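/- Let $\beta>0$, $\delta\ge 0$, $\epsilon>0$, let $\mathbb T^2=(\mathbb R/2\pi\mathbb Z)^2$, and consider the initial value problem $$\eta_t+\eta\,\eta_x+(\beta-1)\eta_{xx}-\eta_{yy}-\delta\Lambda^3\eta+\epsilon\Delta^2\eta=0\quad (t>0),\qquad \eta(0)=\eta_0,$$ for real-valued $\eta$ on $\mathbb T^2$, where $\widehat{\Lambda u}(\xi)=|\xi|\hat u(\xi)$, $\xi\in\mathbb Z^2$. A solution is a function $\eta$ that lies in $C([0,T];H^2(\mathbb T^2))\cap L^2(0,T;H^4(\mathbb T^2))$ for every $T>0$ and satisfies the equation in the sense of distributions in space (with $\eta\eta_x=\tfrac12(\eta^2)_x$), that is, in every Fourier mode, at every $t>0$. Let $$H^2_{\mathrm{od}}(\mathbb T^2)=\{\eta\in H^2(\mathbb T^2): -\eta(-x,y)=\eta(x,y)\}$$ with the norm of $H^2$. For every $\eta_0\in H^2_{\mathrm{od}}(\mathbb T^2)$ there is exactly one solution; it stays in $H^2_{\mathrm{od}}(\mathbb T^2)$, and the solution operators $S(t)\eta_0=\eta(t)$, $t\ge 0$, form a semigroup of continuous maps of $H^2_{\mathrm{od}}(\mathbb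 T^2)$. Call $\mathcal A\subset H^2_{\mathrm{od}}(\mathbb T^2)$ an attractor if $S(t)\mathcal A=\mathcal A$ for all $t\ge0$ and $\mathcal A$ has an open neighbourhood $\mathcal B$ such that $\operatorname{dist}(S(t)\eta_0,\mathcal A)\to0$ as $t\to\infty$ for every $\eta_0\in\mathcal B$. Then there is an attractor $\mathcal A\subset H^2_{\mathrm{od}}(\mathbb T^2)$ that is (non-empty,) compact and connected, that is global, in the sense that for every bounded $B\subset H^2_{\mathrm{od}}(\mathbb T^2)$ and every $r>0$ there is a $T$ such that $S(t)B$ lies in the $r$-neighbourhood of $\mathcal A$ for all $t\ge T$, and that is maximal, in the sense that it contains every bounded attractor. -/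

import Mathlib

open MeasureTheory Filter Topology
open scoped ENNReal

noncomputable section

namespace NonlocalKS

instance factTwoPiPos : Fact ((0 : ℝ) < 2 * Real.pi) := ⟨Real.two_pi_pos⟩

/-- The torus `𝕋² = (ℝ/2πℤ)²`; its `volume` is Lebesgue measure, of total mass `(2π)²`. -/
abbrev Torus : Type := AddCircle (2 * Real.pi) × AddCircle (2 * Real.pi)

/-- Real-valued `L²(𝕋²)`. -/
abbrev L2 : Type := Lp ℝ 2 (volume : Measure Torus)

/-- The Fourier coefficient `(2π)⁻² ∫ e^{-i ξ₁ x - i ξ₂ y} f(x, y) dx dy` of `f : 𝕋² → ℝ`. -/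
def fcoeff (f : Torus → ℝ) (ξ : ℤ × ℤ) : ℂ :=
  ((2 * Real.pi) ^ 2 : ℂ)⁻¹ *
    ∫ z : Torus, fourier (-ξ.1) z.1 * fourier (-ξ.2) z.2 * (f z : ℂ)

/-- The Euclidean length `|ξ|` of a frequency. -/
def freqNorm (ξ : ℤ × ℤ) : ℝ := Real.sqrt ((ξ.1 : ℝ) ^ 2 + (ξ.2 : ℝ) ^ 2)

theorem integrable_char_mul (u : L2) (ξ : ℤ × ℤ) :
    Integrable (fun z : Torus => fourier (-ξ.1) z.1 * fourier (-ξ.2) z.2 * ((u z : ℝ) : ℂ)) := by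
  have hu : Integrable (fun z : Torus => ((u z : ℝ) : ℂ)) :=
    ((Lp.memLp u).integrable (by norm_num)).ofReal
  refine hu.bdd_mul (c := 1) ?_ ?_
  · exact (Continuous.aestronglyMeasurable (by fun_prop))
  · filter_upwards with z
    simp [fourier_apply, Circle.norm_coe]

theorem fcoeff_add (u v : L2) (ξ : ℤ × ℤ) :
    fcoeff (u + v : L2) ξ = fcoeff u ξ + fcoeff v ξ := by
  unfold fcoeff
  rw [← mul_add, ← integral_add (integrable_char_mul u ξ) (integrable_char_mul v ξ)]
  congr 1
  refine integral_congr_ae ?_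
  filter_upwards [Lp.coeFn_add u v] with z hz
  rw [hz]
  simp only [Pi.add_apply, Complex.ofReal_add]
  ring

theorem fcoeff_smul (c : ℝ) (u : L2) (ξ : ℤ × ℤ) :
    fcoeff (c • u : L2) ξ = (c : ℂ) * fcoeff u ξ := by
  unfold fcoeff
  rw [mul_left_comm, ← integral_const_mul (c : ℂ)]
  congr 1
  refine integral_congr_ae ?_
  filter_upwards [Lp.coeFn_smul c u] with z hz
  rw [hz]
  simp only [Pi.smul_apply, smul_eq_mul, Complex.ofReal_mul]
  ring

/-- The Fourier coefficients of `-Δu`, normalised so that their `ℓ²` norm is `‖Δu‖_{L²(𝕋²)}`. -/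
def laplaceSeq (u : L2) : ∀ _ : ℤ × ℤ, ℂ :=
  fun ξ => ((2 * Real.pi * freqNorm ξ ^ 2 : ℝ) : ℂ) * fcoeff u ξ

theorem laplaceSeq_add (u v : L2) : laplaceSeq (u + v) = laplaceSeq u + laplaceSeq v := by
  funext ξ
  simp only [laplaceSeq, fcoeff_add, Pi.add_apply, mul_add]

theorem laplaceSeq_smul (c : ℝ) (u : L2) : laplaceSeq (c • u) = c • laplaceSeq u := by
  funext ξ
  simp only [laplaceSeq, fcoeff_smul, Pi.smul_apply, Complex.real_smul]
  ring

/-- `u ∈ L²` lies in `H²` when `∑ |ξ|⁴ |û(ξ)|² < ∞`. -/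
def IsH2 (u : L2) : Prop := Summable fun ξ : ℤ × ℤ => freqNorm ξ ^ 4 * ‖fcoeff u ξ‖ ^ 2

theorem norm_laplaceSeq_sq (u : L2) (ξ : ℤ × ℤ) :
    ‖laplaceSeq u ξ‖ ^ 2 = (2 * Real.pi) ^ 2 * (freqNorm ξ ^ 4 * ‖fcoeff u ξ‖ ^ 2) := by
  simp only [laplaceSeq, norm_mul, Complex.norm_real, Real.norm_eq_abs, mul_pow, sq_abs]
  ring

theorem isH2_iff (u : L2) : IsH2 u ↔ Memℓp (laplaceSeq u) 2 := by
  rw [memℓp_gen_iff (by norm_num)]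
  have h : (fun ξ => ‖laplaceSeq u ξ‖ ^ (2 : ℝ≥0∞).toReal) =
      fun ξ => (2 * Real.pi) ^ 2 * (freqNorm ξ ^ 4 * ‖fcoeff u ξ‖ ^ 2) := by
    funext ξ
    rw [← norm_laplaceSeq_sq]
    norm_num
  rw [h, summable_mul_left_iff (by positivity)]
  rfl

/-- `H²(𝕋²)` as a linear subspace of `L²(𝕋²)`. -/
def h2Submodule : Submodule ℝ L2 where
  carrier := {u | IsH2 u}
  add_mem' {u v} hu hv := by
    have hu' := (isH2_iff u).1 hu
    have hv' := (isH2_iff v).1 hv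
    refine (isH2_iff _).2 ?_
    rw [laplaceSeq_add]
    exact hu'.add hv'
  zero_mem' := by
    refine (isH2_iff _).2 ?_
    have h : laplaceSeq (0 : L2) = 0 := by
      have := laplaceSeq_smul 0 (0 : L2)
      simpa using this
    rw [h]
    exact zero_memℓp
  smul_mem' c u hu := by
    refine (isH2_iff _).2 ?_
    rw [laplaceSeq_smul]
    exact ((isH2_iff u).1 hu).const_smul c

/-- The Sobolev space `H²(𝕋²)`. It is a type of its own because it carries the `H²` norm below
and not the norm of `L²`. -/
def H2 : Type := h2Submodule

instance : AddCommGroup H2 := inferInstanceAs (AddCommGroup h2Submodule)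
instance : Module ℝ H2 := inferInstanceAs (Module ℝ h2Submodule)

/-- The inclusion `H² → L²`. -/
def H2.toL2 : H2 →ₗ[ℝ] L2 := h2Submodule.subtype

theorem H2.isH2 (u : H2) : IsH2 u.toL2 := u.2

theorem H2.toL2_injective : Function.Injective H2.toL2 := Subtype.val_injective

/-- The linear map `u ↦ (u, Δu)` (the second component through Fourier coefficients) whose
Hilbert-space norm is the `H²` norm. -/
def H2.embed : H2 →ₗ[ℝ] WithLp 2 (L2 × lp (fun _ : ℤ × ℤ => ℂ) 2) where
  toFun u := WithLp.toLp 2 (u.toL2, ⟨laplaceSeq u.toL2, (isH2_iff _).1 u.isH2⟩)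
  map_add' u v := by
    refine WithLp.ofLp_injective 2 (Prod.ext ?_ (Subtype.ext ?_))
    · simp
    · exact laplaceSeq_add u.toL2 v.toL2
  map_smul' c u := by
    refine WithLp.ofLp_injective 2 (Prod.ext ?_ (Subtype.ext ?_))
    · simp
    · exact laplaceSeq_smul c u.toL2

theorem H2.embed_injective : Function.Injective H2.embed := by
  intro u v h
  apply H2.toL2_injective
  exact congrArg (fun p => (WithLp.ofLp p).1) h

instance : NormedAddCommGroup H2 := NormedAddCommGroup.induced H2 _ H2.embed H2.embed_injective
instance : NormedSpace ℝ H2 := NormedSpace.induced ℝ H2 _ H2.embed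

/-- The norm of `H²` is `‖u‖² = ‖u‖²_{L²} + (2π)² ∑ |ξ|⁴ |û(ξ)|² = ‖u‖²_{L²} + ‖Δu‖²_{L²}`. -/
theorem H2.norm_sq (u : H2) :
    ‖u‖ ^ 2 = ‖u.toL2‖ ^ 2 +
      (2 * Real.pi) ^ 2 * ∑' ξ : ℤ × ℤ, freqNorm ξ ^ 4 * ‖fcoeff u.toL2 ξ‖ ^ 2 := by
  have h : ‖u‖ = ‖H2.embed u‖ := rfl
  rw [h, WithLp.prod_norm_sq_eq_of_L2]
  congr 1
  have h2 := lp.norm_rpow_eq_tsum (p := 2) (by norm_num)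
    (⟨laplaceSeq u.toL2, (isH2_iff _).1 u.isH2⟩ : lp (fun _ : ℤ × ℤ => ℂ) 2)
  simp only [ENNReal.toReal_ofNat, Real.rpow_ofNat, norm_laplaceSeq_sq, tsum_mul_left] at h2
  exact h2

/-- The reflection `(x, y) ↦ (-x, y)`. -/
def reflectX (z : Torus) : Torus := (-z.1, z.2)

theorem quasiMeasurePreserving_reflectX :
    Measure.QuasiMeasurePreserving reflectX (volume : Measure Torus) volume :=
  ((Measure.measurePreserving_neg (volume : Measure (AddCircle (2 * Real.pi)))).prod
    (MeasurePreserving.id volume)).quasiMeasurePreserving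

/-- `H²_od(𝕋²)`: the functions in `H²` that are odd in `x`, with the norm of `H²`. -/
def H2od : Submodule ℝ H2 where
  carrier := {u | ∀ᵐ z : Torus, -(u.toL2 (reflectX z)) = u.toL2 z}
  add_mem' {u v} hu hv := by
    have h := Lp.coeFn_add u.toL2 v.toL2
    simp only [Set.mem_ofPred_eq, map_add] at *
    filter_upwards [hu, hv, h, quasiMeasurePreserving_reflectX.ae h] with z h1 h2 h3 h4
    rw [h3, h4, Pi.add_apply, Pi.add_apply, ← h1, ← h2]
    ring
  zero_mem' := by
    have h := Lp.coeFn_zero ℝ 2 (volume : Measure Torus)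
    simp only [Set.mem_ofPred_eq, map_zero]
    filter_upwards [h, quasiMeasurePreserving_reflectX.ae h] with z h3 h4
    rw [h3, h4]
    simp
  smul_mem' c u hu := by
    have h := Lp.coeFn_smul c u.toL2
    simp only [Set.mem_ofPred_eq, map_smul] at *
    filter_upwards [hu, h, quasiMeasurePreserving_reflectX.ae h] with z h1 h3 h4
    rw [h3, h4, Pi.smul_apply, Pi.smul_apply, ← h1]
    simp

/-- The Fourier symbol of `(β - 1) ∂ₓₓ - ∂_yy - δ Λ³ + ε Δ²`. -/
def linSymbol (β δ ε : ℝ) (ξ : ℤ × ℤ) : ℝ :=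
  -(β - 1) * (ξ.1 : ℝ) ^ 2 + (ξ.2 : ℝ) ^ 2 - δ * freqNorm ξ ^ 3 + ε * freqNorm ξ ^ 4

/-- `η : [0, ∞) → H²` is the solution of
`η_t + η η_x + (β - 1) η_xx - η_yy - δ Λ³ η + ε Δ² η = 0` with `η(0) = η₀`, in the class
`C([0, T]; H²) ∩ L²(0, T; H⁴)` for every `T > 0`. The equation is tested against every
exponential `e^{-i ξ·(x, y)}`, with `η η_x = ½ (η²)_x`. Values at negative times are irrelevant. -/
structure IsSolution (β δ ε : ℝ) (η₀ : H2) (η : ℝ → H2) : Prop where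
  initial : η 0 = η₀
  continuousOn : ContinuousOn η (Set.Ici 0)
  l2H4 : ∀ T : ℝ, 0 < T →
    ∫⁻ t in Set.Ioc 0 T, ∑' ξ : ℤ × ℤ,
      ENNReal.ofReal (freqNorm ξ ^ 8 * ‖fcoeff (η t).toL2 ξ‖ ^ 2) < ∞
  equation : ∀ ξ : ℤ × ℤ, ∀ t : ℝ, 0 < t →
    HasDerivAt (fun s => fcoeff (η s).toL2 ξ)
      (-(Complex.I * (ξ.1 : ℂ) / 2 * fcoeff (fun z => (η t).toL2 z ^ 2) ξ
        + (linSymbol β δ ε ξ : ℂ) * fcoeff (η t).toL2 ξ)) t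

/-- `S(t) η₀ = η(t)` for the solution `η` starting at `η₀`: the curve `S(·) η₀` solves the initial
value problem, and it is the only solution with values in `H²`. -/
def IsSolutionOperator (β δ ε : ℝ) (S : ℝ → H2od → H2od) : Prop :=
  ∀ η₀ : H2od, IsSolution β δ ε (η₀ : H2) (fun t => (S t η₀ : H2)) ∧
    ∀ v : ℝ → H2, IsSolution β δ ε (η₀ : H2) v → ∀ t : ℝ, 0 ≤ t → v t = (S t η₀ : H2)

/-- A semigroup of continuous maps (only times `t ≥ 0` matter). -/
structure IsSemiflow {X : Type*} [TopologicalSpace X] (S : ℝ → X → X) : Prop where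
  zero : ∀ u, S 0 u = u
  add : ∀ s t, 0 ≤ s → 0 ≤ t → ∀ u, S (s + t) u = S s (S t u)
  continuous : ∀ t, 0 ≤ t → Continuous (S t)

/-- An attractor: an invariant set that attracts every point of one of its open neighbourhoods. -/
structure IsAttractor {X : Type*} [PseudoMetricSpace X] (S : ℝ → X → X) (A : Set X) : Prop where
  invariant : ∀ t, 0 ≤ t → S t '' A = A
  attracts : ∃ U : Set X, IsOpen U ∧ A ⊆ U ∧
    ∀ u ∈ U, Tendsto (fun t => Metric.infEDist (S t u) A) atTop (𝓝 0)

/-- `A` attracts every bounded set, uniformly on the set. -/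
def AttractsBounded {X : Type*} [PseudoMetricSpace X] (S : ℝ → X → X) (A : Set X) : Prop :=
  ∀ B : Set X, Bornology.IsBounded B → ∀ r : ℝ, 0 < r →
    ∃ T : ℝ, ∀ t, T ≤ t → S t '' B ⊆ Metric.thickening r A

end NonlocalKS

end

/-!
A function on the torus is replaced by its Fourier coefficients `a_ξ`, for which the equation reads
`a_ξ' = -(i ξ₁ / 2 (a * a)_ξ + l_ξ a_ξ)`. Of the real symbol `l` only `IsParabolic` is used: it is
even in each frequency variable and comparable to `1 + |ξ|⁴` up to a constant. The space `H²` is the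
weighted `ℓ²` space with weight `1 + |ξ|⁴` and embeds into the Wiener algebra `ℓ¹`, a convolution
algebra.

*Well-posedness.* Solutions are families of modes with a summable majorant in `ξ` that is uniform in
time (`ModeSol`), that is, elements of `ℓ¹(ℤ²; C_b)`. In the Duhamel formula the one derivative in
the nonlinearity is beaten by the four derivatives of the linear part, so that the Duhamel map is a
contraction for short times (`exists_local`), and solutions are stable and unique
(`ModeSol.stability`, `ModeSol.unique`). By uniqueness real and odd data stay real and odd
(`ModeSol.isOddReal`). The coefficients of `u²` are bounded by `‖u‖²_{L²}`, so a bound in `L²` gives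
a bound in the Wiener algebra (`norm_le_energyEnv`) and in `H²`. This makes solutions global
(`exists_modeSol`), and it makes every solution in the sense of `IsSolution` a `ModeSol`
(`IsSolution.modeSol`), so that uniqueness applies to it.

*Dissipation.* The energy identity alone gives only exponential growth, because the linear part is
unstable at low frequencies. As `u` is odd in `x`, it vanishes at `x = 0`, and the energy can be
measured relative to a background function `φ(x)` with `φ_x = μ - μ F_N`, where `F_N` is the Fejér
kernel. The nonlinearity then contributes `-μ ‖u‖² + μ ∫ u² F_N`, in which the last term is of size
`N⁻¹ ‖Δu‖²` because `F_N` concentrates where `u` vanishes (`norm_sum_fejer_conv_le`). With `μ` larger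
than the growth rate and `N` large enough, the `L²` norm decays exponentially up to a constant
(`exists_energy_le`).

*Attractor.* Trajectories whose energy is bounded have, two units of time later, a common majorant
in `H²` for their coefficients (`exists_smoothing`), and the functions below such a majorant form a
compact set by Tychonoff's theorem (`isCompact_setOf_coef_le`). So there is a compact set that
absorbs all bounded sets, and the intersection of its images under the semiflow is the global
attractor (`IsSemiflow.exists_globalAttractor`). It is connected because it attracts a ball that
contains it, and it contains every bounded invariant set because it attracts that set.
-/

noncomputable section

namespace NonlocalKS

/-! ### Fourier series on the torus -/

/-- The character `e^{i ξ·(x, y)}` of the torus. -/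
def chi (ξ : ℤ × ℤ) : C(Torus, ℂ) :=
  ⟨fun z => fourier ξ.1 z.1 * fourier ξ.2 z.2, by fun_prop⟩

theorem chi_apply (ξ : ℤ × ℤ) (z : Torus) : chi ξ z = fourier ξ.1 z.1 * fourier ξ.2 z.2 := rfl

theorem chi_zero (z : Torus) : chi 0 z = 1 := by simp [chi_apply]

theorem chi_add (ξ ζ : ℤ × ℤ) (z : Torus) : chi (ξ + ζ) z = chi ξ z * chi ζ z := by
  simp only [chi_apply, Prod.fst_add, Prod.snd_add, fourier_add]; ring

theorem chi_neg (ξ : ℤ × ℤ) (z : Torus) : chi (-ξ) z = star (chi ξ z) := by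
  simp [chi_apply]

theorem norm_chi (ξ : ℤ × ℤ) (z : Torus) : ‖chi ξ z‖ = 1 := by
  simp [chi_apply, fourier_apply, Circle.norm_coe]

theorem fcoeff_eq (f : Torus → ℝ) (ξ : ℤ × ℤ) :
    fcoeff f ξ = ((2 * Real.pi) ^ 2 : ℂ)⁻¹ * ∫ z : Torus, chi (-ξ) z * (f z : ℂ) := rfl

theorem integral_fourier (n : ℤ) :
    ∫ x : AddCircle (2 * Real.pi), (fourier n x : ℂ) = if n = 0 then (2 * Real.pi : ℂ) else 0 := by
  split_ifs with h
  · subst h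
    simp [Measure.real, AddCircle.measure_univ, Real.pi_pos.le]
  · exact integral_eq_zero_of_add_right_eq_neg (fourier_add_half_inv_index h Real.two_pi_pos)

theorem integral_chi (ξ : ℤ × ℤ) :
    ∫ z : Torus, chi ξ z = if ξ = 0 then ((2 * Real.pi) ^ 2 : ℂ) else 0 := by
  have h : ∫ z : Torus, chi ξ z = (∫ x : AddCircle (2 * Real.pi), (fourier ξ.1 x : ℂ)) *
      ∫ x : AddCircle (2 * Real.pi), (fourier ξ.2 x : ℂ) :=
    integral_prod_mul (fun x => (fourier ξ.1 x : ℂ)) (fun y => (fourier ξ.2 y : ℂ))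
  rw [h, integral_fourier, integral_fourier]
  obtain ⟨m, n⟩ := ξ
  by_cases hm : m = 0 <;> by_cases hn : n = 0 <;> simp [hm, hn, sq]

/-- The star subalgebra of `C(𝕋², ℂ)` generated by the characters. -/
def chiSubalgebra : StarSubalgebra ℂ C(Torus, ℂ) where
  toSubalgebra := Algebra.adjoin ℂ (Set.range chi)
  star_mem' := by
    change Algebra.adjoin ℂ (Set.range chi) ≤ star (Algebra.adjoin ℂ (Set.range chi))
    refine Algebra.adjoin_le ?_
    rintro _ ⟨n, rfl⟩
    refine Algebra.subset_adjoin ⟨-n, ?_⟩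
    ext1 x
    rw [chi_neg]; rfl

theorem chiSubalgebra_coe :
    chiSubalgebra.toSubalgebra.toSubmodule = Submodule.span ℂ (Set.range chi) := by
  apply Algebra.adjoin_eq_span_of_subset
  refine .trans (fun x ↦ Submonoid.closure_induction (fun _ ↦ id) ⟨0, ?_⟩ ?_)
    Submodule.subset_span
  · ext z
    simp [chi_zero]
  · rintro _ _ _ _ ⟨m, rfl⟩ ⟨n, rfl⟩
    exact ⟨m + n, by ext z; simp [chi_add]⟩

theorem chiSubalgebra_separatesPoints : chiSubalgebra.SeparatesPoints := by
  have hinj : Function.Injective (AddCircle.toCircle (T := 2 * Real.pi)) :=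
    AddCircle.injective_toCircle Real.two_pi_pos.ne'
  intro x y hxy
  by_cases h1 : x.1 = y.1
  · have h2 : x.2 ≠ y.2 := fun h => hxy (Prod.ext h1 h)
    refine ⟨_, ⟨chi (0, 1), Algebra.subset_adjoin ⟨(0, 1), rfl⟩, rfl⟩, ?_⟩
    simp only [chi_apply, fourier_zero, fourier_one, one_mul, ne_eq, Circle.coe_inj]
    exact fun h => h2 (hinj h)
  · refine ⟨_, ⟨chi (1, 0), Algebra.subset_adjoin ⟨(1, 0), rfl⟩, rfl⟩, ?_⟩
    simp only [chi_apply, fourier_zero, fourier_one, mul_one, ne_eq, Circle.coe_inj]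
    exact fun h => h1 (hinj h)

theorem span_chi_closure_eq_top :
    (Submodule.span ℂ (Set.range chi)).topologicalClosure = ⊤ := by
  rw [← chiSubalgebra_coe]
  exact congr_arg (Subalgebra.toSubmodule <| StarSubalgebra.toSubalgebra ·)
    (ContinuousMap.starSubalgebra_topologicalClosure_eq_top_of_separatesPoints _
      chiSubalgebra_separatesPoints)

theorem L2.integrable_ofReal (u : L2) : Integrable (fun z : Torus => ((u z : ℝ) : ℂ)) :=
  ((Lp.memLp u).integrable (by norm_num)).ofReal

/-- A function in `L²(𝕋²)` is determined by its Fourier coefficients. -/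
theorem eq_zero_of_fcoeff_eq_zero (u : L2) (h : ∀ ξ, fcoeff u ξ = 0) : u = 0 := by
  have hint : ∀ g : C(Torus, ℂ), Integrable (fun z => g z * ((u z : ℝ) : ℂ)) := fun g =>
    u.integrable_ofReal.bdd_mul (c := ‖g‖) g.continuous.aestronglyMeasurable
      (Eventually.of_forall g.norm_coe_le_norm)
  let φ : C(Torus, ℂ) →ₗ[ℂ] ℂ :=
    { toFun := fun g => ∫ z : Torus, g z * ((u z : ℝ) : ℂ)
      map_add' := fun g g' => by
        rw [← integral_add (hint g) (hint g')]
        simp [add_mul]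
      map_smul' := fun c g => by
        simp only [RingHom.id_apply, smul_eq_mul]
        rw [← integral_const_mul]
        simp [mul_assoc] }
  have hφc : Continuous φ := by
    refine (LinearMap.mkContinuous φ (∫ z : Torus, ‖((u z : ℝ) : ℂ)‖) fun g => ?_).continuous
    rw [← integral_mul_const]
    refine norm_integral_le_of_norm_le (u.integrable_ofReal.norm.mul_const _)
      (Eventually.of_forall fun z => ?_)
    rw [norm_mul, mul_comm]
    gcongr
    exact g.norm_coe_le_norm z
  have hφ0 : ∀ g, φ g = 0 := by
    have hker : (Submodule.span ℂ (Set.range chi)).topologicalClosure ≤ LinearMap.ker φ := by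
      refine Submodule.topologicalClosure_minimal _ ?_ (isClosed_singleton.preimage hφc)
      rw [Submodule.span_le]
      rintro _ ⟨ξ, rfl⟩
      have := h (-ξ)
      rw [fcoeff_eq, neg_neg] at this
      exact (mul_eq_zero.1 this).resolve_left (by simp [Real.pi_ne_zero])
    intro g
    rw [span_chi_closure_eq_top] at hker
    exact hker trivial
  have hreal : ∀ g : C(Torus, ℝ), inner ℝ (ContinuousMap.toLp 2 volume ℝ g) u = (0 : ℝ) := by
    intro g
    rw [L2.inner_def]
    have h1 := hφ0 ⟨fun z => ((g z : ℝ) : ℂ), by fun_prop⟩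
    have h2 : (∫ z : Torus, ((g z * u z : ℝ) : ℂ)) = 0 := by
      rw [← h1]; simp [φ]
    rw [integral_complex_ofReal, Complex.ofReal_eq_zero] at h2
    rw [← h2]
    refine integral_congr_ae ?_
    filter_upwards [ContinuousMap.coeFn_toLp (p := 2) (𝕜 := ℝ) volume g] with z hz
    rw [hz, real_inner_comm]
    rfl
  have hd := ContinuousMap.toLp_denseRange ℝ (volume : Measure Torus) ℝ
    (show (2 : ℝ≥0∞) ≠ ∞ by norm_num)
  refine hd.eq_zero_of_inner_left (𝕜 := ℝ) ?_
  intro g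
  rw [real_inner_comm]
  exact hreal g

theorem fcoeff_injective {u v : L2} (h : ∀ ξ, fcoeff u ξ = fcoeff v ξ) : u = v := by
  rw [← sub_eq_zero]
  refine eq_zero_of_fcoeff_eq_zero _ fun ξ => ?_
  have h1 : u - v = u + (-1 : ℝ) • v := by rw [neg_one_smul, sub_eq_add_neg]
  rw [h1, fcoeff_add, fcoeff_smul, h]
  push_cast
  ring

theorem fcoeff_congr {f g : Torus → ℝ} (h : f =ᵐ[volume] g) (ξ : ℤ × ℤ) :
    fcoeff f ξ = fcoeff g ξ := by
  rw [fcoeff_eq, fcoeff_eq]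
  congr 1
  refine integral_congr_ae ?_
  filter_upwards [h] with z hz
  rw [hz]

/-- The coefficients of a real function are Hermitian. -/
theorem fcoeff_neg (f : Torus → ℝ) (ξ : ℤ × ℤ) : fcoeff f (-ξ) = star (fcoeff f ξ) := by
  rw [fcoeff_eq, fcoeff_eq, star_mul', ← starRingEnd_apply, ← starRingEnd_apply, ← integral_conj]
  congr 1
  · have h : ((2 * Real.pi) ^ 2 : ℂ)⁻¹ = ((((2 * Real.pi) ^ 2)⁻¹ : ℝ) : ℂ) := by push_cast; rfl
    rw [h, Complex.conj_ofReal]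
  · refine integral_congr_ae (Eventually.of_forall fun z => ?_)
    simp [chi_neg, mul_comm]

theorem measurePreserving_reflectX :
    MeasurePreserving reflectX (volume : Measure Torus) volume :=
  (Measure.measurePreserving_neg (volume : Measure (AddCircle (2 * Real.pi)))).prod
    (MeasurePreserving.id volume)

theorem chi_reflectX (ξ : ℤ × ℤ) (z : Torus) : chi ξ (reflectX z) = chi (-ξ.1, ξ.2) z := by
  simp [chi_apply, reflectX, fourier_apply]

theorem fcoeff_reflectX (f : Torus → ℝ) (ξ : ℤ × ℤ) :
    fcoeff (fun z => f (reflectX z)) ξ = fcoeff f (-ξ.1, ξ.2) := by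
  rw [fcoeff_eq, fcoeff_eq]
  congr 1
  have hemb : MeasurableEmbedding reflectX :=
    (((Homeomorph.neg (AddCircle (2 * Real.pi))).prodCongr
      (Homeomorph.refl _)).toMeasurableEquiv).measurableEmbedding
  rw [← measurePreserving_reflectX.integral_comp hemb]
  refine integral_congr_ae (Eventually.of_forall fun z => ?_)
  simp only [chi_reflectX]
  simp [reflectX]

/-! ### Functions with summable Fourier coefficients -/

/-- The sum of the Fourier series with coefficients `a`. -/
def synth (a : ℤ × ℤ → ℂ) (z : Torus) : ℂ := ∑' ξ, a ξ * chi ξ z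

/-- The discrete convolution, which is the Fourier side of the pointwise product. -/
def conv {R : Type*} [NonUnitalNonAssocSemiring R] [TopologicalSpace R] (a b : ℤ × ℤ → R)
    (ξ : ℤ × ℤ) : R := ∑' ζ, a ζ * b (ξ - ζ)

theorem continuous_synth {a : ℤ × ℤ → ℂ} (ha : Summable fun ξ => ‖a ξ‖) :
    Continuous (synth a) :=
  continuous_tsum (fun ξ => by fun_prop) ha fun ξ z => by simp [norm_chi]

theorem integral_synth_mul {a : ℤ × ℤ → ℂ} (ha : Summable fun ξ => ‖a ξ‖) {g : Torus → ℂ}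
    (hg : Integrable g) :
    ∫ z, synth a z * g z = ∑' ξ, a ξ * ∫ z : Torus, chi ξ z * g z := by
  have hi : ∀ ξ, Integrable fun z => a ξ * (chi ξ z * g z) := fun ξ =>
    (hg.bdd_mul (c := 1) (chi ξ).continuous.aestronglyMeasurable
      (Eventually.of_forall fun z => (norm_chi ξ z).le)).const_mul _
  have h := hasSum_integral_of_summable_integral_norm (F := fun ξ z => a ξ * (chi ξ z * g z)) hi (by
    simp only [norm_mul, norm_chi, one_mul, integral_const_mul]
    exact ha.mul_right _)
  rw [show (fun z => synth a z * g z) = fun z => ∑' ξ, a ξ * (chi ξ z * g z) by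
    funext z; simp only [synth, ← tsum_mul_right, mul_assoc], ← h.tsum_eq]
  simp only [integral_const_mul]

theorem integral_chi_mul_synth {a : ℤ × ℤ → ℂ} (ha : Summable fun ξ => ‖a ξ‖) (ξ : ℤ × ℤ) :
    ∫ z : Torus, chi (-ξ) z * synth a z = (2 * Real.pi) ^ 2 * a ξ := by
  have h := integral_synth_mul ha (g := fun z : Torus => chi (-ξ) z)
    ((chi (-ξ)).continuous.integrable_of_hasCompactSupport (HasCompactSupport.of_compactSpace _))
  simp only [mul_comm (chi (-ξ) _)]
  rw [h, tsum_eq_single ξ]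
  · simp only [← chi_add, integral_chi, add_neg_cancel, if_true]; ring
  · intro ζ hζ
    simp only [← chi_add, integral_chi]
    rw [if_neg (by rwa [← sub_eq_add_neg, sub_eq_zero]), mul_zero]

theorem star_synth {a : ℤ × ℤ → ℂ} (hh : ∀ ξ, a (-ξ) = star (a ξ)) (z : Torus) :
    star (synth a z) = synth a z := by
  rw [synth, tsum_star, ← (Equiv.neg (ℤ × ℤ)).tsum_eq]
  refine tsum_congr fun ξ => ?_
  simp [hh, chi_neg]

theorem ofReal_re_synth {a : ℤ × ℤ → ℂ} (hh : ∀ ξ, a (-ξ) = star (a ξ)) (z : Torus) :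
    (((synth a z).re : ℝ) : ℂ) = synth a z :=
  Complex.conj_eq_iff_re.1 (star_synth hh z)

theorem fcoeff_re_synth {a : ℤ × ℤ → ℂ} (ha : Summable fun ξ => ‖a ξ‖)
    (hh : ∀ ξ, a (-ξ) = star (a ξ)) (ξ : ℤ × ℤ) : fcoeff (fun z => (synth a z).re) ξ = a ξ := by
  rw [fcoeff_eq]
  simp only [ofReal_re_synth hh]
  rw [integral_chi_mul_synth ha, inv_mul_cancel_left₀]
  simp [Real.pi_ne_zero]

theorem fcoeff_sq_re_synth {a : ℤ × ℤ → ℂ} (ha : Summable fun ξ => ‖a ξ‖)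
    (hh : ∀ ξ, a (-ξ) = star (a ξ)) (ξ : ℤ × ℤ) :
    fcoeff (fun z => (synth a z).re ^ 2) ξ = conv a a ξ := by
  rw [fcoeff_eq]
  simp only [Complex.ofReal_pow, ofReal_re_synth hh]
  have h := integral_synth_mul ha (g := fun z : Torus => chi (-ξ) z * synth a z)
    (((chi (-ξ)).continuous.mul (continuous_synth ha)).integrable_of_hasCompactSupport
      (HasCompactSupport.of_compactSpace _))
  have h2 : ∀ ζ, ∫ z : Torus, chi ζ z * (chi (-ξ) z * synth a z) =
      (2 * Real.pi) ^ 2 * a (ξ - ζ) := by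
    intro ζ
    rw [← integral_chi_mul_synth ha, neg_sub, sub_eq_add_neg]
    simp only [← mul_assoc, ← chi_add]
  rw [show (∫ z : Torus, chi (-ξ) z * synth a z ^ 2) =
    ∫ z, synth a z * (chi (-ξ) z * synth a z) by congr 1; funext z; ring, h]
  simp only [h2, mul_left_comm (a _), tsum_mul_left]
  rw [inv_mul_cancel_left₀, conv]
  simp [Real.pi_ne_zero]

/-- The element of `L²(𝕋²)` with a prescribed summable sequence of coefficients. -/
def synthL2 (a : ℤ × ℤ → ℂ) (ha : Summable fun ξ => ‖a ξ‖) : L2 :=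
  ContinuousMap.toLp 2 volume ℝ
    ⟨fun z => (synth a z).re, Complex.continuous_re.comp (continuous_synth ha)⟩

theorem coeFn_synthL2 {a : ℤ × ℤ → ℂ} (ha : Summable fun ξ => ‖a ξ‖) :
    synthL2 a ha =ᵐ[volume] fun z => (synth a z).re :=
  ContinuousMap.coeFn_toLp (p := 2) (𝕜 := ℝ) volume _

theorem fcoeff_synthL2 {a : ℤ × ℤ → ℂ} (ha : Summable fun ξ => ‖a ξ‖)
    (hh : ∀ ξ, a (-ξ) = star (a ξ)) (ξ : ℤ × ℤ) : fcoeff (synthL2 a ha) ξ = a ξ := by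
  rw [fcoeff_congr (coeFn_synthL2 ha), fcoeff_re_synth ha hh]

/-- A function in `L²` with summable coefficients is the sum of its Fourier series. -/
theorem coeFn_eq_synth (u : L2) (hu : Summable fun ξ => ‖fcoeff u ξ‖) :
    u =ᵐ[volume] fun z => (synth (fcoeff u) z).re := by
  have h : u = synthL2 (fcoeff u) hu :=
    fcoeff_injective fun ξ => (fcoeff_synthL2 hu (fcoeff_neg u) ξ).symm
  have h2 := coeFn_synthL2 hu
  rwa [← h] at h2

theorem fcoeff_sq (u : L2) (hu : Summable fun ξ => ‖fcoeff u ξ‖) (ξ : ℤ × ℤ) :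
    fcoeff (fun z => u z ^ 2) ξ = conv (fcoeff u) (fcoeff u) ξ := by
  rw [← fcoeff_sq_re_synth hu (fcoeff_neg u)]
  refine fcoeff_congr ?_ ξ
  filter_upwards [coeFn_eq_synth u hu] with z hz
  rw [hz]

theorem L2.norm_sq_eq_tsum (u : L2) (hu : Summable fun ξ => ‖fcoeff u ξ‖) :
    ‖u‖ ^ 2 = (2 * Real.pi) ^ 2 * ∑' ξ, ‖fcoeff u ξ‖ ^ 2 := by
  have h0 := fcoeff_sq u hu 0
  rw [fcoeff_eq, conv] at h0
  have h1 : ∀ ζ, fcoeff u ζ * fcoeff u (0 - ζ) = ((‖fcoeff u ζ‖ ^ 2 : ℝ) : ℂ) := by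
    intro ζ
    rw [zero_sub, fcoeff_neg, Complex.star_def, Complex.mul_conj, Complex.normSq_eq_norm_sq]
  simp only [h1, neg_zero, chi_zero, one_mul, integral_complex_ofReal] at h0
  rw [← Complex.ofReal_tsum] at h0
  have h2 : ‖u‖ ^ 2 = ∫ z : Torus, u z ^ 2 := by
    rw [← real_inner_self_eq_norm_sq, L2.inner_def]
    simp [sq]
  have hpi : ((2 * Real.pi) ^ 2 : ℂ) ≠ 0 := by simp [Real.pi_ne_zero]
  rw [h2]
  rw [inv_mul_eq_iff_eq_mul₀ hpi] at h0
  exact_mod_cast h0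

/-- Oddness in `x`, read on the Fourier coefficients. -/
theorem odd_iff_fcoeff (u : L2) (hu : Summable fun ξ => ‖fcoeff u ξ‖) :
    (∀ᵐ z : Torus, -(u (reflectX z)) = u z) ↔ ∀ ξ, fcoeff u (-ξ.1, ξ.2) = -fcoeff u ξ := by
  constructor
  · intro h ξ
    rw [← fcoeff_reflectX, ← neg_eq_iff_eq_neg, ← fcoeff_congr (f := fun z => -u (reflectX z)) h ξ,
      fcoeff_eq, fcoeff_eq, ← mul_neg, ← integral_neg]
    simp
  · intro h
    have hs : ∀ z, synth (fcoeff u) (reflectX z) = -synth (fcoeff u) z := by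
      intro z
      rw [synth, synth, ← tsum_neg,
        ← ((Equiv.neg ℤ).prodCongr (Equiv.refl ℤ)).tsum_eq (fun ξ => -(fcoeff u ξ * chi ξ z))]
      refine tsum_congr fun ξ => ?_
      have := h ξ
      simp only [chi_reflectX, Equiv.prodCongr_apply, Equiv.neg_apply, Equiv.coe_refl, Prod.map, id]
      rw [this]
      ring
    have h2 := coeFn_eq_synth u hu
    filter_upwards [h2, quasiMeasurePreserving_reflectX.ae h2] with z h3 h4
    rw [h3, h4, hs]
    simp

/-! ### Weights and convolutions on the frequency lattice -/

/-- The weight `1 + |ξ|⁴`: the `H²` norm is, up to a factor `2π`, the `ℓ²` norm with this weight. -/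
def wt (ξ : ℤ × ℤ) : ℝ := 1 + freqNorm ξ ^ 4

theorem freqNorm_nonneg (ξ : ℤ × ℤ) : 0 ≤ freqNorm ξ := Real.sqrt_nonneg _

theorem freqNorm_sq (ξ : ℤ × ℤ) : freqNorm ξ ^ 2 = (ξ.1 : ℝ) ^ 2 + (ξ.2 : ℝ) ^ 2 :=
  Real.sq_sqrt (by positivity)

theorem abs_fst_le_freqNorm (ξ : ℤ × ℤ) : |(ξ.1 : ℝ)| ≤ freqNorm ξ :=
  Real.abs_le_sqrt (by nlinarith [sq_nonneg (ξ.2 : ℝ)])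

theorem freqNorm_neg (ξ : ℤ × ℤ) : freqNorm (-ξ) = freqNorm ξ := by simp [freqNorm]

theorem freqNorm_reflect (ξ : ℤ × ℤ) : freqNorm (-ξ.1, ξ.2) = freqNorm ξ := by simp [freqNorm]

theorem freqNorm_add_le (ξ ζ : ℤ × ℤ) : freqNorm (ξ + ζ) ≤ freqNorm ξ + freqNorm ζ := by
  refine Real.sqrt_le_iff.2 ⟨add_nonneg (freqNorm_nonneg _) (freqNorm_nonneg _), ?_⟩
  have h : (ξ.1 * ζ.1 + ξ.2 * ζ.2 : ℝ) ≤ freqNorm ξ * freqNorm ζ := by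
    rw [freqNorm, freqNorm, ← Real.sqrt_mul (by positivity)]
    refine Real.le_sqrt_of_sq_le ?_
    nlinarith [sq_nonneg (ξ.1 * ζ.2 - ξ.2 * ζ.1 : ℝ)]
  simp only [Prod.fst_add, Prod.snd_add, Int.cast_add]
  nlinarith [freqNorm_sq ξ, freqNorm_sq ζ]

theorem wt_pos (ξ : ℤ × ℤ) : 0 < wt ξ := by
  have := freqNorm_nonneg ξ
  unfold wt
  positivity

theorem one_le_wt (ξ : ℤ × ℤ) : 1 ≤ wt ξ := by
  have := pow_nonneg (freqNorm_nonneg ξ) 4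
  unfold wt
  linarith

theorem freqNorm_pow_le_wt (ξ : ℤ × ℤ) {k : ℕ} (hk : k ≤ 4) : freqNorm ξ ^ k ≤ wt ξ := by
  rcases le_total (freqNorm ξ) 1 with h | h
  · exact (pow_le_one₀ (freqNorm_nonneg ξ) h).trans (one_le_wt ξ)
  · exact (pow_le_pow_right₀ h hk).trans (by unfold wt; linarith)

theorem summable_int_rpow : Summable fun n : ℤ => (1 + (n : ℝ) ^ 2) ^ (-(3 / 4) : ℝ) := by
  have h1 : Summable fun n : ℤ => |(n : ℝ)| ^ (-(3 / 2) : ℝ) :=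
    Real.summable_abs_int_rpow (by norm_num)
  have h2 : Summable fun n : ℤ => if n = 0 then (1 : ℝ) else 0 :=
    summable_of_ne_finset_zero (s := {0}) (fun n hn => by simpa using hn)
  refine Summable.of_nonneg_of_le (fun n => by positivity) (fun n => ?_) (h1.add h2)
  by_cases hn : n = 0
  · subst hn; norm_num
  · have hn' : 0 < |(n : ℝ)| := abs_pos.2 (Int.cast_ne_zero.2 hn)
    rw [if_neg hn, add_zero, show (-(3 / 2) : ℝ) = (2 : ℕ) * (-(3 / 4)) by norm_num,
      Real.rpow_mul hn'.le, Real.rpow_natCast, sq_abs]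
    exact Real.rpow_le_rpow_of_nonpos (by positivity) (by linarith) (by norm_num)

theorem summable_rpow_freqNorm :
    Summable fun ξ : ℤ × ℤ => (1 + freqNorm ξ ^ 2) ^ (-(3 / 2) : ℝ) := by
  have h := summable_int_rpow.mul_of_nonneg summable_int_rpow
    (fun n => by positivity) (fun n => by positivity)
  refine Summable.of_nonneg_of_le (fun n => by have := freqNorm_nonneg n; positivity)
    (fun ξ => ?_) h
  rw [← Real.mul_rpow (by positivity) (by positivity),
    show (-(3 / 2) : ℝ) = (2 : ℕ) * (-(3 / 4)) by norm_num, Real.rpow_mul (by positivity),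
    Real.rpow_natCast, freqNorm_sq]
  refine Real.rpow_le_rpow_of_nonpos (by positivity) ?_ (by norm_num)
  nlinarith [sq_nonneg (ξ.1 : ℝ), sq_nonneg (ξ.2 : ℝ)]

/-- The sequence `(1 + |ξ|) / (1 + |ξ|⁴) ~ |ξ|⁻³` is summable over the two-dimensional lattice. -/
theorem summable_freqNorm_div_wt : Summable fun ξ : ℤ × ℤ => (1 + freqNorm ξ) / wt ξ := by
  refine Summable.of_nonneg_of_le
    (fun ξ => div_nonneg (by linarith [freqNorm_nonneg ξ]) (wt_pos ξ).le)
    (fun ξ => ?_) (summable_rpow_freqNorm.mul_left 4)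
  have hr := freqNorm_nonneg ξ
  set r := freqNorm ξ with hrdef
  have h1 : (0 : ℝ) < 1 + r ^ 2 := by positivity
  have h2 : (1 + r ^ 2) ^ (-(3 / 2) : ℝ) = Real.sqrt (1 + r ^ 2) / (1 + r ^ 2) ^ 2 := by
    rw [Real.sqrt_eq_rpow, ← Real.rpow_natCast (1 + r ^ 2) 2, ← Real.rpow_sub h1]
    norm_num
  have h3 : 1 + r ≤ 2 * Real.sqrt (1 + r ^ 2) := by
    have ha : 1 ≤ Real.sqrt (1 + r ^ 2) := Real.one_le_sqrt.2 (by nlinarith)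
    have hb : r ≤ Real.sqrt (1 + r ^ 2) := Real.le_sqrt_of_sq_le (by linarith)
    linarith
  rw [h2, ← mul_div_assoc, div_le_div_iff₀ (wt_pos ξ) (by positivity)]
  have h4 : (1 + r ^ 2) ^ 2 ≤ 2 * wt ξ := by
    unfold wt; rw [← hrdef]; nlinarith [sq_nonneg (r ^ 2 - 1)]
  calc (1 + r) * (1 + r ^ 2) ^ 2 ≤ (2 * Real.sqrt (1 + r ^ 2)) * (2 * wt ξ) := by gcongr
    _ = _ := by ring

theorem summable_inv_wt : Summable fun ξ : ℤ × ℤ => (wt ξ)⁻¹ := by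
  refine Summable.of_nonneg_of_le (fun ξ => (inv_pos.2 (wt_pos ξ)).le) (fun ξ => ?_)
    summable_freqNorm_div_wt
  rw [inv_eq_one_div]
  have := wt_pos ξ
  gcongr
  linarith [freqNorm_nonneg ξ]

/-- The Cauchy–Schwarz inequality for series of nonnegative terms. -/
theorem tsum_mul_sq_le {ι : Type*} {f g : ι → ℝ} (hf0 : ∀ i, 0 ≤ f i) (hg0 : ∀ i, 0 ≤ g i)
    (hf : Summable fun i => f i ^ 2) (hg : Summable fun i => g i ^ 2) :
    (Summable fun i => f i * g i) ∧ (∑' i, f i * g i) ^ 2 ≤ (∑' i, f i ^ 2) * ∑' i, g i ^ 2 := by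
  have h2 := Real.inner_le_Lp_mul_Lq_tsum_of_nonneg (p := 2) (q := 2)
    ⟨by norm_num, by norm_num, by norm_num⟩ hf0 hg0 (by simpa using hf) (by simpa using hg)
  refine ⟨Summable.of_nonneg_of_le (fun i => mul_nonneg (hf0 i) (hg0 i))
    (fun i => by nlinarith [sq_nonneg (f i - g i), sq_nonneg (f i + g i)]) (hf.add hg), ?_⟩
  simp only [Real.rpow_ofNat, ← Real.sqrt_eq_rpow] at h2
  have h0 : 0 ≤ ∑' i, f i * g i := tsum_nonneg fun i => mul_nonneg (hf0 i) (hg0 i)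
  calc (∑' i, f i * g i) ^ 2 ≤ (√(∑' i, f i ^ 2) * √(∑' i, g i ^ 2)) ^ 2 := by gcongr
    _ = _ := by
      rw [mul_pow, Real.sq_sqrt (tsum_nonneg fun _ => by positivity),
        Real.sq_sqrt (tsum_nonneg fun _ => by positivity)]

theorem summable_sq_of_summable {ι : Type*} {A : ι → ℝ} (h0 : ∀ i, 0 ≤ A i) (hA : Summable A) :
    (Summable fun i => A i ^ 2) ∧ ∑' i, A i ^ 2 ≤ (∑' i, A i) ^ 2 := by
  have hle : ∀ i, A i ^ 2 ≤ (∑' i, A i) * A i := fun i => by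
    rw [sq]
    exact mul_le_mul_of_nonneg_right (hA.le_tsum i fun j _ => h0 j) (h0 i)
  have hs : Summable fun i => A i ^ 2 :=
    Summable.of_nonneg_of_le (fun i => by positivity) hle (hA.mul_left _)
  refine ⟨hs, (hs.tsum_le_tsum hle (hA.mul_left _)).trans ?_⟩
  rw [tsum_mul_left, sq]

/-- The embedding of `H²(𝕋²)` into the Wiener algebra. -/
theorem summable_of_wt_sq {A : ℤ × ℤ → ℝ} (h0 : ∀ ξ, 0 ≤ A ξ)
    (hA : Summable fun ξ => wt ξ * A ξ ^ 2) :
    Summable A ∧ (∑' ξ, A ξ) ^ 2 ≤ (∑' ξ, (wt ξ)⁻¹) * ∑' ξ, wt ξ * A ξ ^ 2 := by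
  have hw := wt_pos
  have h := tsum_mul_sq_le (f := fun ξ => √(wt ξ)⁻¹) (g := fun ξ => √(wt ξ) * A ξ)
    (fun ξ => by positivity) (fun ξ => mul_nonneg (by positivity) (h0 ξ))
    (by simpa only [fun ξ => Real.sq_sqrt (inv_pos.2 (hw ξ)).le] using summable_inv_wt)
    (by simpa only [mul_pow, fun ξ => Real.sq_sqrt (hw ξ).le] using hA)
  have h1 : ∀ ξ, √(wt ξ)⁻¹ * (√(wt ξ) * A ξ) = A ξ := fun ξ => by
    rw [← mul_assoc, ← Real.sqrt_mul (inv_pos.2 (hw ξ)).le, inv_mul_cancel₀ (hw ξ).ne',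
      Real.sqrt_one, one_mul]
  simp only [h1, mul_pow, fun ξ => Real.sq_sqrt (inv_pos.2 (hw ξ)).le,
    fun ξ => Real.sq_sqrt (hw ξ).le] at h
  exact h

section Convolution

variable {A B : ℤ × ℤ → ℝ}

/-- The change of variables `(ξ, ζ) ↦ (ζ, ξ - ζ)` of pairs of frequencies. -/
def convEquiv : (ℤ × ℤ) × (ℤ × ℤ) ≃ (ℤ × ℤ) × (ℤ × ℤ) where
  toFun p := (p.2, p.1 - p.2)
  invFun p := (p.1 + p.2, p.1)
  left_inv p := by ext <;> simp
  right_inv p := by ext <;> simp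

theorem summable_conv_prod (hA0 : ∀ ξ, 0 ≤ A ξ) (hB0 : ∀ ξ, 0 ≤ B ξ) (hA : Summable A)
    (hB : Summable B) :
    Summable fun p : (ℤ × ℤ) × (ℤ × ℤ) => A p.2 * B (p.1 - p.2) :=
  convEquiv.summable_iff (f := fun p : (ℤ × ℤ) × (ℤ × ℤ) => A p.1 * B p.2) |>.2
    (hA.mul_of_nonneg hB hA0 hB0)

theorem summable_mul_sub (hA0 : ∀ ξ, 0 ≤ A ξ) (hB0 : ∀ ξ, 0 ≤ B ξ) (hA : Summable A)
    (hB : Summable B) (ξ : ℤ × ℤ) : Summable fun ζ => A ζ * B (ξ - ζ) :=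
  (summable_conv_prod hA0 hB0 hA hB).prod_factor ξ

theorem summable_conv (hA0 : ∀ ξ, 0 ≤ A ξ) (hB0 : ∀ ξ, 0 ≤ B ξ) (hA : Summable A)
    (hB : Summable B) : Summable (conv A B) :=
  (summable_conv_prod hA0 hB0 hA hB).prod

theorem tsum_conv (hA0 : ∀ ξ, 0 ≤ A ξ) (hB0 : ∀ ξ, 0 ≤ B ξ) (hA : Summable A)
    (hB : Summable B) : ∑' ξ, conv A B ξ = (∑' ξ, A ξ) * ∑' ξ, B ξ := by
  have h := hA.mul_of_nonneg hB hA0 hB0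
  rw [hA.tsum_mul_tsum hB h, ← convEquiv.tsum_eq]
  exact ((summable_conv_prod hA0 hB0 hA hB).tsum_prod).symm

theorem conv_nonneg (hA0 : ∀ ξ, 0 ≤ A ξ) (hB0 : ∀ ξ, 0 ≤ B ξ) (ξ : ℤ × ℤ) : 0 ≤ conv A B ξ :=
  tsum_nonneg fun ζ => mul_nonneg (hA0 ζ) (hB0 _)

theorem summable_conv_of_le {a b : ℤ × ℤ → ℂ} (hA : Summable A) (hB : Summable B)
    (ha : ∀ ξ, ‖a ξ‖ ≤ A ξ) (hb : ∀ ξ, ‖b ξ‖ ≤ B ξ) (ξ : ℤ × ℤ) :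
    Summable fun ζ => a ζ * b (ξ - ζ) := by
  have hA0 : ∀ ξ, 0 ≤ A ξ := fun ξ => (norm_nonneg _).trans (ha ξ)
  have hB0 : ∀ ξ, 0 ≤ B ξ := fun ξ => (norm_nonneg _).trans (hb ξ)
  refine Summable.of_norm_bounded (summable_mul_sub hA0 hB0 hA hB ξ) fun ζ => ?_
  rw [norm_mul]
  exact mul_le_mul (ha _) (hb _) (norm_nonneg _) (hA0 _)

theorem norm_conv_le {a b : ℤ × ℤ → ℂ} (hA : Summable A) (hB : Summable B)
    (ha : ∀ ξ, ‖a ξ‖ ≤ A ξ) (hb : ∀ ξ, ‖b ξ‖ ≤ B ξ) (ξ : ℤ × ℤ) :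
    ‖conv a b ξ‖ ≤ conv A B ξ := by
  have hA0 : ∀ ξ, 0 ≤ A ξ := fun ξ => (norm_nonneg _).trans (ha ξ)
  have hB0 : ∀ ξ, 0 ≤ B ξ := fun ξ => (norm_nonneg _).trans (hb ξ)
  refine tsum_of_norm_bounded (summable_mul_sub hA0 hB0 hA hB ξ).hasSum fun ζ => ?_
  rw [norm_mul]
  exact mul_le_mul (ha _) (hb _) (norm_nonneg _) (hA0 _)

theorem norm_conv_self_sub_le {W : ℤ × ℤ → ℝ} {a b : ℤ × ℤ → ℂ} (hA : Summable A)
    (hB : Summable B) (hW : Summable W) (ha : ∀ ξ, ‖a ξ‖ ≤ A ξ) (hb : ∀ ξ, ‖b ξ‖ ≤ B ξ)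
    (hab : ∀ ξ, ‖a ξ - b ξ‖ ≤ W ξ) (ξ : ℤ × ℤ) :
    ‖conv a a ξ - conv b b ξ‖ ≤ conv W A ξ + conv B W ξ := by
  have h1 := summable_conv_of_le hA hA ha ha ξ
  have h2 := summable_conv_of_le hB hB hb hb ξ
  have h3 := summable_conv_of_le (a := fun ξ => a ξ - b ξ) hW hA hab ha ξ
  have h4 := summable_conv_of_le (b := fun ξ => a ξ - b ξ) hB hW hb hab ξ
  have : conv a a ξ - conv b b ξ =
      conv (fun ξ => a ξ - b ξ) a ξ + conv b (fun ξ => a ξ - b ξ) ξ := by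
    simp only [conv]
    rw [← h1.tsum_sub h2, ← h3.tsum_add h4]
    exact tsum_congr fun ζ => by ring
  rw [this]
  exact (norm_add_le _ _).trans
    (add_le_add (norm_conv_le hW hA hab ha ξ) (norm_conv_le hB hW hb hab ξ))

/-- The Fourier coefficients of `u²` are bounded by `‖u‖²_{L²}`. -/
theorem norm_conv_self_le {a : ℤ × ℤ → ℂ} (ha : Summable fun ξ => ‖a ξ‖ ^ 2) (ξ : ℤ × ℤ) :
    ‖conv a a ξ‖ ≤ ∑' ζ, ‖a ζ‖ ^ 2 := by
  have hs : Summable fun ζ => ‖a (ξ - ζ)‖ ^ 2 := (Equiv.subLeft ξ).summable_iff.2 ha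
  have hts : ∑' ζ, ‖a (ξ - ζ)‖ ^ 2 = ∑' ζ, ‖a ζ‖ ^ 2 :=
    (Equiv.subLeft ξ).tsum_eq fun ζ => ‖a ζ‖ ^ 2
  have h := ((ha.add hs).mul_left (1 / 2)).hasSum
  rw [tsum_mul_left, ha.tsum_add hs, hts] at h
  refine (tsum_of_norm_bounded h fun ζ => ?_).trans (by linarith)
  rw [norm_mul]
  nlinarith [sq_nonneg (‖a ζ‖ - ‖a (ξ - ζ)‖)]

theorem continuous_conv {a : ℝ → ℤ × ℤ → ℂ} (hc : ∀ ξ, Continuous fun t => a t ξ)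
    (hA : Summable A) (ha : ∀ t ξ, ‖a t ξ‖ ≤ A ξ) (ξ : ℤ × ℤ) :
    Continuous fun t => conv (a t) (a t) ξ := by
  have hA0 : ∀ ξ, 0 ≤ A ξ := fun ξ => (norm_nonneg _).trans (ha 0 ξ)
  refine continuous_tsum (fun ζ => (hc _).mul (hc _)) (summable_mul_sub hA0 hA0 hA hA ξ)
    fun ζ t => ?_
  rw [norm_mul]
  exact mul_le_mul (ha _ _) (ha _ _) (norm_nonneg _) (hA0 _)

/-- Young's inequality `ℓ² * ℓ¹ ⊆ ℓ²`. -/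
theorem summable_conv_sq (hA0 : ∀ ξ, 0 ≤ A ξ) (hB0 : ∀ ξ, 0 ≤ B ξ)
    (hA : Summable fun ξ => A ξ ^ 2) (hB : Summable B) :
    (∀ ξ, Summable fun ζ => A ζ * B (ξ - ζ)) ∧ Summable fun ξ => conv A B ξ ^ 2 := by
  have hA20 : ∀ ξ, 0 ≤ A ξ ^ 2 := fun ξ => by positivity
  have key : ∀ ξ, (Summable fun ζ => A ζ * B (ξ - ζ)) ∧
      conv A B ξ ^ 2 ≤ conv (fun ζ => A ζ ^ 2) B ξ * ∑' ζ, B ζ := by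
    intro ξ
    have h := tsum_mul_sq_le (f := fun ζ => A ζ * √(B (ξ - ζ))) (g := fun ζ => √(B (ξ - ζ)))
      (fun ζ => mul_nonneg (hA0 ζ) (Real.sqrt_nonneg _)) (fun ζ => Real.sqrt_nonneg _)
      (by simpa only [mul_pow, fun ζ => Real.sq_sqrt (hB0 ζ)] using
        summable_mul_sub hA20 hB0 hA hB ξ)
      (by
        simp only [fun ζ => Real.sq_sqrt (hB0 ζ)]
        exact (Equiv.subLeft ξ).summable_iff.2 hB)
    simp only [mul_assoc, fun ζ => Real.mul_self_sqrt (hB0 ζ), mul_pow,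
      fun ζ => Real.sq_sqrt (hB0 ζ)] at h
    have hts : ∑' ζ, B (ξ - ζ) = ∑' ζ, B ζ := (Equiv.subLeft ξ).tsum_eq B
    rw [hts] at h
    exact h
  exact ⟨fun ξ => (key ξ).1, Summable.of_nonneg_of_le (fun ξ => by positivity)
    (fun ξ => (key ξ).2) ((summable_conv hA20 hB0 hA hB).mul_right _)⟩

/-- If `A` has a square-summable first moment, so has `A * A`. -/
theorem summable_freqNorm_conv_sq (hA0 : ∀ ξ, 0 ≤ A ξ) (hA : Summable A)
    (hA1 : Summable fun ξ => (freqNorm ξ * A ξ) ^ 2) :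
    Summable fun ξ => (freqNorm ξ * conv A A ξ) ^ 2 := by
  have hr := freqNorm_nonneg
  have h := summable_conv_sq (fun ξ => mul_nonneg (hr ξ) (hA0 ξ)) hA0 hA1 hA
  refine Summable.of_nonneg_of_le (fun ξ => by positivity) (fun ξ => ?_) (h.2.mul_left 4)
  have hs2 : Summable fun ζ => A ζ * (freqNorm (ξ - ζ) * A (ξ - ζ)) := by
    have := (Equiv.subLeft ξ).summable_iff.2 (h.1 ξ)
    refine this.congr fun ζ => ?_
    simp only [Function.comp, Equiv.subLeft_apply, sub_sub_cancel]
    ring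
  have he : ∑' ζ, A ζ * (freqNorm (ξ - ζ) * A (ξ - ζ)) = conv (fun ξ => freqNorm ξ * A ξ) A ξ := by
    rw [conv, ← (Equiv.subLeft ξ).tsum_eq]
    refine tsum_congr fun ζ => ?_
    simp only [Equiv.subLeft_apply, sub_sub_cancel]
    ring
  have hle : freqNorm ξ * conv A A ξ ≤ 2 * conv (fun ξ => freqNorm ξ * A ξ) A ξ := by
    have h3 : 2 * conv (fun ξ => freqNorm ξ * A ξ) A ξ =
        ∑' ζ, (freqNorm ζ * A ζ * A (ξ - ζ) + A ζ * (freqNorm (ξ - ζ) * A (ξ - ζ))) := by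
      rw [(h.1 ξ).tsum_add hs2, he, conv]; ring
    rw [h3, conv, ← tsum_mul_left]
    refine Summable.tsum_le_tsum (fun ζ => ?_) ((summable_mul_sub hA0 hA0 hA hA ξ).mul_left _)
      ((h.1 ξ).add hs2)
    have h4 : freqNorm ξ ≤ freqNorm ζ + freqNorm (ξ - ζ) := by
      simpa using freqNorm_add_le ζ (ξ - ζ)
    nlinarith [mul_nonneg (hA0 ζ) (hA0 (ξ - ζ))]
  calc (freqNorm ξ * conv A A ξ) ^ 2 ≤ (2 * conv (fun ξ => freqNorm ξ * A ξ) A ξ) ^ 2 := by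
        have := mul_nonneg (hr ξ) (conv_nonneg hA0 hA0 ξ)
        gcongr
    _ = _ := by ring

end Convolution

/-! ### The linear symbol -/

/-- What the analysis uses of the symbol of the linear operator: it is even in each frequency
variable, of order four, and bounded below by a multiple of `1 + |ξ|⁴` up to a constant. -/
structure IsParabolic (l : ℤ × ℤ → ℝ) (c K : ℝ) : Prop where
  c_pos : 0 < c
  K_pos : 0 < K
  lower : ∀ ξ, c * wt ξ ≤ l ξ + K
  upper : ∀ ξ, |l ξ| ≤ K * wt ξ
  neg : ∀ ξ, l (-ξ) = l ξ
  reflect : ∀ ξ, l (-ξ.1, ξ.2) = l ξ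

theorem exists_isParabolic_linSymbol (β : ℝ) {δ ε : ℝ} (hδ : 0 ≤ δ) (hε : 0 < ε) :
    ∃ c K, IsParabolic (linSymbol β δ ε) c K := by
  set b := |β - 1| with hb
  set m := b + δ ^ 2 / ε with hm
  have hb0 : 0 ≤ b := abs_nonneg _
  have hm0 : 0 ≤ m := by positivity
  refine ⟨ε / 2, b + 1 + δ + ε + m ^ 2 / ε, ⟨by positivity, by positivity, fun ξ => ?_,
    fun ξ => ?_, fun ξ => ?_, fun ξ => ?_⟩⟩
  · have hsq := freqNorm_sq ξ
    unfold linSymbol wt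
    set r := freqNorm ξ
    have hr : 0 ≤ r := freqNorm_nonneg ξ
    have h1 : 0 ≤ ε * r ^ 4 / 4 - δ * r ^ 3 + δ ^ 2 / ε * r ^ 2 := by
      have : ε * r ^ 4 / 4 - δ * r ^ 3 + δ ^ 2 / ε * r ^ 2 = r ^ 2 * (ε * r / 2 - δ) ^ 2 / ε := by
        field_simp; ring
      rw [this]; positivity
    have h2 : 0 ≤ ε * r ^ 4 / 4 - m * r ^ 2 + m ^ 2 / ε := by
      have : ε * r ^ 4 / 4 - m * r ^ 2 + m ^ 2 / ε = (ε * r ^ 2 / 2 - m) ^ 2 / ε := by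
        field_simp; ring
      rw [this]; positivity
    have h3 : (β - 1) * (ξ.1 : ℝ) ^ 2 ≤ b * (ξ.1 : ℝ) ^ 2 :=
      mul_le_mul_of_nonneg_right (le_abs_self _) (sq_nonneg _)
    have h4 : b * (ξ.1 : ℝ) ^ 2 ≤ b * r ^ 2 :=
      mul_le_mul_of_nonneg_left (by rw [hsq]; nlinarith [sq_nonneg (ξ.2 : ℝ)]) hb0
    have h5 : m * r ^ 2 = b * r ^ 2 + δ ^ 2 / ε * r ^ 2 := by rw [hm]; ring
    nlinarith [sq_nonneg (ξ.2 : ℝ)]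
  · have hw := one_le_wt ξ
    have h2 := freqNorm_pow_le_wt ξ (k := 2) (by norm_num)
    have h3 := freqNorm_pow_le_wt ξ (k := 3) (by norm_num)
    have h4 := freqNorm_pow_le_wt ξ (k := 4) (by norm_num)
    have hr : 0 ≤ freqNorm ξ := freqNorm_nonneg ξ
    have hsq := freqNorm_sq ξ
    have hx : |-(β - 1) * (ξ.1 : ℝ) ^ 2| ≤ b * wt ξ := by
      rw [abs_mul, abs_neg, abs_of_nonneg (sq_nonneg (ξ.1 : ℝ))]
      exact mul_le_mul_of_nonneg_left (by nlinarith [sq_nonneg (ξ.2 : ℝ)]) hb0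
    have hy : (ξ.2 : ℝ) ^ 2 ≤ wt ξ := by nlinarith [sq_nonneg (ξ.1 : ℝ)]
    have h3' := mul_le_mul_of_nonneg_left h3 hδ
    have h4' := mul_le_mul_of_nonneg_left h4 hε.le
    have h3'' := mul_nonneg hδ (pow_nonneg hr 3)
    have h4'' := mul_nonneg hε.le (pow_nonneg hr 4)
    have hm' : 0 ≤ m ^ 2 / ε * wt ξ := by positivity
    obtain ⟨hx1, hx2⟩ := abs_le.1 hx
    unfold linSymbol
    rw [abs_le]
    constructor <;> nlinarith [sq_nonneg (ξ.2 : ℝ)]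
  · simp [linSymbol, freqNorm_neg]
  · simp [linSymbol, freqNorm_reflect]

namespace IsParabolic

variable {l : ℤ × ℤ → ℝ} {c K : ℝ}

theorem le_add (hl : IsParabolic l c K) {μ : ℝ} (hμ : K ≤ μ) (ξ : ℤ × ℤ) :
    c * wt ξ ≤ l ξ + μ := (hl.lower ξ).trans (by linarith)

theorem add_pos (hl : IsParabolic l c K) {μ : ℝ} (hμ : K ≤ μ) (ξ : ℤ × ℤ) : 0 < l ξ + μ :=
  (mul_pos hl.c_pos (wt_pos ξ)).trans_le (hl.le_add hμ ξ)

theorem exp_neg_le (hl : IsParabolic l c K) (ξ : ℤ × ℤ) {t : ℝ} (ht : 0 ≤ t) :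
    Real.exp (-l ξ * t) ≤ Real.exp (K * t) := by
  have := hl.add_pos le_rfl ξ
  gcongr
  linarith

/-- The parabolic gain of derivatives beats the first-order derivative in the nonlinearity by an
arbitrarily small factor, once the symbol is shifted enough. -/
theorem exists_rate (hl : IsParabolic l c K) {η : ℝ} (hη : 0 < η) :
    ∃ μ, K ≤ μ ∧ ∀ ξ, freqNorm ξ ≤ η * (l ξ + μ) := by
  have hc := hl.c_pos
  set α := η * c with hα
  have hα0 : 0 < α := by positivity
  refine ⟨K + (1 + 1 / α) / η, by linarith [show 0 < (1 + 1 / α) / η by positivity], fun ξ => ?_⟩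
  have h1 := mul_le_mul_of_nonneg_left (hl.lower ξ) hη.le
  have h2 : η * (l ξ + (K + (1 + 1 / α) / η)) = η * (l ξ + K) + (1 + 1 / α) := by
    field_simp
    ring
  rw [h2]
  unfold wt at h1
  have hr := freqNorm_nonneg ξ
  set r := freqNorm ξ
  suffices r ≤ α * r ^ 4 + (1 + 1 / α) by nlinarith
  rcases le_total r (1 + 1 / α) with h | h
  · nlinarith [mul_nonneg hα0.le (pow_nonneg hr 4)]
  · have h1r : 1 ≤ r := by linarith [one_div_pos.2 hα0]
    have h3 : 1 ≤ α * r := by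
      have : α * (1 / α) ≤ α * r := by gcongr; linarith
      rwa [mul_one_div_cancel hα0.ne'] at this
    have h4 : r ≤ r ^ 3 := by nlinarith [mul_nonneg hr (sub_nonneg.2 h1r)]
    have h5 : r ^ 3 ≤ α * r * r ^ 3 := by nlinarith [pow_nonneg hr 3]
    have : 0 < 1 / α := by positivity
    nlinarith

end IsParabolic

/-! ### Solutions as families of Fourier modes -/

/-- A scalar Duhamel estimate: the solution of `f' = -(g + l f)` with `‖g t‖ ≤ G e^{μ t}`. -/
theorem norm_le_of_hasDerivAt {l μ G T : ℝ} {f g : ℝ → ℂ} (hf : ContinuousOn f (Set.Icc 0 T))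
    (hd : ∀ t ∈ Set.Ioo 0 T, HasDerivAt f (-(g t + l * f t)) t)
    (hg : ∀ t ∈ Set.Ioo 0 T, ‖g t‖ ≤ G * Real.exp (μ * t)) (hl : 0 < l + μ) (hG : 0 ≤ G) :
    ∀ t ∈ Set.Icc 0 T,
      ‖f t‖ ≤ Real.exp (-l * t) * ‖f 0‖ + Real.exp (μ * t) * (G / (l + μ)) := by
  intro t ht
  have hpos : 0 ≤ Real.exp (μ * t) * (G / (l + μ)) := by positivity
  rcases ht.1.eq_or_lt with rfl | ht0
  · simpa using hpos
  let h : ℝ → ℂ := fun s => (Real.exp (l * s) : ℂ) * f s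
  have hexp : ∀ s : ℝ, HasDerivAt (fun s : ℝ => ((Real.exp (l * s) : ℝ) : ℂ))
      (((Real.exp (l * s) * l : ℝ)) : ℂ) s := fun s => by
    have := ((hasDerivAt_id s).const_mul l).exp
    simp only [id, mul_one] at this
    exact this.ofReal_comp
  have hhd : ∀ s ∈ Set.Ioo 0 T, HasDerivAt h (-((Real.exp (l * s) : ℂ) * g s)) s := by
    intro s hs
    refine ((hexp s).mul (hd s hs)).congr_deriv ?_
    push_cast
    ring
  have hhc : ContinuousOn h (Set.Icc 0 T) :=
    ContinuousOn.mul (Continuous.continuousOn (by fun_prop)) hf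
  have hn : ∀ s, ‖h s‖ = Real.exp (l * s) * ‖f s‖ := fun s => by
    simp only [h, norm_mul, Complex.norm_real, Real.norm_eq_abs, Real.abs_exp]
  have hstep : ∀ a ∈ Set.Ioo 0 t,
      ‖h t‖ ≤ ‖h a‖ + G / (l + μ) * Real.exp ((l + μ) * t) := by
    intro a ha
    have hsub : Set.Ico a t ⊆ Set.Ioo 0 T := fun s hs =>
      ⟨ha.1.trans_le hs.1, hs.2.trans_le ht.2⟩
    have := image_norm_le_of_norm_deriv_right_le_deriv_boundary (f := h) (a := a) (b := t)
      (hhc.mono (Set.Icc_subset_Icc ha.1.le ht.2))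
      (fun s hs => (hhd s (hsub hs)).hasDerivWithinAt)
      (B := fun s => ‖h a‖ + G / (l + μ) * (Real.exp ((l + μ) * s) - Real.exp ((l + μ) * a)))
      (B' := fun s => G * Real.exp ((l + μ) * s)) (by simp)
      (fun s => by
        have h1 := ((((hasDerivAt_id s).const_mul (l + μ)).exp.sub_const
          (Real.exp ((l + μ) * a))).const_mul (G / (l + μ))).const_add ‖h a‖
        refine h1.congr_deriv ?_
        simp only [id]
        field_simp)
      (fun s hs => by
        rw [norm_neg, norm_mul, Complex.norm_real, Real.norm_eq_abs, Real.abs_exp]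
        calc Real.exp (l * s) * ‖g s‖ ≤ Real.exp (l * s) * (G * Real.exp (μ * s)) := by
              gcongr; exact hg s (hsub hs)
          _ = G * Real.exp ((l + μ) * s) := by rw [add_mul, Real.exp_add]; ring)
      (Set.right_mem_Icc.2 ha.2.le)
    refine this.trans ?_
    have : 0 < Real.exp ((l + μ) * a) := Real.exp_pos _
    gcongr
    linarith
  have hlim : Tendsto (fun a => ‖h a‖ + G / (l + μ) * Real.exp ((l + μ) * t)) (𝓝[>] 0)
      (𝓝 (‖h 0‖ + G / (l + μ) * Real.exp ((l + μ) * t))) := by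
    refine Tendsto.add_const _ (Tendsto.norm ?_)
    have h1 := hhc 0 ⟨le_rfl, ht0.le.trans ht.2⟩
    refine h1.mono_left (nhdsWithin_le_of_mem ?_)
    filter_upwards [Ioo_mem_nhdsGT (ht0.trans_le ht.2)] with s hs using ⟨hs.1.le, hs.2.le⟩
  have hfin : ‖h t‖ ≤ ‖h 0‖ + G / (l + μ) * Real.exp ((l + μ) * t) := by
    refine ge_of_tendsto hlim ?_
    filter_upwards [Ioo_mem_nhdsGT ht0] with a ha using hstep a ha
  rw [hn, hn, mul_zero, Real.exp_zero, one_mul] at hfin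
  have he : Real.exp (-l * t) * Real.exp (l * t) = 1 := by
    rw [← Real.exp_add]; simp
  calc ‖f t‖ = Real.exp (-l * t) * (Real.exp (l * t) * ‖f t‖) := by rw [← mul_assoc, he, one_mul]
    _ ≤ Real.exp (-l * t) * (‖f 0‖ + G / (l + μ) * Real.exp ((l + μ) * t)) := by gcongr
    _ = _ := by
      rw [mul_add, add_mul l μ, Real.exp_add]
      linear_combination (G / (l + μ) * Real.exp (μ * t)) * he

/-- The Fourier coefficients of `½ (u²)_x` in terms of those of `u`. -/
def nl (a : ℤ × ℤ → ℂ) (ξ : ℤ × ℤ) : ℂ := Complex.I * (ξ.1 : ℂ) / 2 * conv a a ξ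

theorem norm_I_mul_le (ξ : ℤ × ℤ) (z : ℂ) :
    ‖Complex.I * (ξ.1 : ℂ) / 2 * z‖ ≤ freqNorm ξ * ‖z‖ := by
  rw [norm_mul]
  gcongr
  have h := abs_fst_le_freqNorm ξ
  have h0 := abs_nonneg (ξ.1 : ℝ)
  simp only [norm_div, norm_mul, Complex.norm_I, one_mul, Complex.norm_intCast, Complex.norm_ofNat]
  linarith

theorem norm_nl_le (a : ℤ × ℤ → ℂ) (ξ : ℤ × ℤ) : ‖nl a ξ‖ ≤ freqNorm ξ * ‖conv a a ξ‖ :=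
  norm_I_mul_le ξ _

theorem norm_nl_sub_le (a b : ℤ × ℤ → ℂ) (ξ : ℤ × ℤ) :
    ‖nl a ξ - nl b ξ‖ ≤ freqNorm ξ * ‖conv a a ξ - conv b b ξ‖ := by
  rw [nl, nl, ← mul_sub]
  exact norm_I_mul_le ξ _

/-- A family of Fourier modes that solves the equation on the time interval `(0, T)` and has a
summable majorant. The modes are continuous functions on all of `ℝ`; only times in `[0, T]`
matter. -/
structure ModeSol (l : ℤ × ℤ → ℝ) (T : ℝ) (a : ℝ → ℤ × ℤ → ℂ) : Prop where
  cont : ∀ ξ, Continuous fun t => a t ξ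
  env : ∃ A : ℤ × ℤ → ℝ, Summable A ∧ ∀ t ξ, ‖a t ξ‖ ≤ A ξ
  deriv : ∀ ξ, ∀ t ∈ Set.Ioo 0 T,
    HasDerivAt (fun s => a s ξ) (-(nl (a t) ξ + l ξ * a t ξ)) t

theorem conv_const_mul_left (k : ℝ) (A B : ℤ × ℤ → ℝ) (ξ : ℤ × ℤ) :
    conv (fun ζ => k * A ζ) B ξ = k * conv A B ξ := by
  simp only [conv, mul_assoc, tsum_mul_left]

theorem conv_const_mul_right (k : ℝ) (A B : ℤ × ℤ → ℝ) (ξ : ℤ × ℤ) :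
    conv A (fun ζ => k * B ζ) ξ = k * conv A B ξ := by
  simp only [conv, mul_left_comm _ k, tsum_mul_left]

namespace ModeSol

variable {l : ℤ × ℤ → ℝ} {c K T : ℝ} {a b : ℝ → ℤ × ℤ → ℂ}

theorem summable_norm (ha : ModeSol l T a) (t : ℝ) : Summable fun ξ => ‖a t ξ‖ := by
  obtain ⟨A, hA, hle⟩ := ha.env
  exact Summable.of_nonneg_of_le (fun _ => norm_nonneg _) (hle t) hA

theorem continuous_rhs (ha : ModeSol l T a) (ξ : ℤ × ℤ) :
    Continuous fun t => -(nl (a t) ξ + l ξ * a t ξ) := by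
  obtain ⟨A, hA, hle⟩ := ha.env
  have := continuous_conv ha.cont hA hle ξ
  have := ha.cont ξ
  unfold nl
  fun_prop

theorem mono (ha : ModeSol l T a) {T' : ℝ} (h : T' ≤ T) : ModeSol l T' a :=
  ⟨ha.cont, ha.env, fun ξ t ht => ha.deriv ξ t ⟨ht.1, ht.2.trans_le h⟩⟩

/-- Translation in time. -/
theorem shift (ha : ModeSol l T a) {s : ℝ} (hs : 0 ≤ s) :
    ModeSol l (T - s) fun t => a (t + s) := by
  obtain ⟨A, hA, hle⟩ := ha.env
  refine ⟨fun ξ => (ha.cont ξ).comp (by fun_prop), ⟨A, hA, fun t => hle _⟩, fun ξ t ht => ?_⟩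
  exact HasDerivAt.comp_add_const t s
    (ha.deriv ξ (t + s) ⟨by linarith [ht.1], by linarith [ht.2]⟩)

/-- Stability: the sequence of the suprema of `e^{-μ t} |a_ξ(t) - b_ξ(t)|` over `[0, T]` is
controlled in `ℓ¹` by the initial values, where `μ` depends only on a bound for the two
majorants. The second estimate records the smoothing of the Duhamel term. -/
theorem stability (hl : IsParabolic l c K) {R : ℝ} (hR : 0 ≤ R) :
    ∃ μ, K ≤ μ ∧ ∀ (T : ℝ) (a b : ℝ → ℤ × ℤ → ℂ) (A B : ℤ × ℤ → ℝ), 0 ≤ T →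
      ModeSol l T a → ModeSol l T b → Summable A → Summable B → ∑' ξ, A ξ ≤ R → ∑' ξ, B ξ ≤ R →
      (∀ t ∈ Set.Icc 0 T, ∀ ξ, ‖a t ξ‖ ≤ A ξ) → (∀ t ∈ Set.Icc 0 T, ∀ ξ, ‖b t ξ‖ ≤ B ξ) →
      ∃ V : ℤ × ℤ → ℝ, (∀ ξ, 0 ≤ V ξ) ∧ Summable V ∧
        ∑' ξ, V ξ ≤ 4 * R * ∑' ξ, ‖a 0 ξ - b 0 ξ‖ ∧
        ∀ t ∈ Set.Icc 0 T, ∀ ξ, ‖a t ξ - b t ξ‖ ≤ Real.exp (K * t) * ‖a 0 ξ - b 0 ξ‖ +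
          Real.exp (μ * t) * (freqNorm ξ * V ξ / (c * wt ξ)) := by
  obtain ⟨μ, hμK, hμ⟩ := hl.exists_rate (η := 1 / (4 * (R + 1))) (by positivity)
  refine ⟨μ, hμK, fun T a b A B hT ha hb hA hB hAR hBR haA hbB => ?_⟩
  have h0T : (0 : ℝ) ∈ Set.Icc 0 T := ⟨le_rfl, hT⟩
  have hA0 : ∀ ξ, 0 ≤ A ξ := fun ξ => (norm_nonneg _).trans (haA 0 h0T ξ)
  have hB0 : ∀ ξ, 0 ≤ B ξ := fun ξ => (norm_nonneg _).trans (hbB 0 h0T ξ)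
  have hμ0 : 0 ≤ μ := hl.K_pos.le.trans hμK
  -- The supremum over the times is taken inside the sum over the frequencies: `W` is summable, and
  -- convolution with it bounds the difference of the nonlinearities at all times at once.
  let D : ℤ × ℤ → Set.Icc 0 T → ℝ := fun ξ t => Real.exp (-μ * t) * ‖a t ξ - b t ξ‖
  let W : ℤ × ℤ → ℝ := fun ξ => ⨆ t, D ξ t
  have : Nonempty (Set.Icc 0 T) := ⟨⟨0, h0T⟩⟩
  have hD0 : ∀ ξ t, 0 ≤ D ξ t := fun ξ t => by positivity
  have hDAB : ∀ ξ t, D ξ t ≤ A ξ + B ξ := fun ξ t => by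
    have h1 : Real.exp (-μ * t) ≤ 1 := Real.exp_le_one_iff.2 (by nlinarith [t.2.1])
    have h2 : ‖a t ξ - b t ξ‖ ≤ A ξ + B ξ :=
      (norm_sub_le _ _).trans (add_le_add (haA t t.2 ξ) (hbB t t.2 ξ))
    calc D ξ t ≤ 1 * (A ξ + B ξ) := by
          simp only [D]; gcongr
      _ = _ := one_mul _
  have hbdd : ∀ ξ, BddAbove (Set.range (D ξ)) := fun ξ =>
    ⟨A ξ + B ξ, by rintro _ ⟨t, rfl⟩; exact hDAB ξ t⟩
  have hW0 : ∀ ξ, 0 ≤ W ξ := fun ξ => Real.iSup_nonneg (hD0 ξ)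
  have hW : Summable W :=
    Summable.of_nonneg_of_le hW0 (fun ξ => ciSup_le (hDAB ξ)) (hA.add hB)
  have hdW : ∀ t ∈ Set.Icc 0 T, ∀ ξ, ‖a t ξ - b t ξ‖ ≤ Real.exp (μ * t) * W ξ := by
    intro t ht ξ
    have h1 : D ξ ⟨t, ht⟩ ≤ W ξ := le_ciSup (hbdd ξ) _
    have h2 : Real.exp (μ * t) * Real.exp (-μ * t) = 1 := by rw [← Real.exp_add]; simp
    calc ‖a t ξ - b t ξ‖ = Real.exp (μ * t) * D ξ ⟨t, ht⟩ := by
          simp only [D]; rw [← mul_assoc, h2, one_mul]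
      _ ≤ _ := by gcongr
  let V : ℤ × ℤ → ℝ := fun ξ => conv W A ξ + conv B W ξ
  have hV0 : ∀ ξ, 0 ≤ V ξ := fun ξ => add_nonneg (conv_nonneg hW0 hA0 ξ) (conv_nonneg hB0 hW0 ξ)
  have hV : Summable V := (summable_conv hW0 hA0 hW hA).add (summable_conv hB0 hW0 hB hW)
  have hVsum : ∑' ξ, V ξ ≤ 2 * R * ∑' ξ, W ξ := by
    rw [(summable_conv hW0 hA0 hW hA).tsum_add (summable_conv hB0 hW0 hB hW),
      tsum_conv hW0 hA0 hW hA, tsum_conv hB0 hW0 hB hW]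
    have hWn : 0 ≤ ∑' ξ, W ξ := tsum_nonneg hW0
    nlinarith
  have hest : ∀ t ∈ Set.Icc 0 T, ∀ ξ, ‖a t ξ - b t ξ‖ ≤
      Real.exp (-l ξ * t) * ‖a 0 ξ - b 0 ξ‖ +
        Real.exp (μ * t) * (freqNorm ξ * V ξ / (l ξ + μ)) := by
    intro t ht ξ
    refine norm_le_of_hasDerivAt (f := fun t => a t ξ - b t ξ)
      (g := fun t => nl (a t) ξ - nl (b t) ξ) ((ha.cont ξ).sub (hb.cont ξ)).continuousOn
      (fun s hs => ((ha.deriv ξ s hs).sub (hb.deriv ξ s hs)).congr_deriv (by ring))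
      (fun s hs => ?_) (hl.add_pos hμK ξ) (mul_nonneg (freqNorm_nonneg ξ) (hV0 ξ)) t ht
    have hs' := Set.Ioo_subset_Icc_self hs
    refine (norm_nl_sub_le _ _ ξ).trans ?_
    rw [mul_assoc]
    refine mul_le_mul_of_nonneg_left ?_ (freqNorm_nonneg ξ)
    have := norm_conv_self_sub_le hA hB (hW.mul_left (Real.exp (μ * s))) (haA s hs') (hbB s hs')
      (hdW s hs') ξ
    rw [conv_const_mul_left, conv_const_mul_right] at this
    refine this.trans (le_of_eq ?_)
    simp only [V]
    ring
  have hd0 : Summable fun ξ => ‖a 0 ξ - b 0 ξ‖ :=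
    Summable.of_nonneg_of_le (fun _ => norm_nonneg _) (fun ξ => norm_sub_le _ _)
      ((ha.summable_norm 0).add (hb.summable_norm 0))
  -- By the choice of `μ` at most half of `∑ W` comes back through the nonlinearity.
  have hWle : ∀ ξ, W ξ ≤ ‖a 0 ξ - b 0 ξ‖ + 1 / (4 * (R + 1)) * V ξ := by
    intro ξ
    refine ciSup_le fun t => ?_
    have hlm := hl.add_pos hμK ξ
    have h1 : Real.exp (-μ * t) * Real.exp (-l ξ * t) ≤ 1 := by
      rw [← Real.exp_add]; exact Real.exp_le_one_iff.2 (by nlinarith [t.2.1])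
    have h2 : Real.exp (-μ * t) * Real.exp (μ * t) = 1 := by rw [← Real.exp_add]; simp
    have h3 : freqNorm ξ * V ξ / (l ξ + μ) ≤ 1 / (4 * (R + 1)) * V ξ := by
      rw [div_le_iff₀ hlm]
      nlinarith [mul_le_mul_of_nonneg_right (hμ ξ) (hV0 ξ)]
    calc D ξ t ≤ Real.exp (-μ * t) * (Real.exp (-l ξ * t) * ‖a 0 ξ - b 0 ξ‖ +
        Real.exp (μ * t) * (freqNorm ξ * V ξ / (l ξ + μ))) := by
          simp only [D]; gcongr; exact hest t t.2 ξ
      _ = Real.exp (-μ * t) * Real.exp (-l ξ * t) * ‖a 0 ξ - b 0 ξ‖ +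
        (Real.exp (-μ * t) * Real.exp (μ * t)) * (freqNorm ξ * V ξ / (l ξ + μ)) := by ring
      _ ≤ 1 * ‖a 0 ξ - b 0 ξ‖ + 1 * (1 / (4 * (R + 1)) * V ξ) := by
          rw [h2]; gcongr
      _ = _ := by ring
  have hWsum : ∑' ξ, W ξ ≤ 2 * ∑' ξ, ‖a 0 ξ - b 0 ξ‖ := by
    have h1 := hW.tsum_le_tsum hWle (hd0.add (hV.mul_left _))
    rw [hd0.tsum_add (hV.mul_left _), tsum_mul_left] at h1
    have hWn : 0 ≤ ∑' ξ, W ξ := tsum_nonneg hW0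
    have h2 : 1 / (4 * (R + 1)) * ∑' ξ, V ξ ≤ 1 / 2 * ∑' ξ, W ξ := by
      calc 1 / (4 * (R + 1)) * ∑' ξ, V ξ ≤ 1 / (4 * (R + 1)) * (2 * R * ∑' ξ, W ξ) := by gcongr
        _ ≤ 1 / (4 * (R + 1)) * (2 * (R + 1) * ∑' ξ, W ξ) := by gcongr; linarith
        _ = _ := by field_simp; ring
    linarith
  refine ⟨V, hV0, hV, by nlinarith, fun t ht ξ => (hest t ht ξ).trans ?_⟩
  have h1 := mul_pos hl.c_pos (wt_pos ξ)
  have h2 := hl.le_add hμK ξ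
  have h3 := mul_nonneg (freqNorm_nonneg ξ) (hV0 ξ)
  refine add_le_add (mul_le_mul_of_nonneg_right (hl.exp_neg_le ξ ht.1) (norm_nonneg _)) ?_
  gcongr

theorem unique (hl : IsParabolic l c K) (hT : 0 ≤ T) (ha : ModeSol l T a) (hb : ModeSol l T b)
    (h0 : a 0 = b 0) : ∀ t ∈ Set.Icc 0 T, a t = b t := by
  obtain ⟨A, hA, haA⟩ := ha.env
  obtain ⟨B, hB, hbB⟩ := hb.env
  obtain ⟨μ, -, h⟩ := stability hl (R := max 0 (max (∑' ξ, A ξ) (∑' ξ, B ξ))) (le_max_left _ _)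
  obtain ⟨V, hV0, hV, hVs, hle⟩ := h T a b A B hT ha hb hA hB (by simp) (by simp)
    (fun t _ => haA t) (fun t _ => hbB t)
  simp only [h0, sub_self, norm_zero, tsum_zero, mul_zero, zero_add] at hVs hle
  have hVz : ∀ ξ, V ξ = 0 := fun ξ =>
    le_antisymm ((hV.le_tsum ξ fun j _ => hV0 j).trans hVs) (hV0 ξ)
  intro t ht
  funext ξ
  have := hle t ht ξ
  rw [hVz, mul_zero, zero_div, mul_zero, norm_le_zero_iff, sub_eq_zero] at this
  exact this

/-- Two solutions on consecutive time intervals combine to one solution. -/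
theorem glue {T' : ℝ} (hT : 0 < T) (ha : ModeSol l T a) (hb : ModeSol l T' b)
    (h : b 0 = a T) : ModeSol l (T + T') fun t => if t ≤ T then a t else b (t - T) := by
  obtain ⟨A, hA, haA⟩ := ha.env
  obtain ⟨B, hB, hbB⟩ := hb.env
  have hcont : ∀ ξ, Continuous fun t => (if t ≤ T then a t else b (t - T)) ξ := by
    intro ξ
    have : (fun t => (if t ≤ T then a t else b (t - T)) ξ) =
        fun t => if t ≤ T then a t ξ else b (t - T) ξ := by
      funext t; split_ifs <;> rfl
    rw [this]
    refine Continuous.if_le (ha.cont ξ) ((hb.cont ξ).comp (by fun_prop)) continuous_id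
      continuous_const fun t ht => ?_
    simp [← h, ht]
  have henv : ∀ t ξ, ‖(if t ≤ T then a t else b (t - T)) ξ‖ ≤ A ξ + B ξ := by
    intro t ξ
    have h1 := (norm_nonneg _).trans (haA 0 ξ)
    have h2 := (norm_nonneg _).trans (hbB 0 ξ)
    split_ifs
    · linarith [haA t ξ]
    · linarith [hbB (t - T) ξ]
  have hT'sol : ModeSol l 0 fun t => if t ≤ T then a t else b (t - T) :=
    ⟨hcont, ⟨_, hA.add hB, henv⟩, fun ξ t ht => absurd (ht.1.trans ht.2) (lt_irrefl _)⟩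
  refine ⟨hcont, ⟨_, hA.add hB, henv⟩, fun ξ => ?_⟩
  have hlt : ∀ t, 0 < t → t < T →
      HasDerivAt (fun s => (if s ≤ T then a s else b (s - T)) ξ)
        (-(nl (if t ≤ T then a t else b (t - T)) ξ +
          l ξ * (if t ≤ T then a t else b (t - T)) ξ)) t := by
    intro t h0 h1
    rw [if_pos h1.le]
    refine (ha.deriv ξ t ⟨h0, h1⟩).congr_of_eventuallyEq ?_
    filter_upwards [Iio_mem_nhds h1] with s hs
    rw [if_pos (Set.mem_Iio.1 hs).le]
  have hgt : ∀ t, T < t → t < T + T' →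
      HasDerivAt (fun s => (if s ≤ T then a s else b (s - T)) ξ)
        (-(nl (if t ≤ T then a t else b (t - T)) ξ +
          l ξ * (if t ≤ T then a t else b (t - T)) ξ)) t := by
    intro t h0 h1
    rw [if_neg h0.not_ge]
    refine (HasDerivAt.comp_sub_const t T
      (hb.deriv ξ (t - T) ⟨by linarith, by linarith⟩)).congr_of_eventuallyEq ?_
    filter_upwards [Ioi_mem_nhds h0] with s hs
    rw [if_neg (Set.mem_Ioi.1 hs).not_ge]
  intro t ht
  rcases lt_trichotomy t T with h1 | rfl | h1
  · exact hlt t ht.1 h1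
  · -- At the junction the derivative is the limit of the derivatives at nearby times.
    let g : ℝ → ℂ := fun s => (if s ≤ t then a s else b (s - t)) ξ
    let g' : ℝ → ℂ := fun s => -(nl (if s ≤ t then a s else b (s - t)) ξ +
          l ξ * (if s ≤ t then a s else b (s - t)) ξ)
    have hg' : Continuous g' := hT'sol.continuous_rhs ξ
    have hd : ∀ s ∈ Set.Ioo 0 (t + T'), s ≠ t → HasDerivAt g (g' s) s := by
      intro s hs hne
      rcases hne.lt_or_gt with h1 | h1
      · exact hlt s hs.1 h1
      · exact hgt s h1 hs.2
    have hsd : ∀ s ⊆ Set.Ioo 0 (t + T') \ {t}, DifferentiableOn ℝ g s := fun s hs x hx =>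
      (hd x (hs hx).1 (hs hx).2).differentiableAt.differentiableWithinAt
    have htend : ∀ s : Set ℝ, Set.Ioo 0 (t + T') \ {t} ∈ 𝓝[s] t →
        Tendsto (fun y => _root_.deriv g y) (𝓝[s] t) (𝓝 (g' t)) := by
      intro s hs
      refine (hg'.continuousAt.tendsto.mono_left nhdsWithin_le_nhds).congr' ?_
      filter_upwards [hs] with y hy using (hd y hy.1 hy.2).deriv.symm
    have hR : Set.Ioo t (t + T') ∈ 𝓝[>] t := Ioo_mem_nhdsGT ht.2
    have hL : Set.Ioo 0 t ∈ 𝓝[<] t := Ioo_mem_nhdsLT ht.1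
    have hRs : Set.Ioo t (t + T') ⊆ Set.Ioo 0 (t + T') \ {t} := fun y hy =>
      ⟨⟨ht.1.trans hy.1, hy.2⟩, hy.1.ne'⟩
    have hLs : Set.Ioo 0 t ⊆ Set.Ioo 0 (t + T') \ {t} := fun y hy =>
      ⟨⟨hy.1, hy.2.trans ht.2⟩, hy.2.ne⟩
    have h1 : HasDerivWithinAt g (g' t) (Set.Ici t) t :=
      hasDerivWithinAt_Ici_of_tendsto_deriv (hsd _ hRs) (hcont ξ).continuousWithinAt hR
        (htend _ (mem_of_superset hR hRs))
    have h2 : HasDerivWithinAt g (g' t) (Set.Iic t) t :=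
      hasDerivWithinAt_Iic_of_tendsto_deriv (hsd _ hLs) (hcont ξ).continuousWithinAt hL
        (htend _ (mem_of_superset hL hLs))
    have h3 := h2.union h1
    rw [Set.Iic_union_Ici, hasDerivWithinAt_univ] at h3
    exact h3
  · exact hgt t h1 ht.2

end ModeSol

/-! ### Local existence -/

/-- The right-hand side of the Duhamel formula, with `u` inserted into the nonlinearity. -/
def duhamel (l : ℤ × ℤ → ℝ) (a₀ : ℤ × ℤ → ℂ) (u : ℝ → ℤ × ℤ → ℂ) (t : ℝ) (ξ : ℤ × ℤ) : ℂ :=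
  Real.exp (-l ξ * t) * (a₀ ξ - ∫ s in (0 : ℝ)..t, Real.exp (l ξ * s) * nl (u s) ξ)

section Duhamel

variable {l : ℤ × ℤ → ℝ} {a₀ : ℤ × ℤ → ℂ} {u v : ℝ → ℤ × ℤ → ℂ} {A B W : ℤ × ℤ → ℝ}

theorem duhamel_zero (ξ : ℤ × ℤ) : duhamel l a₀ u 0 ξ = a₀ ξ := by simp [duhamel]

theorem hasDerivAt_duhamel (hu : ∀ ξ, Continuous fun t => u t ξ) (hA : Summable A)
    (huA : ∀ t ξ, ‖u t ξ‖ ≤ A ξ) (ξ : ℤ × ℤ) (t : ℝ) :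
    HasDerivAt (fun t => duhamel l a₀ u t ξ) (-(nl (u t) ξ + l ξ * duhamel l a₀ u t ξ)) t := by
  have hc : Continuous fun s => (Real.exp (l ξ * s) : ℂ) * nl (u s) ξ := by
    have := continuous_conv hu hA huA ξ
    unfold nl
    fun_prop
  have h1 := intervalIntegral.integral_hasDerivAt_right (hc.intervalIntegrable 0 t)
    hc.aestronglyMeasurable.stronglyMeasurableAtFilter hc.continuousAt
  have h2 : HasDerivAt (fun s : ℝ => ((Real.exp (-l ξ * s) : ℝ) : ℂ))
      ((Real.exp (-l ξ * t) * (-l ξ) : ℝ) : ℂ) t := by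
    have := ((hasDerivAt_id t).const_mul (-l ξ)).exp
    simp only [id, mul_one] at this
    exact this.ofReal_comp
  have he : (Real.exp (-l ξ * t) : ℂ) * Real.exp (l ξ * t) = 1 := by
    rw [← Complex.ofReal_mul, ← Real.exp_add]; simp
  refine (h2.mul (h1.const_sub (a₀ ξ))).congr_deriv ?_
  unfold duhamel
  push_cast at he ⊢
  linear_combination -nl (u t) ξ * he

theorem continuous_duhamel (hu : ∀ ξ, Continuous fun t => u t ξ) (hA : Summable A)
    (huA : ∀ t ξ, ‖u t ξ‖ ≤ A ξ) (ξ : ℤ × ℤ) : Continuous fun t => duhamel l a₀ u t ξ :=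
  continuous_iff_continuousAt.2 fun t => (hasDerivAt_duhamel hu hA huA ξ t).continuousAt

variable {c K μ η τ : ℝ}

/-- On time intervals of length at most `μ⁻¹` exponential factors are bounded by `3`. -/
theorem exp_mul_le_three (hτ : μ * τ ≤ 1) (hμ : 0 ≤ μ) {t : ℝ} (ht : t ≤ τ) :
    Real.exp (μ * t) ≤ 3 :=
  (Real.exp_le_exp.2 ((mul_le_mul_of_nonneg_left ht hμ).trans hτ)).trans
    (Real.exp_one_lt_d9.le.trans (by norm_num))

theorem norm_duhamel_le (hl : IsParabolic l c K) (hμ : K ≤ μ)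
    (hη : ∀ ξ, freqNorm ξ ≤ η * (l ξ + μ)) (hτ : μ * τ ≤ 1) (hu : ∀ ξ, Continuous fun t => u t ξ)
    (hA : Summable A) (huA : ∀ t ξ, ‖u t ξ‖ ≤ A ξ) {t : ℝ} (ht : t ∈ Set.Icc 0 τ) (ξ : ℤ × ℤ) :
    ‖duhamel l a₀ u t ξ‖ ≤ 3 * ‖a₀ ξ‖ + 3 * (η * conv A A ξ) := by
  have hA0 : ∀ ξ, 0 ≤ A ξ := fun ξ => (norm_nonneg _).trans (huA 0 ξ)
  have hμ0 : 0 ≤ μ := hl.K_pos.le.trans hμ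
  have hlm := hl.add_pos hμ ξ
  have hcv := conv_nonneg hA0 hA0 ξ
  have hr := freqNorm_nonneg ξ
  have h := norm_le_of_hasDerivAt (f := fun t => duhamel l a₀ u t ξ) (T := τ) (μ := μ)
    (G := freqNorm ξ * conv A A ξ) (continuous_duhamel hu hA huA ξ).continuousOn
    (fun s _ => hasDerivAt_duhamel hu hA huA ξ s)
    (fun s hs => by
      refine (norm_nl_le _ _).trans ?_
      have h1 := norm_conv_le hA hA (huA s) (huA s) ξ
      have h2 : 1 ≤ Real.exp (μ * s) := Real.one_le_exp (mul_nonneg hμ0 hs.1.le)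
      calc freqNorm ξ * ‖conv (u s) (u s) ξ‖ ≤ freqNorm ξ * conv A A ξ * 1 := by
            rw [mul_one]; gcongr
        _ ≤ _ := by gcongr)
    hlm (by positivity) t ht
  simp only [duhamel_zero] at h
  have h3 := exp_mul_le_three hτ hμ0 ht.2
  have h4 : Real.exp (-l ξ * t) ≤ 3 := by
    refine (hl.exp_neg_le ξ ht.1).trans (le_trans ?_ h3)
    exact Real.exp_le_exp.2 (mul_le_mul_of_nonneg_right hμ ht.1)
  have h5 : freqNorm ξ * conv A A ξ / (l ξ + μ) ≤ η * conv A A ξ := by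
    rw [div_le_iff₀ hlm]
    nlinarith [mul_le_mul_of_nonneg_right (hη ξ) hcv]
  refine h.trans (add_le_add (by gcongr) ?_)
  gcongr

theorem norm_duhamel_sub_le (hl : IsParabolic l c K) (hμ : K ≤ μ)
    (hη : ∀ ξ, freqNorm ξ ≤ η * (l ξ + μ)) (hτ : μ * τ ≤ 1) (hu : ∀ ξ, Continuous fun t => u t ξ)
    (hv : ∀ ξ, Continuous fun t => v t ξ) (hA : Summable A) (hB : Summable B) (hW : Summable W)
    (huA : ∀ t ξ, ‖u t ξ‖ ≤ A ξ) (hvB : ∀ t ξ, ‖v t ξ‖ ≤ B ξ)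
    (huv : ∀ t ξ, ‖u t ξ - v t ξ‖ ≤ W ξ) {t : ℝ} (ht : t ∈ Set.Icc 0 τ) (ξ : ℤ × ℤ) :
    ‖duhamel l a₀ u t ξ - duhamel l a₀ v t ξ‖ ≤ 3 * (η * (conv W A ξ + conv B W ξ)) := by
  have hA0 : ∀ ξ, 0 ≤ A ξ := fun ξ => (norm_nonneg _).trans (huA 0 ξ)
  have hB0 : ∀ ξ, 0 ≤ B ξ := fun ξ => (norm_nonneg _).trans (hvB 0 ξ)
  have hW0 : ∀ ξ, 0 ≤ W ξ := fun ξ => (norm_nonneg _).trans (huv 0 ξ)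
  have hμ0 : 0 ≤ μ := hl.K_pos.le.trans hμ
  have hlm := hl.add_pos hμ ξ
  have hcv := add_nonneg (conv_nonneg hW0 hA0 ξ) (conv_nonneg hB0 hW0 ξ)
  have hr := freqNorm_nonneg ξ
  have h := norm_le_of_hasDerivAt (f := fun t => duhamel l a₀ u t ξ - duhamel l a₀ v t ξ) (T := τ)
    (μ := μ) (g := fun t => nl (u t) ξ - nl (v t) ξ) (l := l ξ)
    (G := freqNorm ξ * (conv W A ξ + conv B W ξ))
    ((continuous_duhamel hu hA huA ξ).sub (continuous_duhamel hv hB hvB ξ)).continuousOn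
    (fun s _ => ((hasDerivAt_duhamel hu hA huA ξ s).sub
      (hasDerivAt_duhamel hv hB hvB ξ s)).congr_deriv (by ring))
    (fun s hs => by
      refine (norm_nl_sub_le _ _ _).trans ?_
      have h1 := norm_conv_self_sub_le hA hB hW (huA s) (hvB s) (huv s) ξ
      have h2 : 1 ≤ Real.exp (μ * s) := Real.one_le_exp (mul_nonneg hμ0 hs.1.le)
      calc freqNorm ξ * ‖conv (u s) (u s) ξ - conv (v s) (v s) ξ‖
          ≤ freqNorm ξ * (conv W A ξ + conv B W ξ) * 1 := by
            rw [mul_one]; gcongr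
        _ ≤ _ := by gcongr)
    hlm (by positivity) t ht
  simp only [duhamel_zero, sub_self, norm_zero, mul_zero, zero_add] at h
  have h3 := exp_mul_le_three hτ hμ0 ht.2
  have h5 : freqNorm ξ * (conv W A ξ + conv B W ξ) / (l ξ + μ) ≤
      η * (conv W A ξ + conv B W ξ) := by
    rw [div_le_iff₀ hlm]
    nlinarith [mul_le_mul_of_nonneg_right (hη ξ) hcv]
  refine h.trans ?_
  gcongr

end Duhamel

/-- The space `ℓ¹(ℤ²; C_b(ℝ))` in which local solutions are found. The supremum in time is inside
the sum over the frequencies, so that this is a convolution algebra. -/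
abbrev ModeSpace : Type := lp (fun _ : ℤ × ℤ => BoundedContinuousFunction ℝ ℂ) 1

theorem ModeSpace.hasSum_norm (x : ModeSpace) : HasSum (fun ξ => ‖x ξ‖) ‖x‖ := by
  simpa using lp.hasSum_norm (p := 1) (by norm_num) x

/-- The clamp of a time to the interval `[0, τ]`. -/
def clamp (τ t : ℝ) : ℝ := max 0 (min t τ)

theorem continuous_clamp (τ : ℝ) : Continuous (clamp τ) := by unfold clamp; fun_prop

theorem clamp_mem {τ : ℝ} (hτ : 0 ≤ τ) (t : ℝ) : clamp τ t ∈ Set.Icc 0 τ :=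
  ⟨le_max_left _ _, max_le hτ (min_le_right _ _)⟩

theorem clamp_of_mem {τ t : ℝ} (ht : t ∈ Set.Icc 0 τ) : clamp τ t = t := by
  rw [clamp, min_eq_left ht.2, max_eq_right ht.1]

/-- Local existence in the Wiener algebra, on a time interval that depends only on the norm of the
initial value. -/
theorem exists_local {l : ℤ × ℤ → ℝ} {c K : ℝ} (hl : IsParabolic l c K) {R : ℝ} (hR : 0 ≤ R) :
    ∃ τ > 0, ∀ a₀ : ℤ × ℤ → ℂ, Summable (fun ξ => ‖a₀ ξ‖) → ∑' ξ, ‖a₀ ξ‖ ≤ R →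
      ∃ a, ModeSol l τ a ∧ a 0 = a₀ := by
  -- In the ball of radius `ρ` the map is a contraction by `6 η ρ = 1 / 2`.
  set ρ : ℝ := 6 * R + 1 with hρ
  have hρ0 : 0 < ρ := by positivity
  set η : ℝ := 1 / (12 * ρ) with hη
  have hη0 : 0 < η := by positivity
  have hηρ : η * ρ = 1 / 12 := by rw [hη]; field_simp
  obtain ⟨μ, hμK, hμ⟩ := hl.exists_rate hη0
  have hμ0 : 0 < μ := hl.K_pos.trans_le hμK
  set τ : ℝ := 1 / μ with hτdef
  have hτ0 : 0 < τ := by positivity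
  have hτ : μ * τ ≤ 1 := by rw [hτdef, mul_one_div_cancel hμ0.ne']
  refine ⟨τ, hτ0, fun a₀ ha₀ ha₀R => ?_⟩
  let U : ModeSpace → ℝ → ℤ × ℤ → ℂ := fun x t ξ => x ξ t
  have hUc : ∀ x ξ, Continuous fun t => U x t ξ := fun x ξ => (x ξ).continuous
  have hUs : ∀ x : ModeSpace, Summable fun ξ => ‖x ξ‖ := fun x => x.hasSum_norm.summable
  have hUt : ∀ x : ModeSpace, ∑' ξ, ‖x ξ‖ = ‖x‖ := fun x => x.hasSum_norm.tsum_eq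
  have hU : ∀ (x : ModeSpace) t ξ, ‖U x t ξ‖ ≤ ‖x ξ‖ := fun x t ξ => (x ξ).norm_coe_le_norm t
  have hn0 : ∀ (x : ModeSpace) ξ, 0 ≤ ‖x ξ‖ := fun x ξ => norm_nonneg _
  -- Clamping the time makes the Duhamel integral a bounded function on all of `ℝ`.
  let F : ModeSpace → ℝ → ℤ × ℤ → ℂ := fun x t ξ => duhamel l a₀ (U x) (clamp τ t) ξ
  have hFc : ∀ x ξ, Continuous fun t => F x t ξ := fun x ξ =>
    (continuous_duhamel (hUc x) (hUs x) (hU x) ξ).comp (continuous_clamp τ)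
  let C : ModeSpace → ℤ × ℤ → ℝ := fun x ξ =>
    3 * ‖a₀ ξ‖ + 3 * (η * conv (fun ξ => ‖x ξ‖) (fun ξ => ‖x ξ‖) ξ)
  have hCF : ∀ x ξ t, ‖F x t ξ‖ ≤ C x ξ := fun x ξ t =>
    norm_duhamel_le hl hμK hμ hτ (hUc x) (hUs x) (hU x) (clamp_mem hτ0.le t) ξ
  have hCs : ∀ x, Summable (C x) := fun x => (ha₀.mul_left 3).add
    (((summable_conv (hn0 x) (hn0 x) (hUs x) (hUs x)).mul_left η).mul_left 3)
  let Ψ₀ : ModeSpace → ∀ _ : ℤ × ℤ, BoundedContinuousFunction ℝ ℂ := fun x ξ =>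
    BoundedContinuousFunction.ofNormedAddCommGroup (fun t => F x t ξ) (hFc x ξ) (C x ξ) (hCF x ξ)
  have hΨC : ∀ x ξ, ‖Ψ₀ x ξ‖ ≤ C x ξ := fun x ξ =>
    BoundedContinuousFunction.norm_ofNormedAddCommGroup_le _
      ((norm_nonneg _).trans (hCF x ξ 0)) (hCF x ξ)
  let Ψ : ModeSpace → ModeSpace := fun x => ⟨Ψ₀ x, memℓp_gen (by
    simpa using Summable.of_nonneg_of_le (fun ξ => norm_nonneg (Ψ₀ x ξ)) (hΨC x) (hCs x))⟩
  have hΨ : ∀ x ξ t, Ψ x ξ t = F x t ξ := fun x ξ t => rfl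
  have hmaps : Set.MapsTo Ψ (Metric.closedBall 0 ρ) (Metric.closedBall 0 ρ) := by
    intro x hx
    rw [mem_closedBall_zero_iff] at hx ⊢
    rw [← hUt]
    have hcv := summable_conv (hn0 x) (hn0 x) (hUs x) (hUs x)
    have h1 : ∑' ξ, C x ξ = 3 * ∑' ξ, ‖a₀ ξ‖ + 3 * (η * (‖x‖ * ‖x‖)) := by
      rw [(ha₀.mul_left 3).tsum_add ((hcv.mul_left η).mul_left 3), tsum_mul_left, tsum_mul_left,
        tsum_mul_left, tsum_conv (hn0 x) (hn0 x) (hUs x) (hUs x), hUt]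
    have h2 : ∑' ξ, ‖Ψ x ξ‖ ≤ ∑' ξ, C x ξ := (hUs (Ψ x)).tsum_le_tsum (hΨC x) (hCs x)
    have h3 : η * (‖x‖ * ‖x‖) ≤ η * (ρ * ρ) := by gcongr
    have h4 : η * (ρ * ρ) = ρ / 12 := by rw [← mul_assoc, hηρ]; ring
    linarith
  have hcontr : ContractingWith (1 / 2) (hmaps.restrict Ψ _ _) := by
    refine ⟨by norm_num, LipschitzWith.of_dist_le_mul fun x y => ?_⟩
    rw [Subtype.dist_eq, Subtype.dist_eq, dist_eq_norm, dist_eq_norm]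
    obtain ⟨x, hx⟩ := x
    obtain ⟨y, hy⟩ := y
    rw [mem_closedBall_zero_iff] at hx hy
    simp only [Set.MapsTo.val_restrict_apply]
    let w : ModeSpace := x - y
    have hcv1 := summable_conv (hn0 w) (hn0 x) (hUs w) (hUs x)
    have hcv2 := summable_conv (hn0 y) (hn0 w) (hUs y) (hUs w)
    have hpt : ∀ ξ, ‖(Ψ x - Ψ y) ξ‖ ≤ 3 * (η * (conv (fun ξ => ‖w ξ‖) (fun ξ => ‖x ξ‖) ξ +
        conv (fun ξ => ‖y ξ‖) (fun ξ => ‖w ξ‖) ξ)) := by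
      intro ξ
      have hb : ∀ t, ‖((Ψ x - Ψ y) ξ) t‖ ≤ 3 * (η * (conv (fun ξ => ‖w ξ‖) (fun ξ => ‖x ξ‖) ξ +
        conv (fun ξ => ‖y ξ‖) (fun ξ => ‖w ξ‖) ξ)) := fun t =>
        norm_duhamel_sub_le hl hμK hμ hτ (hUc x) (hUc y) (hUs x) (hUs y) (hUs w) (hU x) (hU y)
          (fun t ξ => (w ξ).norm_coe_le_norm t) (clamp_mem hτ0.le t) ξ
      exact (BoundedContinuousFunction.norm_le ((norm_nonneg _).trans (hb 0))).2 hb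
    have h1 : ‖Ψ x - Ψ y‖ ≤ 3 * (η * (‖w‖ * ‖x‖ + ‖y‖ * ‖w‖)) := by
      rw [← hUt (Ψ x - Ψ y)]
      refine ((hUs (Ψ x - Ψ y)).tsum_le_tsum hpt
        (((hcv1.add hcv2).mul_left η).mul_left 3)).trans (le_of_eq ?_)
      rw [tsum_mul_left, tsum_mul_left, hcv1.tsum_add hcv2,
        tsum_conv (hn0 w) (hn0 x) (hUs w) (hUs x), tsum_conv (hn0 y) (hn0 w) (hUs y) (hUs w),
        hUt, hUt, hUt]
    have h2 : η * (‖w‖ * ‖x‖ + ‖y‖ * ‖w‖) ≤ η * (‖w‖ * ρ + ρ * ‖w‖) := by gcongr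
    have h3 : η * (‖w‖ * ρ + ρ * ‖w‖) = ‖w‖ / 6 := by
      rw [show η * (‖w‖ * ρ + ρ * ‖w‖) = 2 * (η * ρ) * ‖w‖ by ring, hηρ]; ring
    have h4 : (((1 / 2 : NNReal) : ℝ)) = 1 / 2 := by norm_num
    rw [h4]
    linarith
  obtain ⟨x, -, hfix, -⟩ := hcontr.exists_fixedPoint' Metric.isClosed_closedBall.isComplete hmaps
    (Metric.mem_closedBall_self hρ0.le) (edist_ne_top 0 _)
  have hx : ∀ t ξ, U x t ξ = F x t ξ := fun t ξ => by
    rw [← hΨ, hfix]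
  have hxI : ∀ t ∈ Set.Icc 0 τ, ∀ ξ, U x t ξ = duhamel l a₀ (U x) t ξ := fun t ht ξ => by
    rw [hx]; simp only [F]; rw [clamp_of_mem ht]
  refine ⟨U x, ⟨hUc x, ⟨_, hUs x, hU x⟩, fun ξ t ht => ?_⟩, ?_⟩
  · rw [hxI t (Set.Ioo_subset_Icc_self ht) ξ]
    refine (hasDerivAt_duhamel (hUc x) (hUs x) (hU x) ξ t).congr_of_eventuallyEq ?_
    filter_upwards [Ioo_mem_nhds ht.1 ht.2] with s hs using hxI s (Set.Ioo_subset_Icc_self hs) ξ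
  · funext ξ
    rw [hxI 0 ⟨le_rfl, hτ0.le⟩, duhamel_zero]

/-! ### Symmetries and the cancellation in the energy -/

/-- The coefficients of a real-valued function that is odd in `x`. -/
structure IsOddReal (a : ℤ × ℤ → ℂ) : Prop where
  herm : ∀ ξ, a (-ξ) = star (a ξ)
  odd : ∀ ξ, a (-ξ.1, ξ.2) = -a ξ

/-- The reflection of frequencies in the first variable. -/
def reflectFreq : ℤ × ℤ ≃ ℤ × ℤ := (Equiv.neg ℤ).prodCongr (Equiv.refl ℤ)

theorem reflectFreq_apply (ξ : ℤ × ℤ) : reflectFreq ξ = (-ξ.1, ξ.2) := rfl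

theorem nl_star_neg (a : ℤ × ℤ → ℂ) (ξ : ℤ × ℤ) :
    nl (fun ζ => star (a (-ζ))) ξ = star (nl a (-ξ)) := by
  have h : conv (fun ζ => star (a (-ζ))) (fun ζ => star (a (-ζ))) ξ = star (conv a a (-ξ)) := by
    rw [conv, conv, tsum_star, ← (Equiv.neg (ℤ × ℤ)).tsum_eq]
    refine tsum_congr fun ζ => ?_
    simp only [Equiv.neg_apply, neg_neg, star_mul']
    congr 3
    abel
  rw [nl, nl, h]
  simp only [Complex.star_def, map_mul, map_div₀, Complex.conj_I, Prod.fst_neg, Int.cast_neg,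
    map_neg, map_intCast, map_ofNat]
  ring

theorem nl_neg_reflect (a : ℤ × ℤ → ℂ) (ξ : ℤ × ℤ) :
    nl (fun ζ => -a (reflectFreq ζ)) ξ = -nl a (reflectFreq ξ) := by
  have h : conv (fun ζ => -a (reflectFreq ζ)) (fun ζ => -a (reflectFreq ζ)) ξ =
      conv a a (reflectFreq ξ) := by
    rw [conv, conv, ← reflectFreq.tsum_eq]
    refine tsum_congr fun ζ => ?_
    simp only [neg_mul_neg, reflectFreq_apply, neg_neg]
    congr 2
    ext <;> simp
    ring
  rw [nl, nl, h]
  simp only [reflectFreq_apply, Int.cast_neg]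
  ring

/-- The Duhamel bound for one mode. -/
theorem norm_mode_le {l : ℤ × ℤ → ℝ} {c K T : ℝ} (hl : IsParabolic l c K) {a : ℝ → ℤ × ℤ → ℂ}
    {ξ : ℤ × ℤ} (hc : Continuous fun t => a t ξ)
    (hd : ∀ t ∈ Set.Ioo 0 T, HasDerivAt (fun s => a s ξ) (-(nl (a t) ξ + l ξ * a t ξ)) t)
    {G : ℝ} (hG : 0 ≤ G) (h : ∀ t ∈ Set.Ioo 0 T, ‖conv (a t) (a t) ξ‖ ≤ G) {t : ℝ}
    (ht : t ∈ Set.Icc 0 T) :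
    ‖a t ξ‖ ≤ Real.exp (-l ξ * t) * ‖a 0 ξ‖ +
      Real.exp (K * t) * (freqNorm ξ * G / (c * wt ξ)) := by
  have hr := freqNorm_nonneg ξ
  have h1 := mul_pos hl.c_pos (wt_pos ξ)
  have h2 := hl.lower ξ
  refine (norm_le_of_hasDerivAt (f := fun t => a t ξ) (g := fun t => nl (a t) ξ) (μ := K)
    (G := freqNorm ξ * G) hc.continuousOn hd (fun s hs => ?_)
    (hl.add_pos le_rfl ξ) (by positivity) t ht).trans ?_
  · have h2 : 1 ≤ Real.exp (K * s) := Real.one_le_exp (mul_nonneg hl.K_pos.le hs.1.le)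
    calc ‖nl (a s) ξ‖ ≤ freqNorm ξ * ‖conv (a s) (a s) ξ‖ := norm_nl_le _ _
      _ ≤ freqNorm ξ * G * 1 := by rw [mul_one]; gcongr; exact h s hs
      _ ≤ _ := by gcongr
  · gcongr

namespace ModeSol

variable {l : ℤ × ℤ → ℝ} {c K T : ℝ} {a b : ℝ → ℤ × ℤ → ℂ}

/-- Reality and oddness are preserved, by uniqueness. -/
theorem isOddReal (hl : IsParabolic l c K) (hT : 0 ≤ T) (ha : ModeSol l T a)
    (h0 : IsOddReal (a 0)) : ∀ t ∈ Set.Icc 0 T, IsOddReal (a t) := by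
  obtain ⟨A, hA, hle⟩ := ha.env
  have h1 : ModeSol l T fun t ξ => star (a t (-ξ)) := by
    refine ⟨fun ξ => continuous_star.comp (ha.cont (-ξ)), ⟨fun ξ => A (-ξ),
      (Equiv.neg (ℤ × ℤ)).summable_iff.2 hA, fun t ξ => by rw [norm_star]; exact hle _ _⟩,
      fun ξ t ht => ?_⟩
    refine (ha.deriv (-ξ) t ht).star.congr_deriv ?_
    rw [nl_star_neg, hl.neg]
    simp
  have h2 : ModeSol l T fun t ξ => -a t (reflectFreq ξ) := by
    refine ⟨fun ξ => (ha.cont (reflectFreq ξ)).neg, ⟨fun ξ => A (reflectFreq ξ),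
      reflectFreq.summable_iff.2 hA, fun t ξ => by rw [norm_neg]; exact hle _ _⟩,
      fun ξ t ht => ?_⟩
    refine (ha.deriv (reflectFreq ξ) t ht).neg.congr_deriv ?_
    rw [nl_neg_reflect, show l (reflectFreq ξ) = l ξ from hl.reflect ξ]
    ring
  have e1 : a 0 = fun ξ => star (a 0 (-ξ)) := by
    funext ξ; rw [h0.herm, star_star]
  have e2 : a 0 = fun ξ => -a 0 (reflectFreq ξ) := by
    funext ξ; rw [reflectFreq_apply, h0.odd, neg_neg]
  intro t ht
  refine ⟨fun ξ => ?_, fun ξ => ?_⟩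
  · have := congrFun (ha.unique hl hT h1 e1 t ht) ξ
    rw [this, star_star]
  · have := congrFun (ha.unique hl hT h2 e2 t ht) ξ
    rw [this, neg_neg]; rfl

theorem norm_le (hl : IsParabolic l c K) (ha : ModeSol l T a) {ξ : ℤ × ℤ} {G : ℝ} (hG : 0 ≤ G)
    (h : ∀ t ∈ Set.Ioo 0 T, ‖conv (a t) (a t) ξ‖ ≤ G) {t : ℝ} (ht : t ∈ Set.Icc 0 T) :
    ‖a t ξ‖ ≤ Real.exp (-l ξ * t) * ‖a 0 ξ‖ +
      Real.exp (K * t) * (freqNorm ξ * G / (c * wt ξ)) :=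
  norm_mode_le hl (ha.cont ξ) (ha.deriv ξ) hG h ht

/-- A solution that starts in `H²` has a majorant in `H²` on the whole time interval, since the
Duhamel term gains three derivatives over the convolution `A * A` of its majorant in the Wiener
algebra. -/
theorem exists_env (hl : IsParabolic l c K) (ha : ModeSol l T a)
    (h0 : Summable fun ξ => wt ξ * ‖a 0 ξ‖ ^ 2) :
    ∃ A : ℤ × ℤ → ℝ, (∀ ξ, 0 ≤ A ξ) ∧ (Summable fun ξ => wt ξ * A ξ ^ 2) ∧
      ∀ t ∈ Set.Icc 0 T, ∀ ξ, ‖a t ξ‖ ≤ A ξ := by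
  obtain ⟨A, hA, hle⟩ := ha.env
  have hA0 : ∀ ξ, 0 ≤ A ξ := fun ξ => (norm_nonneg _).trans (hle 0 ξ)
  have hc := hl.c_pos
  have hcv := conv_nonneg hA0 hA0
  refine ⟨fun ξ => Real.exp (K * T) * (‖a 0 ξ‖ + freqNorm ξ * conv A A ξ / (c * wt ξ)),
    fun ξ => ?_, ?_, fun t ht ξ => ?_⟩
  · have := wt_pos ξ
    have := freqNorm_nonneg ξ
    have := hcv ξ
    positivity
  · have hs := (summable_sq_of_summable hcv (summable_conv hA0 hA0 hA hA)).1
    refine Summable.of_nonneg_of_le (fun ξ => mul_nonneg (wt_pos ξ).le (sq_nonneg _)) (fun ξ => ?_)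
      ((h0.add (hs.mul_left (1 / c ^ 2))).mul_left (2 * Real.exp (K * T) ^ 2))
    have hw := wt_pos ξ
    have h1 : wt ξ * (freqNorm ξ * conv A A ξ / (c * wt ξ)) ^ 2 ≤ 1 / c ^ 2 * conv A A ξ ^ 2 := by
      have h2 := freqNorm_pow_le_wt ξ (k := 2) (by norm_num)
      have : wt ξ * (freqNorm ξ * conv A A ξ / (c * wt ξ)) ^ 2 =
          1 / c ^ 2 * conv A A ξ ^ 2 * (freqNorm ξ ^ 2 / wt ξ) := by field_simp
      rw [this]
      exact mul_le_of_le_one_right (by positivity) ((div_le_one hw).2 h2)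
    have h2 : (‖a 0 ξ‖ + freqNorm ξ * conv A A ξ / (c * wt ξ)) ^ 2 ≤
        2 * (‖a 0 ξ‖ ^ 2 + (freqNorm ξ * conv A A ξ / (c * wt ξ)) ^ 2) := add_sq_le
    calc wt ξ * (Real.exp (K * T) * (‖a 0 ξ‖ + freqNorm ξ * conv A A ξ / (c * wt ξ))) ^ 2
        = Real.exp (K * T) ^ 2 * (wt ξ *
          (‖a 0 ξ‖ + freqNorm ξ * conv A A ξ / (c * wt ξ)) ^ 2) := by ring
      _ ≤ Real.exp (K * T) ^ 2 * (wt ξ *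
          (2 * (‖a 0 ξ‖ ^ 2 + (freqNorm ξ * conv A A ξ / (c * wt ξ)) ^ 2))) := by gcongr
      _ = 2 * Real.exp (K * T) ^ 2 * (wt ξ * ‖a 0 ξ‖ ^ 2 +
          wt ξ * (freqNorm ξ * conv A A ξ / (c * wt ξ)) ^ 2) := by ring
      _ ≤ _ := by gcongr
  · have hw := wt_pos ξ
    have hr := freqNorm_nonneg ξ
    have h1 := ha.norm_le hl (hcv ξ) (fun s _ => norm_conv_le hA hA (hle s) (hle s) ξ) ht
    have h2 : Real.exp (K * t) ≤ Real.exp (K * T) := by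
      have := hl.K_pos
      have := ht.2
      gcongr
    have h3 := (hl.exp_neg_le ξ ht.1).trans h2
    have := hcv ξ
    refine h1.trans ?_
    beta_reduce
    rw [mul_add]
    refine add_le_add (by gcongr) (by gcongr)

end ModeSol

section Cancellation

variable {a : ℤ × ℤ → ℂ}

theorem summable_of_wt {A : ℤ × ℤ → ℝ} (hA : Summable fun ξ => wt ξ * A ξ ^ 2) {k : ℕ}
    (hk : k ≤ 4) : Summable fun ξ => freqNorm ξ ^ k * A ξ ^ 2 :=
  Summable.of_nonneg_of_le (fun ξ => mul_nonneg (pow_nonneg (freqNorm_nonneg ξ) k) (sq_nonneg _))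
    (fun ξ => mul_le_mul_of_nonneg_right (freqNorm_pow_le_wt ξ hk) (sq_nonneg _)) hA

theorem exists_freqNorm_mul_le {A : ℤ × ℤ → ℝ} (hA : Summable fun ξ => wt ξ * A ξ ^ 2) :
    ∃ C, 0 ≤ C ∧ ∀ ξ, freqNorm ξ * A ξ ≤ C := by
  have h := summable_of_wt hA (k := 2) (by norm_num)
  have h0 : ∀ ξ, 0 ≤ freqNorm ξ ^ 2 * A ξ ^ 2 := fun ξ => by positivity
  refine ⟨1 + ∑' ξ, freqNorm ξ ^ 2 * A ξ ^ 2, add_nonneg zero_le_one (tsum_nonneg h0), fun ξ => ?_⟩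
  have h1 := h.le_tsum ξ fun j _ => h0 j
  nlinarith [sq_nonneg (freqNorm ξ * A ξ - 1)]

/-- `∫ u² u_x = 0`, on the Fourier side: the trilinear sum over frequencies with sum zero vanishes
because its cyclic permutations add up to zero. -/
theorem tsum_star_mul_conv (hh : ∀ ξ, a (-ξ) = star (a ξ))
    (ha : Summable fun ξ => wt ξ * ‖a ξ‖ ^ 2) :
    (Summable fun ξ => star (a ξ) * ((ξ.1 : ℂ) * conv a a ξ)) ∧
      ∑' ξ, star (a ξ) * ((ξ.1 : ℂ) * conv a a ξ) = 0 := by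
  obtain ⟨C, hC0, hC⟩ := exists_freqNorm_mul_le ha
  have hA := (summable_of_wt_sq (fun ξ => norm_nonneg (a ξ)) ha).1
  let S : (ℤ × ℤ) × (ℤ × ℤ) → ℂ := fun p => a (-p.1) * ((p.1.1 : ℂ) * (a p.2 * a (p.1 - p.2)))
  have hS : Summable S := by
    refine Summable.of_norm_bounded ((summable_conv_prod (fun ξ => norm_nonneg (a ξ))
      (fun ξ => norm_nonneg (a ξ)) hA hA).mul_left C) fun p => ?_
    have h1 : ‖a p.1‖ * |(p.1.1 : ℝ)| ≤ C := by
      refine le_trans ?_ (hC p.1)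
      rw [mul_comm]
      exact mul_le_mul_of_nonneg_right (abs_fst_le_freqNorm _) (norm_nonneg _)
    simp only [S, norm_mul, hh, norm_star, Complex.norm_intCast]
    rw [← mul_assoc]
    exact mul_le_mul_of_nonneg_right h1 (by positivity)
  have hfib : ∀ ξ, ∑' ζ, S (ξ, ζ) = star (a ξ) * ((ξ.1 : ℂ) * conv a a ξ) := by
    intro ξ
    simp only [S, tsum_mul_left, hh, conv]
  have hT : ∑' p, S p = ∑' ξ, star (a ξ) * ((ξ.1 : ℂ) * conv a a ξ) := by
    rw [hS.tsum_prod]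
    exact tsum_congr hfib
  refine ⟨by simpa only [hfib] using hS.prod, ?_⟩
  rw [← hT]
  -- With `p = (ξ, ζ)` the three frequencies are `-ξ`, `ζ` and `ξ - ζ`; `σ` permutes them cyclically.
  let σ : (ℤ × ℤ) × (ℤ × ℤ) ≃ (ℤ × ℤ) × (ℤ × ℤ) :=
    { toFun := fun p => (-p.2, p.1 - p.2)
      invFun := fun p => (p.2 - p.1, -p.1)
      left_inv := fun p => by ext <;> simp
      right_inv := fun p => by ext <;> simp }
  have h1 : ∑' p, S (σ p) = ∑' p, S p := σ.tsum_eq S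
  have h2 : ∑' p, S (σ (σ p)) = ∑' p, S p := (σ.tsum_eq fun p => S (σ p)).trans h1
  have hS1 : Summable fun p => S (σ p) := σ.summable_iff.2 hS
  have hS2 : Summable fun p => S (σ (σ p)) := (σ.summable_iff (f := fun p => S (σ p))).2 hS1
  have hz : ∀ p, S p + S (σ p) + S (σ (σ p)) = 0 := by
    intro p
    have e1 : -p.2 - (p.1 - p.2) = -p.1 := by abel
    have e2 : -(p.1 - p.2) - -p.1 = p.2 := by abel
    simp only [S, σ, Equiv.coe_fn_mk, e1, e2, neg_neg, Prod.fst_neg, Prod.fst_sub, Int.cast_neg,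
      Int.cast_sub]
    ring
  have h3 : ∑' p, S p + ∑' p, S p + ∑' p, S p = 0 := by
    conv_lhs => enter [1, 2]; rw [← h1]
    conv_lhs => enter [2]; rw [← h2]
    rw [← hS.tsum_add hS1, ← (hS.add hS1).tsum_add hS2]
    simp only [hz, tsum_zero]
  linear_combination h3 / 3

theorem conv_self_zero (hh : ∀ ξ, a (-ξ) = star (a ξ)) :
    conv a a 0 = ((∑' ξ, ‖a ξ‖ ^ 2 : ℝ) : ℂ) := by
  rw [conv, Complex.ofReal_tsum]
  refine tsum_congr fun ζ => ?_
  rw [zero_sub, hh, Complex.star_def, Complex.mul_conj, Complex.normSq_eq_norm_sq]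

end Cancellation

/-! ### Dissipation for odd functions -/

/-- The triangle function: the Fourier coefficients of the Fejér kernel. -/
def fejer (N : ℕ) (k : ℤ) : ℝ := max 0 (1 - |(k : ℝ)| / N)

theorem fejer_zero (N : ℕ) : fejer N 0 = 1 := by simp [fejer]

theorem abs_fejer_le (N : ℕ) (k : ℤ) : |fejer N k| ≤ 1 := by
  rw [fejer, abs_of_nonneg (le_max_left _ _)]
  refine max_le zero_le_one ?_
  have : 0 ≤ |(k : ℝ)| / N := by positivity
  linarith

theorem fejer_eq_zero {N : ℕ} (hN : 0 < N) {k : ℤ} (hk : k ∉ Finset.Icc (-(N : ℤ)) N) :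
    fejer N k = 0 := by
  have h1 : (N : ℤ) < |k| := by
    rw [Finset.mem_Icc, ← abs_le] at hk
    exact not_le.1 hk
  have h2 : (N : ℝ) < |(k : ℝ)| := by exact_mod_cast h1
  refine max_eq_left ?_
  rw [sub_nonpos, one_le_div (by positivity)]
  exact h2.le

theorem abs_fejer_sub_le {N : ℕ} (hN : 0 < N) (j m : ℤ) :
    |fejer N (j + m) - fejer N (j - m)| ≤ 2 / N * (|(j : ℝ)| * |(m : ℝ)|) := by
  have hN' : (0 : ℝ) < N := by positivity
  have h1 : |fejer N (j + m) - fejer N (j - m)| ≤ |(|(j - m : ℝ)| - |(j + m : ℝ)|)| / N := by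
    refine (abs_max_sub_max_le_max _ _ _ _).trans ?_
    rw [sub_self, abs_zero, max_eq_right (abs_nonneg _)]
    have : 1 - |((j + m : ℤ) : ℝ)| / N - (1 - |((j - m : ℤ) : ℝ)| / N) =
        (|(j - m : ℝ)| - |(j + m : ℝ)|) / N := by push_cast; ring
    rw [this, abs_div, abs_of_pos hN']
  refine h1.trans ?_
  rw [div_mul_eq_mul_div]
  gcongr
  rcases eq_or_ne j 0 with rfl | hj
  · simp
  rcases eq_or_ne m 0 with rfl | hm
  · simp
  have hj1 : 1 ≤ |(j : ℝ)| := by exact_mod_cast Int.one_le_abs hj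
  have h2 : |(j - m : ℝ) - (-(j + m))| = 2 * |(j : ℝ)| ∧ |(j - m : ℝ) - (j + m)| = 2 * |(m : ℝ)| := by
    constructor
    · rw [show (j - m : ℝ) - (-(j + m)) = 2 * j by ring, abs_mul, abs_two]
    · rw [show (j - m : ℝ) - (j + m) = -2 * m by ring, abs_mul]; norm_num
  have h3 := abs_abs_sub_abs_le (j - m : ℝ) (j + m)
  rw [h2.2] at h3
  nlinarith [abs_nonneg (m : ℝ)]

theorem two_mul_abs_mul_le (a : ℤ × ℤ → ℂ) (j n m : ℤ) :
    2 * (|(j : ℝ)| * |(m : ℝ)| * (‖a (j, n)‖ * ‖a (m, -n)‖)) ≤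
      (wt (j, n) * ‖a (j, n)‖ ^ 2) * (1 / (m : ℝ) ^ 2) +
        (wt (m, -n) * ‖a (m, -n)‖ ^ 2) * (1 / (j : ℝ) ^ 2) := by
  have hj4 : ∀ (j n : ℤ), |(j : ℝ)| ^ 4 ≤ wt (j, n) := fun j n =>
    (pow_le_pow_left₀ (abs_nonneg _) (abs_fst_le_freqNorm (j, n)) 4).trans
      (freqNorm_pow_le_wt _ le_rfl)
  -- At `j = 0` this holds because `0⁻¹ = 0`; the corresponding terms vanish anyway.
  have hinv : ∀ j : ℤ, |(j : ℝ)| = |(j : ℝ)| ^ 2 * |(j : ℝ)|⁻¹ := fun j => by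
    rcases eq_or_ne j 0 with rfl | hj
    · simp
    · have : |(j : ℝ)| ≠ 0 := by simpa using hj
      field_simp
  have hX1 : |(j : ℝ)| ^ 4 * ‖a (j, n)‖ ^ 2 * (|(m : ℝ)|⁻¹) ^ 2 ≤
      (wt (j, n) * ‖a (j, n)‖ ^ 2) * (1 / (m : ℝ) ^ 2) := by
    rw [one_div]
    rw [inv_pow, sq_abs]
    have := hj4 j n
    gcongr
  have hX2 : |(m : ℝ)| ^ 4 * ‖a (m, -n)‖ ^ 2 * (|(j : ℝ)|⁻¹) ^ 2 ≤
      (wt (m, -n) * ‖a (m, -n)‖ ^ 2) * (1 / (j : ℝ) ^ 2) := by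
    rw [one_div]
    rw [inv_pow, sq_abs]
    have := hj4 m (-n)
    gcongr
  have h3 : |(j : ℝ)| * |(m : ℝ)| * (‖a (j, n)‖ * ‖a (m, -n)‖) =
      (|(j : ℝ)| ^ 2 * ‖a (j, n)‖ * |(m : ℝ)|⁻¹) * (|(m : ℝ)| ^ 2 * ‖a (m, -n)‖ * |(j : ℝ)|⁻¹) := by
    conv_lhs => rw [hinv j, hinv m]
    ring
  rw [h3]
  nlinarith [sq_nonneg (|(j : ℝ)| ^ 2 * ‖a (j, n)‖ * |(m : ℝ)|⁻¹ -
    |(m : ℝ)| ^ 2 * ‖a (m, -n)‖ * |(j : ℝ)|⁻¹)]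

/-- The terms of the double series that expresses the mean of `u²` against a function of `x` with
Fourier coefficients `F`, where `F` is evaluated at a function of the pair of frequencies. -/
def pairTerm (a : ℤ × ℤ → ℂ) (F : (ℤ × ℤ) × ℤ → ℝ) (p : (ℤ × ℤ) × ℤ) : ℂ :=
  (F p : ℂ) * (a p.1 * a (p.2, -p.1.2))

theorem summable_pairTerm {a : ℤ × ℤ → ℂ} (hA : Summable fun ξ => ‖a ξ‖)
    {F : (ℤ × ℤ) × ℤ → ℝ} (hF : ∀ p, |F p| ≤ 1) : Summable (pairTerm a F) := by
  have hA2 : Summable fun p : (ℤ × ℤ) × (ℤ × ℤ) => ‖a p.1‖ * ‖a p.2‖ :=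
    hA.mul_of_nonneg hA (fun ξ => norm_nonneg (a ξ)) (fun ξ => norm_nonneg (a ξ))
  have hinj : Function.Injective
      fun p : (ℤ × ℤ) × ℤ => ((p.1, (p.2, -p.1.2)) : (ℤ × ℤ) × (ℤ × ℤ)) := by
    rintro ⟨p, m⟩ ⟨q, n⟩ h
    simp only [Prod.mk.injEq] at h
    simp [h.1, h.2.1]
  refine Summable.of_norm_bounded (hA2.comp_injective hinj) fun p => ?_
  simp only [pairTerm, norm_mul, Complex.norm_real, Function.comp, Real.norm_eq_abs]
  exact mul_le_of_le_one_left (by positivity) (hF p)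

/-- The mean of `u²` against the Fejér kernel as a double series over the frequencies `(j, n)` and
`(m, -n)` of the two factors. -/
theorem sum_fejer_mul_conv {a : ℤ × ℤ → ℂ} (hA : Summable fun ξ => ‖a ξ‖) {N : ℕ} (hN : 0 < N) :
    ∑ k ∈ Finset.Icc (-(N : ℤ)) N, (fejer N k : ℂ) * conv a a (k, 0) =
      ∑' p, pairTerm a (fun p => fejer N (p.1.1 + p.2)) p := by
  let σ : (ℤ × ℤ) × ℤ ≃ (ℤ × ℤ) × ℤ :=
    { toFun := fun p => (p.1, p.2 - p.1.1)
      invFun := fun p => (p.1, p.2 + p.1.1)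
      left_inv := fun p => by ext <;> simp
      right_inv := fun p => by ext <;> simp }
  let g : (ℤ × ℤ) × ℤ → ℂ := fun p => (fejer N p.2 : ℂ) * (a p.1 * a ((p.2, 0) - p.1))
  have hσ : ∀ p, pairTerm a (fun p => fejer N (p.1.1 + p.2)) (σ p) = g p := by
    rintro ⟨⟨j, n⟩, k⟩
    simp [pairTerm, σ, g]
  have hs : Summable g := by
    refine (σ.summable_iff.2 (summable_pairTerm hA
      (F := fun p => fejer N (p.1.1 + p.2)) fun p => abs_fejer_le _ _)).congr fun p => ?_
    exact hσ p
  have hk : ∀ k, ∑' ζ, g (ζ, k) = (fejer N k : ℂ) * conv a a (k, 0) := fun k => by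
    rw [conv, ← tsum_mul_left]
  rw [← σ.tsum_eq]
  simp only [hσ]
  rw [hs.tsum_prod, ← Summable.tsum_comm (f := fun ζ k => g (ζ, k)) hs]
  simp only [hk]
  refine (tsum_eq_sum fun k hk => ?_).symm
  rw [fejer_eq_zero hN hk, Complex.ofReal_zero, zero_mul]

/-- Reflecting one of the two factors changes the sign. -/
theorem tsum_pairTerm_reflect {a : ℤ × ℤ → ℂ} (hodd : ∀ ξ, a (-ξ.1, ξ.2) = -a ξ) (N : ℕ) :
    ∑' p, pairTerm a (fun p => fejer N (p.1.1 + p.2)) p =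
      -∑' p, pairTerm a (fun p => fejer N (p.1.1 - p.2)) p := by
  let ρ : (ℤ × ℤ) × ℤ ≃ (ℤ × ℤ) × ℤ := (Equiv.refl _).prodCongr (Equiv.neg ℤ)
  rw [← ρ.tsum_eq, ← tsum_neg]
  refine tsum_congr fun p => ?_
  have h := hodd (p.2, -p.1.2)
  simp only [pairTerm, ρ, Equiv.prodCongr_apply, Equiv.coe_refl, Prod.map, id, Equiv.neg_apply,
    ← sub_eq_add_neg]
  rw [h]
  ring

/-- For `u` odd in `x`, the mean of `u²` against the Fejér kernel in `x` is of size `N⁻¹ ‖Δu‖²`: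
the kernel concentrates at `x = 0`, where `u` vanishes. -/
theorem norm_sum_fejer_conv_le {a : ℤ × ℤ → ℂ} (hodd : ∀ ξ, a (-ξ.1, ξ.2) = -a ξ)
    (ha : Summable fun ξ => wt ξ * ‖a ξ‖ ^ 2) {N : ℕ} (hN : 0 < N) :
    ‖∑ k ∈ Finset.Icc (-(N : ℤ)) N, (fejer N k : ℂ) * conv a a (k, 0)‖ ≤
      1 / N * ((∑' n : ℤ, 1 / (n : ℝ) ^ 2) * ∑' ξ, wt ξ * ‖a ξ‖ ^ 2) := by
  have hA := (summable_of_wt_sq (fun ξ => norm_nonneg (a ξ)) ha).1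
  have hG1 := summable_pairTerm hA (F := fun p => fejer N (p.1.1 + p.2)) fun p => abs_fejer_le _ _
  have hG2 := summable_pairTerm hA (F := fun p => fejer N (p.1.1 - p.2)) fun p => abs_fejer_le _ _
  have hflip := tsum_pairTerm_reflect hodd N
  -- Averaging over the reflection of one factor replaces the Fejér coefficients by the differences
  -- `F (j + m) - F (j - m)`, which are of size `N⁻¹ |j| |m|`.
  have h2Q : 2 * ∑' p, pairTerm a (fun p => fejer N (p.1.1 + p.2)) p =
      ∑' p, (pairTerm a (fun p => fejer N (p.1.1 + p.2)) p -
        pairTerm a (fun p => fejer N (p.1.1 - p.2)) p) := by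
    rw [hG1.tsum_sub hG2, ← neg_eq_iff_eq_neg.2 hflip]; ring
  let X : (ℤ × ℤ) × ℤ → ℝ := fun p => (wt p.1 * ‖a p.1‖ ^ 2) * (1 / (p.2 : ℝ) ^ 2)
  let τ : (ℤ × ℤ) × ℤ ≃ (ℤ × ℤ) × ℤ :=
    { toFun := fun p => ((p.2, -p.1.2), p.1.1)
      invFun := fun p => ((p.2, -p.1.2), p.1.1)
      left_inv := fun p => by ext <;> simp
      right_inv := fun p => by ext <;> simp }
  have hZ : Summable fun n : ℤ => 1 / (n : ℝ) ^ 2 := Real.summable_one_div_int_pow.2 (by norm_num)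
  have hw0 : ∀ ξ, 0 ≤ wt ξ * ‖a ξ‖ ^ 2 := fun ξ => mul_nonneg (wt_pos ξ).le (sq_nonneg _)
  have hX : Summable X := ha.mul_of_nonneg hZ hw0 (fun n => by positivity)
  have hXτ : Summable fun p => X (τ p) := τ.summable_iff.2 hX
  have hXt : ∑' p, X p = (∑' n : ℤ, 1 / (n : ℝ) ^ 2) * ∑' ξ, wt ξ * ‖a ξ‖ ^ 2 := by
    rw [mul_comm, ha.tsum_mul_tsum hZ hX]
  have hXτt : ∑' p, X (τ p) = ∑' p, X p := τ.tsum_eq X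
  have hpt : ∀ p, ‖pairTerm a (fun p => fejer N (p.1.1 + p.2)) p -
      pairTerm a (fun p => fejer N (p.1.1 - p.2)) p‖ ≤ 1 / N * (X p + X (τ p)) := by
    rintro ⟨⟨j, n⟩, m⟩
    simp only [pairTerm]
    rw [← sub_mul, ← Complex.ofReal_sub, norm_mul, norm_mul, Complex.norm_real, Real.norm_eq_abs]
    refine (mul_le_mul_of_nonneg_right (abs_fejer_sub_le hN j m) (by positivity)).trans ?_
    calc 2 / (N : ℝ) * (|(j : ℝ)| * |(m : ℝ)|) * (‖a (j, n)‖ * ‖a (m, -n)‖)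
        = 1 / N * (2 * (|(j : ℝ)| * |(m : ℝ)| * (‖a (j, n)‖ * ‖a (m, -n)‖))) := by ring
      _ ≤ _ := mul_le_mul_of_nonneg_left (two_mul_abs_mul_le a j n m) (by positivity)
  have hbound := tsum_of_norm_bounded ((hX.add hXτ).mul_left (1 / (N : ℝ))).hasSum hpt
  rw [← h2Q, tsum_mul_left, hX.tsum_add hXτ, hXτt, hXt, norm_mul, Complex.norm_ofNat] at hbound
  rw [sum_fejer_mul_conv hA hN]
  linarith

/-- The energy `∑ |a_ξ|²`, which is `(2π)⁻² ‖u‖²_{L²}`. -/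
def energy (a : ℤ × ℤ → ℂ) : ℝ := ∑' ξ, ‖a ξ‖ ^ 2

theorem energy_nonneg (a : ℤ × ℤ → ℂ) : 0 ≤ energy a := tsum_nonneg fun _ => by positivity

theorem summable_sq_of_wt {A : ℤ × ℤ → ℝ} (hA : Summable fun ξ => wt ξ * A ξ ^ 2) :
    Summable fun ξ => A ξ ^ 2 := by
  simpa using summable_of_wt hA (k := 0) (by norm_num)

namespace ModeSol

variable {l : ℤ × ℤ → ℝ} {c K T : ℝ} {a : ℝ → ℤ × ℤ → ℂ}

theorem continuousOn_energy (ha : ModeSol l T a) {A : ℤ × ℤ → ℝ}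
    (hA : Summable fun ξ => wt ξ * A ξ ^ 2) (haA : ∀ t ∈ Set.Icc 0 T, ∀ ξ, ‖a t ξ‖ ≤ A ξ) :
    ContinuousOn (fun t => energy (a t)) (Set.Icc 0 T) := by
  refine continuousOn_tsum (fun ξ => ((ha.cont ξ).norm.pow 2).continuousOn)
    (summable_sq_of_wt hA) fun ξ t ht => ?_
  rw [Real.norm_eq_abs, abs_of_nonneg (by positivity)]
  exact pow_le_pow_left₀ (norm_nonneg _) (haA t ht ξ) 2

/-- The energy identity: the nonlinearity does not contribute. -/
theorem hasDerivAt_energy (hl : IsParabolic l c K) (ha : ModeSol l T a) {A : ℤ × ℤ → ℝ}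
    (hA0 : ∀ ξ, 0 ≤ A ξ) (hA : Summable fun ξ => wt ξ * A ξ ^ 2)
    (haA : ∀ t ∈ Set.Icc 0 T, ∀ ξ, ‖a t ξ‖ ≤ A ξ) {t : ℝ} (ht : t ∈ Set.Ioo 0 T)
    (hh : ∀ ξ, a t (-ξ) = star (a t ξ)) :
    HasDerivAt (fun t => energy (a t)) (-2 * ∑' ξ, l ξ * ‖a t ξ‖ ^ 2) t := by
  have hA1 := (summable_of_wt_sq hA0 hA).1
  obtain ⟨C, hC0, hC⟩ := exists_freqNorm_mul_le hA
  let d : ℤ × ℤ → ℝ → ℝ := fun ξ s => 2 * inner ℝ (a s ξ) (-(nl (a s) ξ + l ξ * a s ξ))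
  have hd : ∀ ξ, ∀ s ∈ Set.Ioo 0 T, HasDerivAt (fun s => ‖a s ξ‖ ^ 2) (d ξ s) s :=
    fun ξ s hs => (ha.deriv ξ s hs).norm_sq
  have hu : Summable fun ξ => 2 * (C * conv A A ξ + K * (wt ξ * A ξ ^ 2)) :=
    (((summable_conv hA0 hA0 hA1 hA1).mul_left C).add (hA.mul_left K)).mul_left 2
  have hdu : ∀ ξ, ∀ s ∈ Set.Ioo 0 T,
      ‖d ξ s‖ ≤ 2 * (C * conv A A ξ + K * (wt ξ * A ξ ^ 2)) := by
    intro ξ s hs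
    have hs' := haA s (Set.Ioo_subset_Icc_self hs)
    have hr := freqNorm_nonneg ξ
    have hcv := conv_nonneg hA0 hA0 ξ
    have hw := wt_pos ξ
    have hA0ξ := hA0 ξ
    have hK := hl.K_pos
    have h1 : ‖nl (a s) ξ‖ ≤ freqNorm ξ * conv A A ξ :=
      (norm_nl_le _ _).trans (mul_le_mul_of_nonneg_left (norm_conv_le hA1 hA1 hs' hs' ξ) hr)
    have h2 : ‖(l ξ : ℂ) * a s ξ‖ ≤ K * wt ξ * A ξ := by
      rw [norm_mul, Complex.norm_real, Real.norm_eq_abs]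
      exact mul_le_mul (hl.upper ξ) (hs' ξ) (norm_nonneg _) (by positivity)
    simp only [d]
    rw [norm_mul, Real.norm_ofNat]
    gcongr
    calc ‖inner ℝ (a s ξ) (-(nl (a s) ξ + l ξ * a s ξ))‖
        ≤ ‖a s ξ‖ * ‖-(nl (a s) ξ + l ξ * a s ξ)‖ := norm_inner_le_norm _ _
      _ ≤ A ξ * (freqNorm ξ * conv A A ξ + K * wt ξ * A ξ) := by
          rw [norm_neg]
          gcongr
          · exact hs' ξ
          · exact (norm_add_le _ _).trans (add_le_add h1 h2)
      _ = (freqNorm ξ * A ξ) * conv A A ξ + K * (wt ξ * A ξ ^ 2) := by ring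
      _ ≤ _ := by gcongr; exact hC ξ
  have hat : Summable fun ξ => wt ξ * ‖a t ξ‖ ^ 2 :=
    Summable.of_nonneg_of_le (fun ξ => mul_nonneg (wt_pos ξ).le (sq_nonneg _)) (fun ξ =>
      mul_le_mul_of_nonneg_left (pow_le_pow_left₀ (norm_nonneg _)
        (haA t (Set.Ioo_subset_Icc_self ht) ξ) 2) (wt_pos ξ).le) hA
  have h := hasDerivAt_tsum_of_isPreconnected hu isOpen_Ioo isPreconnected_Ioo hd hdu ht
    (summable_sq_of_wt hat) ht
  refine h.congr_deriv ?_
  obtain ⟨hs, h0⟩ := tsum_star_mul_conv hh hat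
  have hls : Summable fun ξ => l ξ * ‖a t ξ‖ ^ 2 := by
    refine Summable.of_norm_bounded (hat.mul_left K) fun ξ => ?_
    rw [norm_mul, Real.norm_eq_abs, norm_pow, norm_norm, ← mul_assoc]
    exact mul_le_mul_of_nonneg_right (hl.upper ξ) (sq_nonneg _)
  have hre : Summable fun ξ => (Complex.I * (star (a t ξ) * ((ξ.1 : ℂ) * conv (a t) (a t) ξ))).re :=
    (Complex.reCLM.summable (hs.mul_left Complex.I))
  have hd' : ∀ ξ, d ξ t = -2 * (l ξ * ‖a t ξ‖ ^ 2) -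
      (Complex.I * (star (a t ξ) * ((ξ.1 : ℂ) * conv (a t) (a t) ξ))).re := by
    intro ξ
    have h1 : ((‖a t ξ‖ ^ 2 : ℝ) : ℂ) = a t ξ * star (a t ξ) := by
      rw [Complex.star_def, Complex.mul_conj, Complex.normSq_eq_norm_sq]
    have h2 : (2 : ℂ) * (-(nl (a t) ξ + l ξ * a t ξ) * star (a t ξ)) =
        ((-2 * (l ξ * ‖a t ξ‖ ^ 2) : ℝ) : ℂ) -
          Complex.I * (star (a t ξ) * ((ξ.1 : ℂ) * conv (a t) (a t) ξ)) := by
      push_cast at h1 ⊢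
      rw [h1, nl]
      ring
    have h3 := congrArg Complex.re h2
    rw [Complex.sub_re, Complex.ofReal_re] at h3
    rw [← h3]
    simp only [d, Complex.inner]
    rw [show (2 : ℂ) = ((2 : ℝ) : ℂ) by norm_num, Complex.re_ofReal_mul]
    rfl
  simp only [hd']
  rw [(hls.mul_left (-2)).tsum_sub hre, tsum_mul_left,
    ← Complex.re_tsum (hs.mul_left Complex.I), tsum_mul_left, h0]
  simp

end ModeSol

/-- The value at `u` of a linear functional that sees finitely many modes independent of `y`. -/
def axisSum (N : ℕ) (b a : ℤ × ℤ → ℂ) : ℂ := ∑ k ∈ Finset.Icc (-(N : ℤ)) N, b (k, 0) * a (k, 0)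

theorem norm_axisSum_le (N : ℕ) (b : ℤ × ℤ → ℂ) {a : ℤ × ℤ → ℂ}
    (ha : Summable fun ξ => ‖a ξ‖ ^ 2) :
    2 * ‖axisSum N b a‖ ≤
      energy a / 2 + 2 * (∑ k ∈ Finset.Icc (-(N : ℤ)) N, ‖b (k, 0)‖) ^ 2 := by
  set B := ∑ k ∈ Finset.Icc (-(N : ℤ)) N, ‖b (k, 0)‖ with hB
  have hE := energy_nonneg a
  have h1 : ∀ ξ, ‖a ξ‖ ≤ √(energy a) := fun ξ =>
    Real.le_sqrt_of_sq_le (ha.le_tsum ξ fun j _ => by positivity)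
  have h2 : ‖axisSum N b a‖ ≤ B * √(energy a) := by
    rw [hB, Finset.sum_mul]
    refine (norm_sum_le _ _).trans (Finset.sum_le_sum fun k _ => ?_)
    rw [norm_mul]
    exact mul_le_mul_of_nonneg_left (h1 _) (norm_nonneg _)
  nlinarith [Real.sq_sqrt hE, sq_nonneg (√(energy a) - 2 * B)]

/-- The conjugate Fourier coefficients of the background function `φ(x)`, for which `φ_x` is `μ`
minus `μ` times the Fejér kernel. The value at `ξ.1 = 0` is `0`, by division by zero: `φ` has mean
zero. -/
def background (μ : ℝ) (N : ℕ) (ξ : ℤ × ℤ) : ℂ := -(Complex.I * (μ * fejer N ξ.1 / ξ.1))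

/-- The energy relative to the background function, up to a constant: `‖u - φ‖² - ‖φ‖²`. -/
def relEnergy (μ : ℝ) (N : ℕ) (a : ℤ × ℤ → ℂ) : ℝ :=
  energy a - 2 * (axisSum N (background μ N) a).re

theorem background_mul_nl (μ : ℝ) (N : ℕ) (a : ℤ × ℤ → ℂ) (k : ℤ) :
    background μ N (k, 0) * nl a (k, 0) =
      μ / 2 * ((fejer N k : ℂ) * conv a a (k, 0) - if k = 0 then conv a a 0 else 0) := by
  by_cases hk : k = 0
  · subst hk
    rw [if_pos rfl, fejer_zero, show ((0 : ℤ), (0 : ℤ)) = (0 : ℤ × ℤ) from rfl]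
    simp [background]
  · have hk' : (k : ℂ) ≠ 0 := by exact_mod_cast hk
    rw [if_neg hk, sub_zero, background, nl]
    field_simp
    linear_combination (-(μ : ℂ) * fejer N k * conv a a (k, 0)) * Complex.I_sq

namespace ModeSol

variable {l : ℤ × ℤ → ℝ} {c K T : ℝ} {a : ℝ → ℤ × ℤ → ℂ}

/-- The nonlinearity enters the relative energy as `-μ ‖u‖²` and the mean of `u²` against the Fejér
kernel. -/
theorem hasDerivAt_relEnergy (hl : IsParabolic l c K) (ha : ModeSol l T a) {A : ℤ × ℤ → ℝ}
    (hA0 : ∀ ξ, 0 ≤ A ξ) (hA : Summable fun ξ => wt ξ * A ξ ^ 2)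
    (haA : ∀ t ∈ Set.Icc 0 T, ∀ ξ, ‖a t ξ‖ ≤ A ξ) (μ : ℝ) (N : ℕ) {t : ℝ}
    (ht : t ∈ Set.Ioo 0 T) (hh : ∀ ξ, a t (-ξ) = star (a t ξ)) :
    HasDerivAt (fun t => relEnergy μ N (a t))
      (-2 * (∑' ξ, l ξ * ‖a t ξ‖ ^ 2) +
        μ * ((∑ k ∈ Finset.Icc (-(N : ℤ)) N, (fejer N k : ℂ) * conv (a t) (a t) (k, 0)).re -
          energy (a t)) + 2 * (axisSum N (fun ξ => background μ N ξ * l ξ) (a t)).re) t := by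
  have h1 := ha.hasDerivAt_energy hl hA0 hA haA ht hh
  have h2 : HasDerivAt (fun t => axisSum N (background μ N) (a t))
      (∑ k ∈ Finset.Icc (-(N : ℤ)) N,
        background μ N (k, 0) * -(nl (a t) (k, 0) + l (k, 0) * a t (k, 0))) t := by
    unfold axisSum
    exact HasDerivAt.fun_sum fun k _ => (ha.deriv (k, 0) t ht).const_mul _
  have h3 := Complex.reCLM.hasFDerivAt.comp_hasDerivAt t h2
  refine (h1.sub (h3.const_mul 2)).congr_deriv ?_
  have h4 : ∑ k ∈ Finset.Icc (-(N : ℤ)) N,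
        background μ N (k, 0) * -(nl (a t) (k, 0) + l (k, 0) * a t (k, 0)) =
      ((μ / 2 : ℝ) : ℂ) * ((energy (a t) : ℂ) -
        ∑ k ∈ Finset.Icc (-(N : ℤ)) N, (fejer N k : ℂ) * conv (a t) (a t) (k, 0)) -
      axisSum N (fun ξ => background μ N ξ * l ξ) (a t) := by
    have hz : (0 : ℤ) ∈ Finset.Icc (-(N : ℤ)) N := by simp
    have h5 : ∀ k : ℤ, background μ N (k, 0) * -(nl (a t) (k, 0) + l (k, 0) * a t (k, 0)) =
        ((μ / 2 : ℝ) : ℂ) * (if k = 0 then conv (a t) (a t) 0 else 0) -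
          ((μ / 2 : ℝ) : ℂ) * ((fejer N k : ℂ) * conv (a t) (a t) (k, 0)) -
          background μ N (k, 0) * l (k, 0) * a t (k, 0) := by
      intro k
      have := background_mul_nl μ N (a t) k
      push_cast
      linear_combination -this
    simp only [h5, Finset.sum_sub_distrib, ← Finset.mul_sum, Finset.sum_ite_eq', hz, if_true]
    rw [conv_self_zero hh, ← mul_sub]
    rfl
  rw [h4]
  simp only [Complex.reCLM_apply, Complex.sub_re, Complex.re_ofReal_mul, Complex.ofReal_re]
  ring

end ModeSol

/-- Dissipation of the `L²` norm: uniformly over all solutions that are real and odd in `x`, the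
energy decays exponentially up to an additive constant. -/
theorem exists_energy_le {l : ℤ × ℤ → ℝ} {c K : ℝ} (hl : IsParabolic l c K) :
    ∃ D, 0 ≤ D ∧ ∀ (T : ℝ) (a : ℝ → ℤ × ℤ → ℂ), ModeSol l T a → IsOddReal (a 0) →
      (Summable fun ξ => wt ξ * ‖a 0 ξ‖ ^ 2) →
      ∀ t ∈ Set.Icc 0 T, energy (a t) ≤ 3 * Real.exp (-t) * energy (a 0) + D := by
  set Z : ℝ := ∑' n : ℤ, 1 / (n : ℝ) ^ 2 with hZ
  have hZ0 : 0 ≤ Z := tsum_nonneg fun n => by positivity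
  -- The slope `μ` of the background function beats the growth rate `2 K` of the linear part.
  set μ : ℝ := 2 * K + 2 with hμ
  have hμ0 : 0 ≤ μ := by linarith [hl.K_pos]
  have hc := hl.c_pos
  -- The Fejér kernel is so concentrated that its contribution is absorbed by the dissipation.
  obtain ⟨N, hN⟩ := exists_nat_gt (μ * Z / (2 * c))
  have hN0 : (0 : ℝ) < N := lt_of_le_of_lt (by positivity) hN
  have hN1 : 0 < N := by exact_mod_cast hN0
  have hNZ : μ * (1 / N * Z) ≤ 2 * c := by
    rw [div_lt_iff₀ (by positivity)] at hN
    rw [show μ * (1 / N * Z) = μ * Z / N by ring, div_le_iff₀ hN0]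
    linarith
  set B₁ : ℝ := ∑ k ∈ Finset.Icc (-(N : ℤ)) N, ‖background μ N (k, 0)‖ with hB₁
  set B₂ : ℝ := ∑ k ∈ Finset.Icc (-(N : ℤ)) N, ‖background μ N (k, 0) * l (k, 0)‖ with hB₂
  set D' : ℝ := 2 * B₁ ^ 2 + 2 * B₂ ^ 2 with hD'
  refine ⟨8 * B₁ ^ 2 + 2 * D', by positivity, fun T a ha h0 hs t ht => ?_⟩
  have hT : 0 ≤ T := ht.1.trans ht.2
  obtain ⟨A, hA0, hA, haA⟩ := ha.exists_env hl hs
  have hodd := ha.isOddReal hl hT h0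
  have hwt : ∀ t ∈ Set.Icc 0 T, Summable fun ξ => wt ξ * ‖a t ξ‖ ^ 2 := fun t ht =>
    Summable.of_nonneg_of_le (fun ξ => mul_nonneg (wt_pos ξ).le (sq_nonneg _)) (fun ξ =>
      mul_le_mul_of_nonneg_left (pow_le_pow_left₀ (norm_nonneg _) (haA t ht ξ) 2)
        (wt_pos ξ).le) hA
  have hsq : ∀ t ∈ Set.Icc 0 T, Summable fun ξ => ‖a t ξ‖ ^ 2 := fun t ht =>
    summable_sq_of_wt (hwt t ht)
  have hP : ∀ t ∈ Set.Icc 0 T,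
      |2 * (axisSum N (background μ N) (a t)).re| ≤ energy (a t) / 2 + 2 * B₁ ^ 2 := by
    intro t ht
    rw [abs_mul, abs_two]
    exact (mul_le_mul_of_nonneg_left (Complex.abs_re_le_norm _) zero_le_two).trans
      (norm_axisSum_le N _ (hsq t ht))
  have hcontP : ContinuousOn (fun t => relEnergy μ N (a t)) (Set.Icc 0 T) := by
    refine (ha.continuousOn_energy hA haA).sub (Continuous.continuousOn ?_)
    have hcP : Continuous fun t => axisSum N (background μ N) (a t) :=
      continuous_finsetSum _ fun k _ => continuous_const.mul (ha.cont (k, 0))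
    fun_prop
  have hder : ∀ s ∈ Set.Ioo 0 T, ∃ Φ' : ℝ,
      HasDerivAt (fun t => relEnergy μ N (a t)) Φ' s ∧ Φ' ≤ -relEnergy μ N (a s) + D' := by
    intro s hs
    have hs' := Set.Ioo_subset_Icc_self hs
    refine ⟨_, ha.hasDerivAt_relEnergy hl hA0 hA haA μ N hs (hodd s hs').herm, ?_⟩
    have hY := hwt s hs'
    set Y : ℝ := ∑' ξ, wt ξ * ‖a s ξ‖ ^ 2 with hYdef
    have hY0 : 0 ≤ Y := tsum_nonneg fun ξ => mul_nonneg (wt_pos ξ).le (sq_nonneg _)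
    have h1 : c * Y - K * energy (a s) ≤ ∑' ξ, l ξ * ‖a s ξ‖ ^ 2 := by
      have hls : Summable fun ξ => l ξ * ‖a s ξ‖ ^ 2 := by
        refine Summable.of_norm_bounded (hY.mul_left K) fun ξ => ?_
        rw [norm_mul, Real.norm_eq_abs, norm_pow, norm_norm, ← mul_assoc]
        exact mul_le_mul_of_nonneg_right (hl.upper ξ) (sq_nonneg _)
      rw [hYdef, energy, ← tsum_mul_left, ← tsum_mul_left,
        ← (hY.mul_left c).tsum_sub ((hsq s hs').mul_left K)]
      refine Summable.tsum_le_tsum (fun ξ => ?_)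
        ((hY.mul_left c).sub ((hsq s hs').mul_left K)) hls
      have := mul_le_mul_of_nonneg_right (hl.lower ξ) (sq_nonneg ‖a s ξ‖)
      linarith
    have h2 : μ * (∑ k ∈ Finset.Icc (-(N : ℤ)) N,
        (fejer N k : ℂ) * conv (a s) (a s) (k, 0)).re ≤ 2 * c * Y := by
      have := (Complex.re_le_norm _).trans (norm_sum_fejer_conv_le (hodd s hs').odd hY hN1)
      calc _ ≤ μ * (1 / N * (Z * Y)) := mul_le_mul_of_nonneg_left this hμ0
        _ = μ * (1 / N * Z) * Y := by ring
        _ ≤ _ := mul_le_mul_of_nonneg_right hNZ hY0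
    have h3 : 2 * (axisSum N (fun ξ => background μ N ξ * l ξ) (a s)).re ≤
        energy (a s) / 2 + 2 * B₂ ^ 2 :=
      (mul_le_mul_of_nonneg_left (Complex.re_le_norm _) zero_le_two).trans
        (norm_axisSum_le N _ (hsq s hs'))
    have h4 := (abs_le.1 (hP s hs')).1
    have h5 := energy_nonneg (a s)
    have h6 : relEnergy μ N (a s) ≤ 3 / 2 * energy (a s) + 2 * B₁ ^ 2 := by
      unfold relEnergy; linarith
    have h7 : μ * energy (a s) = 2 * (K * energy (a s)) + 2 * energy (a s) := by rw [hμ]; ring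
    rw [mul_sub]
    linarith
  have hanti : AntitoneOn (fun t => Real.exp t * (relEnergy μ N (a t) - D')) (Set.Icc 0 T) := by
    have hd : ∀ s ∈ Set.Ioo 0 T, ∃ g : ℝ,
        HasDerivAt (fun t => Real.exp t * (relEnergy μ N (a t) - D')) g s ∧ g ≤ 0 := by
      intro s hs
      obtain ⟨Φ', h1, h2⟩ := hder s hs
      refine ⟨_, (Real.hasDerivAt_exp s).mul (h1.sub_const D'), ?_⟩
      have := Real.exp_pos s
      nlinarith
    refine antitoneOn_of_deriv_nonpos (convex_Icc 0 T)
      (Real.continuous_exp.continuousOn.mul (hcontP.sub continuousOn_const)) ?_ ?_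
    · rw [interior_Icc]
      intro s hs
      obtain ⟨g, hg, -⟩ := hd s hs
      exact hg.differentiableAt.differentiableWithinAt
    · rw [interior_Icc]
      intro s hs
      obtain ⟨g, hg, hg0⟩ := hd s hs
      rw [hg.deriv]
      exact hg0
  have h0T : (0 : ℝ) ∈ Set.Icc 0 T := ⟨le_rfl, hT⟩
  have hfin := hanti h0T ht ht.1
  simp only [Real.exp_zero, one_mul] at hfin
  have he : Real.exp (-t) * Real.exp t = 1 := by rw [← Real.exp_add]; simp
  have he1 : Real.exp (-t) ≤ 1 := Real.exp_le_one_iff.2 (by linarith [ht.1])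
  have he0 : 0 < Real.exp (-t) := Real.exp_pos _
  have hfin2 : relEnergy μ N (a t) - D' ≤ Real.exp (-t) * (relEnergy μ N (a 0) - D') := by
    calc relEnergy μ N (a t) - D' =
        Real.exp (-t) * (Real.exp t * (relEnergy μ N (a t) - D')) := by
          rw [← mul_assoc, he, one_mul]
      _ ≤ _ := mul_le_mul_of_nonneg_left hfin he0.le
  have hP0 := (abs_le.1 (hP 0 h0T)).1
  have hPt := (abs_le.1 (hP t ht)).2
  have hD0 : 0 ≤ D' := by positivity
  have hB0 : 0 ≤ B₁ ^ 2 := sq_nonneg _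
  have h8 : relEnergy μ N (a 0) - D' ≤ 3 / 2 * energy (a 0) + 2 * B₁ ^ 2 := by
    unfold relEnergy; linarith
  have h9 : Real.exp (-t) * (relEnergy μ N (a 0) - D') ≤
      Real.exp (-t) * (3 / 2 * energy (a 0)) + 2 * B₁ ^ 2 := by
    calc _ ≤ Real.exp (-t) * (3 / 2 * energy (a 0) + 2 * B₁ ^ 2) :=
          mul_le_mul_of_nonneg_left h8 he0.le
      _ = Real.exp (-t) * (3 / 2 * energy (a 0)) + Real.exp (-t) * (2 * B₁ ^ 2) := by ring
      _ ≤ _ := by nlinarith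
  have h10 : relEnergy μ N (a t) =
      energy (a t) - 2 * (axisSum N (background μ N) (a t)).re := rfl
  linarith

/-! ### Global existence and smoothing -/

/-- The sum of `(1 + |ξ|) / (1 + |ξ|⁴)`. -/
def decaySum : ℝ := ∑' ξ : ℤ × ℤ, (1 + freqNorm ξ) / wt ξ

theorem decay_nonneg (ξ : ℤ × ℤ) : 0 ≤ (1 + freqNorm ξ) / wt ξ :=
  div_nonneg (by linarith [freqNorm_nonneg ξ]) (wt_pos ξ).le

/-- The majorant on `[0, T]` of a mode with initial value `a₀` when the energy is at most `M`. -/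
def energyEnv (c K T M : ℝ) (a₀ : ℤ × ℤ → ℂ) (ξ : ℤ × ℤ) : ℝ :=
  Real.exp (K * T) * (‖a₀ ξ‖ + M / c * ((1 + freqNorm ξ) / wt ξ))

theorem summable_energyEnv (c K T M : ℝ) {a₀ : ℤ × ℤ → ℂ} (h : Summable fun ξ => ‖a₀ ξ‖) :
    Summable (energyEnv c K T M a₀) :=
  (h.add (summable_freqNorm_div_wt.mul_left _)).mul_left _

theorem tsum_energyEnv (c K T M : ℝ) {a₀ : ℤ × ℤ → ℂ} (h : Summable fun ξ => ‖a₀ ξ‖) :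
    ∑' ξ, energyEnv c K T M a₀ ξ = Real.exp (K * T) * (∑' ξ, ‖a₀ ξ‖ + M / c * decaySum) := by
  unfold energyEnv
  rw [tsum_mul_left, h.tsum_add (summable_freqNorm_div_wt.mul_left _), tsum_mul_left, decaySum]

section

variable {l : ℤ × ℤ → ℝ} {c K T : ℝ} {a b : ℝ → ℤ × ℤ → ℂ}

/-- A bound for the energy controls the modes in the Wiener algebra. -/
theorem norm_le_energyEnv (hl : IsParabolic l c K) {ξ : ℤ × ℤ} (hc : Continuous fun t => a t ξ)
    (hd : ∀ t ∈ Set.Ioo 0 T, HasDerivAt (fun s => a s ξ) (-(nl (a t) ξ + l ξ * a t ξ)) t)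
    {M : ℝ} (hs : ∀ t ∈ Set.Icc 0 T, Summable fun ξ => ‖a t ξ‖ ^ 2)
    (hM : ∀ t ∈ Set.Icc 0 T, energy (a t) ≤ M) {t : ℝ} (ht : t ∈ Set.Icc 0 T) :
    ‖a t ξ‖ ≤ energyEnv c K T M (a 0) ξ := by
  have hM0 : 0 ≤ M := (energy_nonneg _).trans (hM t ht)
  have h := norm_mode_le hl hc hd hM0 (fun s hs' =>
    (norm_conv_self_le (hs s (Set.Ioo_subset_Icc_self hs')) ξ).trans
      (hM s (Set.Ioo_subset_Icc_self hs'))) ht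
  have h1 : Real.exp (K * t) ≤ Real.exp (K * T) :=
    Real.exp_le_exp.2 (mul_le_mul_of_nonneg_left ht.2 hl.K_pos.le)
  have h2 := (hl.exp_neg_le ξ ht.1).trans h1
  have hw := wt_pos ξ
  have hr := freqNorm_nonneg ξ
  have hc := hl.c_pos
  refine h.trans ?_
  rw [energyEnv, mul_add]
  refine add_le_add (by gcongr) ?_
  have h3 : freqNorm ξ * M / (c * wt ξ) ≤ M / c * ((1 + freqNorm ξ) / wt ξ) := by
    rw [div_mul_div_comm, mul_comm (freqNorm ξ) M]
    gcongr
    linarith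
  gcongr

theorem ModeSol.summable_wt (hl : IsParabolic l c K) (ha : ModeSol l T a)
    (h0 : Summable fun ξ => wt ξ * ‖a 0 ξ‖ ^ 2) {t : ℝ} (ht : t ∈ Set.Icc 0 T) :
    Summable fun ξ => wt ξ * ‖a t ξ‖ ^ 2 := by
  obtain ⟨A, hA0, hA, haA⟩ := ha.exists_env hl h0
  exact Summable.of_nonneg_of_le (fun ξ => mul_nonneg (wt_pos ξ).le (sq_nonneg _)) (fun ξ =>
    mul_le_mul_of_nonneg_left (pow_le_pow_left₀ (norm_nonneg _) (haA t ht ξ) 2) (wt_pos ξ).le) hA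

/-- Global existence: the a priori bound keeps the local existence time bounded below. -/
theorem exists_modeSol (hl : IsParabolic l c K) {a₀ : ℤ × ℤ → ℂ} (h0 : IsOddReal a₀)
    (hs : Summable fun ξ => wt ξ * ‖a₀ ξ‖ ^ 2) (T : ℝ) : ∃ a, ModeSol l T a ∧ a 0 = a₀ := by
  obtain ⟨D, hD0, hD⟩ := exists_energy_le hl
  have hs1 := (summable_of_wt_sq (fun ξ => norm_nonneg (a₀ ξ)) hs).1
  set M := 3 * energy a₀ + D with hM
  have hM0 : 0 ≤ M := by have := energy_nonneg a₀; positivity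
  set T₀ := max T 0 with hT₀
  have hT00 : 0 ≤ T₀ := le_max_right _ _
  set R := ∑' ξ, energyEnv c K T₀ M a₀ ξ with hR
  have hc := hl.c_pos
  have hle0 : ∀ ξ, ‖a₀ ξ‖ ≤ energyEnv c K T₀ M a₀ ξ := fun ξ => by
    have h1 : 1 ≤ Real.exp (K * T₀) := Real.one_le_exp (mul_nonneg hl.K_pos.le hT00)
    have h2 := decay_nonneg ξ
    have h3 : 0 ≤ M / c * ((1 + freqNorm ξ) / wt ξ) := by positivity
    unfold energyEnv
    nlinarith [norm_nonneg (a₀ ξ)]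
  have hR0 : 0 ≤ R := tsum_nonneg fun ξ => (norm_nonneg _).trans (hle0 ξ)
  have henv := summable_energyEnv c K T₀ M hs1
  obtain ⟨τ, hτ, hloc⟩ := exists_local hl hR0
  have hstep : ∀ n : ℕ, n * τ ≤ T₀ → ∃ a, ModeSol l ((n + 1) * τ) a ∧ a 0 = a₀ := by
    intro n
    induction n with
    | zero =>
      intro _
      obtain ⟨a, ha, ha0⟩ := hloc a₀ hs1 (hs1.tsum_le_tsum hle0 henv)
      exact ⟨a, by simpa using ha, ha0⟩
    | succ n ih =>
      intro hn
      push_cast at hn ⊢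
      obtain ⟨a, ha, ha0⟩ := ih (by nlinarith)
      subst ha0
      set t₁ := ((n : ℝ) + 1) * τ with ht₁
      have ht₁0 : 0 < t₁ := by positivity
      have hen : ∀ t ∈ Set.Icc 0 t₁, energy (a t) ≤ M := fun t ht => by
        have h1 := hD t₁ a ha h0 hs t ht
        have h2 : Real.exp (-t) ≤ 1 := Real.exp_le_one_iff.2 (by linarith [ht.1])
        have h3 := energy_nonneg (a 0)
        nlinarith
      have hbd : ∀ ξ, ‖a t₁ ξ‖ ≤ energyEnv c K T₀ M (a 0) ξ := fun ξ => by
        refine (norm_le_energyEnv hl (ha.cont ξ) (ha.deriv ξ)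
          (fun t ht => summable_sq_of_wt (ha.summable_wt hl hs ht)) hen
          (Set.right_mem_Icc.2 ht₁0.le)).trans ?_
        have h1 : Real.exp (K * t₁) ≤ Real.exp (K * T₀) :=
          Real.exp_le_exp.2 (mul_le_mul_of_nonneg_left hn hl.K_pos.le)
        have h2 := decay_nonneg ξ
        unfold energyEnv
        gcongr
      obtain ⟨b, hb, hb0⟩ := hloc (a t₁) (ha.summable_norm t₁)
        ((ha.summable_norm t₁).tsum_le_tsum hbd henv)
      have hglue := ha.glue ht₁0 hb hb0
      rw [show t₁ + τ = (n + 1 + 1) * τ by rw [ht₁]; ring] at hglue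
      exact ⟨_, hglue, by simp only [if_pos ht₁0.le]⟩
  obtain ⟨a, ha, ha0⟩ := hstep ⌊T₀ / τ⌋₊ (by
    rw [← le_div_iff₀ hτ]; exact Nat.floor_le (by positivity))
  refine ⟨a, ha.mono ?_, ha0⟩
  have := Nat.lt_floor_add_one (T₀ / τ)
  rw [div_lt_iff₀ hτ] at this
  exact (le_max_left T 0).trans this.le

/-- Lipschitz dependence on the initial value in `H²`. -/
theorem exists_lipschitz (hl : IsParabolic l c K) {R : ℝ} (hR : 0 ≤ R) (T : ℝ) :
    ∃ L, 0 ≤ L ∧ ∀ (a b : ℝ → ℤ × ℤ → ℂ) (A B : ℤ × ℤ → ℝ),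
      ModeSol l T a → ModeSol l T b → Summable A → Summable B → ∑' ξ, A ξ ≤ R → ∑' ξ, B ξ ≤ R →
      (∀ t ∈ Set.Icc 0 T, ∀ ξ, ‖a t ξ‖ ≤ A ξ) → (∀ t ∈ Set.Icc 0 T, ∀ ξ, ‖b t ξ‖ ≤ B ξ) →
      (Summable fun ξ => wt ξ * ‖a 0 ξ - b 0 ξ‖ ^ 2) →
      ∀ t ∈ Set.Icc 0 T,
        ∑' ξ, wt ξ * ‖a t ξ - b t ξ‖ ^ 2 ≤ L * ∑' ξ, wt ξ * ‖a 0 ξ - b 0 ξ‖ ^ 2 := by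
  obtain ⟨μ, hμK, h⟩ := ModeSol.stability hl hR
  have hc := hl.c_pos
  have hμ0 : 0 ≤ μ := hl.K_pos.le.trans hμK
  set C₀ : ℝ := ∑' ξ, (wt ξ)⁻¹ with hC₀
  have hC₀0 : 0 ≤ C₀ := tsum_nonneg fun ξ => (inv_pos.2 (wt_pos ξ)).le
  refine ⟨2 * Real.exp (μ * T) ^ 2 * (1 + 1 / c ^ 2 * ((4 * R) ^ 2 * C₀)), by positivity,
    fun a b A B ha hb hA hB hAR hBR haA hbB hs t ht => ?_⟩
  have hT : 0 ≤ T := ht.1.trans ht.2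
  obtain ⟨V, hV0, hV, hVs, hle⟩ := h T a b A B hT ha hb hA hB hAR hBR haA hbB
  obtain ⟨hV2, hV2s⟩ := summable_sq_of_summable hV0 hV
  set X := ∑' ξ, wt ξ * ‖a 0 ξ - b 0 ξ‖ ^ 2 with hX
  have hd := (summable_of_wt_sq (fun ξ => norm_nonneg (a 0 ξ - b 0 ξ)) hs).2
  have he1 : Real.exp (K * t) ≤ Real.exp (μ * T) :=
    Real.exp_le_exp.2 (mul_le_mul hμK ht.2 ht.1 hμ0)
  have he2 : Real.exp (μ * t) ≤ Real.exp (μ * T) :=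
    Real.exp_le_exp.2 (mul_le_mul_of_nonneg_left ht.2 hμ0)
  have hpt : ∀ ξ, wt ξ * ‖a t ξ - b t ξ‖ ^ 2 ≤
      2 * Real.exp (μ * T) ^ 2 * (wt ξ * ‖a 0 ξ - b 0 ξ‖ ^ 2 + 1 / c ^ 2 * V ξ ^ 2) := by
    intro ξ
    have hw := wt_pos ξ
    have hr := freqNorm_nonneg ξ
    have hVξ := hV0 ξ
    have h1 : ‖a t ξ - b t ξ‖ ≤
        Real.exp (μ * T) * (‖a 0 ξ - b 0 ξ‖ + freqNorm ξ * V ξ / (c * wt ξ)) := by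
      rw [mul_add]
      refine (hle t ht ξ).trans (add_le_add (by gcongr) (by gcongr))
    have h2 : wt ξ * (freqNorm ξ * V ξ / (c * wt ξ)) ^ 2 ≤ 1 / c ^ 2 * V ξ ^ 2 := by
      have h2 := freqNorm_pow_le_wt ξ (k := 2) (by norm_num)
      have : wt ξ * (freqNorm ξ * V ξ / (c * wt ξ)) ^ 2 =
          1 / c ^ 2 * V ξ ^ 2 * (freqNorm ξ ^ 2 / wt ξ) := by field_simp
      rw [this]
      exact mul_le_of_le_one_right (by positivity) ((div_le_one hw).2 h2)
    calc wt ξ * ‖a t ξ - b t ξ‖ ^ 2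
        ≤ wt ξ * (Real.exp (μ * T) * (‖a 0 ξ - b 0 ξ‖ + freqNorm ξ * V ξ / (c * wt ξ))) ^ 2 := by
          gcongr
      _ = Real.exp (μ * T) ^ 2 * (wt ξ *
          (‖a 0 ξ - b 0 ξ‖ + freqNorm ξ * V ξ / (c * wt ξ)) ^ 2) := by ring
      _ ≤ Real.exp (μ * T) ^ 2 * (wt ξ *
          (2 * (‖a 0 ξ - b 0 ξ‖ ^ 2 + (freqNorm ξ * V ξ / (c * wt ξ)) ^ 2))) := by
          gcongr; exact add_sq_le
      _ = 2 * Real.exp (μ * T) ^ 2 * (wt ξ * ‖a 0 ξ - b 0 ξ‖ ^ 2 +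
          wt ξ * (freqNorm ξ * V ξ / (c * wt ξ)) ^ 2) := by ring
      _ ≤ _ := by gcongr
  have hsum := (hs.add (hV2.mul_left (1 / c ^ 2))).mul_left (2 * Real.exp (μ * T) ^ 2)
  have hst : Summable fun ξ => wt ξ * ‖a t ξ - b t ξ‖ ^ 2 :=
    Summable.of_nonneg_of_le (fun ξ => mul_nonneg (wt_pos ξ).le (sq_nonneg _)) hpt hsum
  refine (hst.tsum_le_tsum hpt hsum).trans ?_
  rw [tsum_mul_left, hs.tsum_add (hV2.mul_left _), tsum_mul_left, mul_assoc _ (1 + _) X]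
  have hVV : ∑' ξ, V ξ ^ 2 ≤ (4 * R) ^ 2 * (C₀ * X) := by
    have hV00 : 0 ≤ ∑' ξ, V ξ := tsum_nonneg hV0
    calc ∑' ξ, V ξ ^ 2 ≤ (∑' ξ, V ξ) ^ 2 := hV2s
      _ ≤ (4 * R * ∑' ξ, ‖a 0 ξ - b 0 ξ‖) ^ 2 := pow_le_pow_left₀ hV00 hVs 2
      _ = (4 * R) ^ 2 * (∑' ξ, ‖a 0 ξ - b 0 ξ‖) ^ 2 := mul_pow _ _ _
      _ ≤ _ := by gcongr
  refine mul_le_mul_of_nonneg_left ?_ (by positivity)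
  calc X + 1 / c ^ 2 * ∑' ξ, V ξ ^ 2 ≤ X + 1 / c ^ 2 * ((4 * R) ^ 2 * (C₀ * X)) := by gcongr
    _ = _ := by ring

/-- Smoothing: the states reached after time `2` along trajectories of bounded energy have a common
majorant in `H²`. Over `[1, 2]` the modes decay like `|ξ|⁻³`, which is summable; the Duhamel formula
then gains three more powers of `|ξ|`. -/
theorem exists_smoothing (hl : IsParabolic l c K) {M : ℝ} (hM : 0 ≤ M) :
    ∃ G : ℤ × ℤ → ℝ, (Summable fun ξ => wt ξ * G ξ ^ 2) ∧
      ∀ a : ℝ → ℤ × ℤ → ℂ, ModeSol l 2 a →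
        (∀ t ∈ Set.Icc (0 : ℝ) 2, Summable fun ξ => ‖a t ξ‖ ^ 2) →
        (∀ t ∈ Set.Icc (0 : ℝ) 2, energy (a t) ≤ M) → ∀ ξ, ‖a 2 ξ‖ ≤ G ξ := by
  have hc := hl.c_pos
  have hK := hl.K_pos
  have hw := wt_pos
  have hr := freqNorm_nonneg
  -- From time `1` on the linear semigroup gains a factor `(1 + |ξ|⁴)⁻¹`.
  have hexp : ∀ ξ, ∀ s, 1 ≤ s → s ≤ 2 → Real.exp (-l ξ * s) ≤ Real.exp (K * 2) * (1 / (c * wt ξ)) := by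
    intro ξ s hs1 hs2
    have hcw := mul_pos hc (hw ξ)
    have h1 : -l ξ * s ≤ K * 2 + -(c * wt ξ) := by nlinarith [hl.lower ξ]
    refine (Real.exp_le_exp.2 h1).trans ?_
    rw [Real.exp_add]
    have h2 : Real.exp (-(c * wt ξ)) ≤ 1 / (c * wt ξ) := by
      rw [Real.exp_neg, ← one_div]
      exact one_div_le_one_div_of_le hcw (by linarith [Real.add_one_le_exp (c * wt ξ)])
    gcongr
  set e := Real.exp (K * 2) with he
  have he0 : 0 < e := Real.exp_pos _
  set k := e * ((√M + M) / c) with hk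
  have hk0 : 0 ≤ k := by positivity
  let G₁ : ℤ × ℤ → ℝ := fun ξ => k * ((1 + freqNorm ξ) / wt ξ)
  have hG₁0 : ∀ ξ, 0 ≤ G₁ ξ := fun ξ => mul_nonneg hk0 (decay_nonneg ξ)
  have hG₁ : Summable G₁ := summable_freqNorm_div_wt.mul_left k
  have hH0 := conv_nonneg hG₁0 hG₁0
  have hH := summable_conv hG₁0 hG₁0 hG₁ hG₁
  refine ⟨fun ξ => e / c * ((G₁ ξ + freqNorm ξ * conv G₁ G₁ ξ) / wt ξ), ?_,
    fun a ha hs hE ξ => ?_⟩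
  · refine Summable.of_nonneg_of_le (fun ξ => mul_nonneg (hw ξ).le (sq_nonneg _)) (fun ξ => ?_)
      (((summable_sq_of_summable hG₁0 hG₁).1.add (summable_sq_of_summable hH0 hH).1).mul_left
        (2 * (e / c) ^ 2))
    have h1 := freqNorm_pow_le_wt ξ (k := 2) (by norm_num)
    have h2 := one_le_wt ξ
    have h3 : wt ξ * (e / c * ((G₁ ξ + freqNorm ξ * conv G₁ G₁ ξ) / wt ξ)) ^ 2 =
        (e / c) ^ 2 * ((G₁ ξ + freqNorm ξ * conv G₁ G₁ ξ) ^ 2 / wt ξ) := by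
      have := (hw ξ).ne'
      field_simp
    rw [h3, mul_comm 2, mul_assoc]
    refine mul_le_mul_of_nonneg_left ?_ (sq_nonneg _)
    rw [div_le_iff₀ (hw ξ)]
    calc (G₁ ξ + freqNorm ξ * conv G₁ G₁ ξ) ^ 2
        ≤ 2 * (G₁ ξ ^ 2 + (freqNorm ξ * conv G₁ G₁ ξ) ^ 2) := add_sq_le
      _ = 2 * (G₁ ξ ^ 2 * 1 + conv G₁ G₁ ξ ^ 2 * freqNorm ξ ^ 2) := by ring
      _ ≤ 2 * (G₁ ξ ^ 2 * wt ξ + conv G₁ G₁ ξ ^ 2 * wt ξ) := by gcongr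
      _ = _ := by ring
  · have h1 : ∀ s ∈ Set.Icc (1 : ℝ) 2, ∀ ξ, ‖a s ξ‖ ≤ G₁ ξ := by
      intro s hs' ξ
      have hsI : s ∈ Set.Icc (0 : ℝ) 2 := ⟨by linarith [hs'.1], hs'.2⟩
      have h2 := ha.norm_le hl (ξ := ξ) hM (fun t ht =>
        (norm_conv_self_le (hs t (Set.Ioo_subset_Icc_self ht)) ξ).trans
          (hE t (Set.Ioo_subset_Icc_self ht))) hsI
      have h3 : ‖a 0 ξ‖ ≤ √M := Real.le_sqrt_of_sq_le
        (((hs 0 ⟨le_rfl, by norm_num⟩).le_tsum ξ fun j _ => by positivity).trans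
          (hE 0 ⟨le_rfl, by norm_num⟩))
      have h4 : Real.exp (K * s) ≤ e := Real.exp_le_exp.2 (by nlinarith [hs'.2])
      have hwξ := hw ξ
      have hrξ := hr ξ
      calc ‖a s ξ‖ ≤ (e * (1 / (c * wt ξ))) * √M + e * (freqNorm ξ * M / (c * wt ξ)) := by
            refine h2.trans (add_le_add ?_ (by gcongr))
            exact mul_le_mul (hexp ξ s hs'.1 hs'.2) h3 (norm_nonneg _) (by positivity)
        _ = e * ((√M + freqNorm ξ * M) / (c * wt ξ)) := by ring
        _ ≤ e * (((√M + M) * (1 + freqNorm ξ)) / (c * wt ξ)) := by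
            gcongr
            nlinarith [mul_nonneg (Real.sqrt_nonneg M) hrξ]
        _ = G₁ ξ := by simp only [G₁, hk]; field_simp
    have ha1 := ha.shift (s := 1) (by norm_num)
    have h2 := ha1.norm_le hl (hH0 ξ) (fun t ht => by
      have h3 : ∀ ξ, ‖a (t + 1) ξ‖ ≤ G₁ ξ :=
        h1 (t + 1) ⟨by linarith [ht.1], by linarith [ht.2]⟩
      exact norm_conv_le hG₁ hG₁ h3 h3 ξ) (t := 1) ⟨by norm_num, by norm_num⟩
    rw [show (1 : ℝ) + 1 = 2 by norm_num, zero_add] at h2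
    have h4 : Real.exp (K * 1) ≤ e := Real.exp_le_exp.2 (by linarith)
    have hwξ := hw ξ
    have hrξ := hr ξ
    have hHξ := hH0 ξ
    calc ‖a 2 ξ‖ ≤ (e * (1 / (c * wt ξ))) * G₁ ξ + e * (freqNorm ξ * conv G₁ G₁ ξ / (c * wt ξ)) := by
          refine h2.trans (add_le_add ?_ (by gcongr))
          exact mul_le_mul (hexp ξ 1 le_rfl (by norm_num)) (h1 1 ⟨le_rfl, by norm_num⟩ ξ)
            (norm_nonneg _) (by positivity)
      _ = _ := by field_simp

theorem integral_exp_neg_mul_le {k T : ℝ} (hk : 0 < k) :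
    ∫ t in (0 : ℝ)..T, Real.exp (-k * t) ≤ 1 / k := by
  have h : ∫ t in (0 : ℝ)..T, Real.exp (-k * t) = (1 - Real.exp (-k * T)) / k := by
    rw [intervalIntegral.integral_comp_mul_left (fun x => Real.exp x) (neg_ne_zero.2 hk.ne'),
      integral_exp]
    simp
    field_simp
    ring
  rw [h]
  gcongr
  linarith [Real.exp_pos (-k * T)]

/-- Solutions with values in `H²` lie in `L²(0, T; H⁴)`. -/
theorem ModeSol.lintegral_lt_top (hl : IsParabolic l c K) (ha : ModeSol l T a) (hT : 0 < T)
    (h0 : Summable fun ξ => wt ξ * ‖a 0 ξ‖ ^ 2) :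
    ∫⁻ t in Set.Ioc 0 T, ∑' ξ : ℤ × ℤ, ENNReal.ofReal (freqNorm ξ ^ 8 * ‖a t ξ‖ ^ 2) < ∞ := by
  obtain ⟨A, hA0, hA, haA⟩ := ha.exists_env hl h0
  have hA1 := (summable_of_wt_sq hA0 hA).1
  have hc := hl.c_pos
  have hK := hl.K_pos
  have hcv := conv_nonneg hA0 hA0
  have hrA : Summable fun ξ => (freqNorm ξ * A ξ) ^ 2 := by
    simpa only [mul_pow] using summable_of_wt hA (k := 2) (by norm_num)
  have hrc := summable_freqNorm_conv_sq hA0 hA1 hrA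
  set e := Real.exp (K * T) with he
  have he0 : 0 < e := Real.exp_pos _
  let B : ℤ × ℤ → ℝ := fun ξ =>
    2 * e ^ 2 * (wt ξ * ‖a 0 ξ‖ ^ 2 * (1 / (2 * c)) +
      T * ((freqNorm ξ * conv A A ξ) ^ 2 * (1 / c ^ 2)))
  have hB : Summable B := ((h0.mul_right _).add ((hrc.mul_right _).mul_left T)).mul_left _
  have hB0 : ∀ ξ, 0 ≤ B ξ := fun ξ => by
    have := wt_pos ξ
    positivity
  have hmode : ∀ ξ, ∫⁻ t in Set.Ioc 0 T, ENNReal.ofReal (freqNorm ξ ^ 8 * ‖a t ξ‖ ^ 2) ≤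
      ENNReal.ofReal (B ξ) := by
    intro ξ
    have hw := wt_pos ξ
    have hr := freqNorm_nonneg ξ
    have hcw := mul_pos hc hw
    have h4 := freqNorm_pow_le_wt ξ (k := 4) le_rfl
    have h8 : freqNorm ξ ^ 8 ≤ wt ξ ^ 2 := by
      rw [show freqNorm ξ ^ 8 = (freqNorm ξ ^ 4) ^ 2 by ring]
      gcongr
    let g : ℝ → ℝ := fun t => 2 * e ^ 2 * (wt ξ ^ 2 * ‖a 0 ξ‖ ^ 2 * Real.exp (-(2 * (c * wt ξ)) * t)
      + (freqNorm ξ * conv A A ξ) ^ 2 * (1 / c ^ 2))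
    have hg : Continuous g := by fun_prop
    have hle : ∀ t ∈ Set.Icc 0 T, freqNorm ξ ^ 8 * ‖a t ξ‖ ^ 2 ≤ g t := by
      intro t ht
      have h1 := ha.norm_le hl (hcv ξ) (fun s hs => norm_conv_le hA1 hA1
        (haA s (Set.Ioo_subset_Icc_self hs)) (haA s (Set.Ioo_subset_Icc_self hs)) ξ) ht
      have h2 : Real.exp (K * t) ≤ e :=
        Real.exp_le_exp.2 (mul_le_mul_of_nonneg_left ht.2 hK.le)
      have h3 : Real.exp (-l ξ * t) ≤ e * Real.exp (-(c * wt ξ) * t) := by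
        rw [he, ← Real.exp_add]
        refine Real.exp_le_exp.2 ?_
        nlinarith [mul_le_mul_of_nonneg_right (hl.lower ξ) ht.1,
          mul_le_mul_of_nonneg_left ht.2 hK.le]
      have h5 : ‖a t ξ‖ ≤ e * (Real.exp (-(c * wt ξ) * t) * ‖a 0 ξ‖ +
          freqNorm ξ * conv A A ξ / (c * wt ξ)) := by
        have := hcv ξ
        rw [mul_add, ← mul_assoc]
        exact h1.trans (add_le_add (by gcongr) (by gcongr))
      have h6 : Real.exp (-(c * wt ξ) * t) ^ 2 = Real.exp (-(2 * (c * wt ξ)) * t) := by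
        rw [← Real.exp_nat_mul]; congr 1; push_cast; ring
      calc freqNorm ξ ^ 8 * ‖a t ξ‖ ^ 2 ≤ wt ξ ^ 2 * (e * (Real.exp (-(c * wt ξ) * t) * ‖a 0 ξ‖ +
          freqNorm ξ * conv A A ξ / (c * wt ξ))) ^ 2 := by gcongr
        _ = wt ξ ^ 2 * e ^ 2 * (Real.exp (-(c * wt ξ) * t) * ‖a 0 ξ‖ +
          freqNorm ξ * conv A A ξ / (c * wt ξ)) ^ 2 := by ring
        _ ≤ wt ξ ^ 2 * e ^ 2 * (2 * ((Real.exp (-(c * wt ξ) * t) * ‖a 0 ξ‖) ^ 2 +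
          (freqNorm ξ * conv A A ξ / (c * wt ξ)) ^ 2)) := by gcongr; exact add_sq_le
        _ = g t := by
          simp only [g]
          rw [mul_pow, h6]
          field_simp
    calc ∫⁻ t in Set.Ioc 0 T, ENNReal.ofReal (freqNorm ξ ^ 8 * ‖a t ξ‖ ^ 2)
        ≤ ∫⁻ t in Set.Ioc 0 T, ENNReal.ofReal (g t) :=
          setLIntegral_mono' measurableSet_Ioc fun t ht =>
            ENNReal.ofReal_le_ofReal (hle t (Set.Ioc_subset_Icc_self ht))
      _ = ENNReal.ofReal (∫ t in Set.Ioc 0 T, g t) := by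
          rw [ofReal_integral_eq_lintegral_ofReal]
          · exact hg.integrableOn_Ioc
          · filter_upwards with t
            simp only [g, Pi.zero_apply]
            positivity
      _ ≤ ENNReal.ofReal (B ξ) := by
          refine ENNReal.ofReal_le_ofReal ?_
          rw [← intervalIntegral.integral_of_le hT.le]
          simp only [g, B]
          rw [intervalIntegral.integral_const_mul, intervalIntegral.integral_add
            (Continuous.intervalIntegrable (by fun_prop) _ _) (by simp),
            intervalIntegral.integral_const_mul, intervalIntegral.integral_const]
          have hI := integral_exp_neg_mul_le (k := 2 * (c * wt ξ)) (T := T) (by positivity)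
          rw [sub_zero, smul_eq_mul]
          refine mul_le_mul_of_nonneg_left (add_le_add ?_ le_rfl) (by positivity)
          calc _ ≤ wt ξ ^ 2 * ‖a 0 ξ‖ ^ 2 * (1 / (2 * (c * wt ξ))) := by gcongr
            _ = _ := by field_simp
  rw [lintegral_tsum fun ξ => ?_]
  · refine (ENNReal.tsum_le_tsum hmode).trans_lt ?_
    rw [← ENNReal.ofReal_tsum_of_nonneg hB0 hB]
    exact ENNReal.ofReal_lt_top
  · have := ha.cont ξ
    exact (Continuous.measurable (by fun_prop)).ennreal_ofReal.aemeasurable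

end

/-! ### Fourier coefficients of functions in `H²` -/

/-- The Fourier coefficients of a function in `H²`. -/
def H2.coef (u : H2) (ξ : ℤ × ℤ) : ℂ := fcoeff u.toL2 ξ

theorem one_le_freqNorm {ξ : ℤ × ℤ} (h : ξ ≠ 0) : 1 ≤ freqNorm ξ := by
  have h1 : 1 ≤ freqNorm ξ ^ 2 := by
    rw [freqNorm_sq]
    have h2 : (1 : ℤ) ≤ ξ.1 ^ 2 + ξ.2 ^ 2 := by
      by_contra! hlt
      have h3 : ξ.1 = 0 := by nlinarith [sq_nonneg ξ.1, sq_nonneg ξ.2]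
      have h4 : ξ.2 = 0 := by nlinarith [sq_nonneg ξ.1, sq_nonneg ξ.2]
      exact h (Prod.ext h3 h4)
    exact_mod_cast h2
  nlinarith [freqNorm_nonneg ξ]

namespace H2

theorem coef_sub (u v : H2) (ξ : ℤ × ℤ) : (u - v).coef ξ = u.coef ξ - v.coef ξ := by
  have h := fcoeff_add (u - v).toL2 v.toL2 ξ
  rw [← map_add, sub_add_cancel] at h
  exact eq_sub_of_add_eq h.symm

theorem coef_injective : Function.Injective coef := fun _ _ h =>
  toL2_injective (fcoeff_injective fun ξ => congrFun h ξ)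

theorem summable_sq (u : H2) : Summable fun ξ => ‖u.coef ξ‖ ^ 2 := by
  refine (u.isH2.add (hasSum_pi_single (0 : ℤ × ℤ) (‖u.coef 0‖ ^ 2)).summable).of_nonneg_of_le
    (fun ξ => sq_nonneg _) fun ξ => ?_
  by_cases h : ξ = 0
  · subst h
    simp [freqNorm]
  · have h1 : 1 ≤ freqNorm ξ ^ 4 := one_le_pow₀ (one_le_freqNorm h)
    rw [Pi.single_eq_of_ne h, add_zero]
    exact le_mul_of_one_le_left (sq_nonneg _) h1

theorem summable_wt (u : H2) : Summable fun ξ => wt ξ * ‖u.coef ξ‖ ^ 2 := by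
  simp only [wt, add_mul, one_mul]
  exact u.summable_sq.add u.isH2

theorem summable_norm (u : H2) : Summable fun ξ => ‖u.coef ξ‖ :=
  (summable_of_wt_sq (fun _ => norm_nonneg _) u.summable_wt).1

theorem norm_sq_eq (u : H2) : ‖u‖ ^ 2 = (2 * Real.pi) ^ 2 * ∑' ξ, wt ξ * ‖u.coef ξ‖ ^ 2 := by
  rw [H2.norm_sq, L2.norm_sq_eq_tsum u.toL2 u.summable_norm, ← mul_add]
  congr 1
  simp only [wt, add_mul, one_mul]
  exact (u.summable_sq.tsum_add u.isH2).symm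

theorem tsum_wt_le (u : H2) : ∑' ξ, wt ξ * ‖u.coef ξ‖ ^ 2 ≤ ‖u‖ ^ 2 := by
  rw [norm_sq_eq]
  refine le_mul_of_one_le_left (tsum_nonneg fun ξ => mul_nonneg (wt_pos ξ).le (sq_nonneg _)) ?_
  exact one_le_pow₀ (by linarith [Real.pi_gt_three])

theorem energy_coef_le (u : H2) : energy u.coef ≤ ‖u‖ ^ 2 :=
  (u.summable_sq.tsum_le_tsum (fun ξ => le_mul_of_one_le_left (sq_nonneg _) (one_le_wt ξ))
    u.summable_wt).trans u.tsum_wt_le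

theorem norm_coef_le (u : H2) (ξ : ℤ × ℤ) : ‖u.coef ξ‖ ≤ ‖u‖ := by
  refine (sq_le_sq₀ (norm_nonneg _) (norm_nonneg _)).1 (le_trans ?_ u.energy_coef_le)
  exact u.summable_sq.le_tsum ξ fun _ _ => sq_nonneg _

theorem continuous_coef (ξ : ℤ × ℤ) : Continuous fun u : H2 => u.coef ξ := by
  refine (LipschitzWith.of_dist_le_mul (K := 1) fun u v => ?_).continuous
  rw [dist_eq_norm, dist_eq_norm, ← coef_sub, NNReal.coe_one, one_mul]
  exact norm_coef_le _ ξ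

/-- Convergence of every Fourier coefficient under a common majorant is convergence in `H²`. -/
theorem tendsto_of_coef {α : Type*} {F : Filter α} {u : α → H2} {v : H2} {A : ℤ × ℤ → ℝ}
    (hA : Summable fun ξ => wt ξ * A ξ ^ 2) (hle : ∀ᶠ x in F, ∀ ξ, ‖(u x).coef ξ‖ ≤ A ξ)
    (h : ∀ ξ, Tendsto (fun x => (u x).coef ξ) F (𝓝 (v.coef ξ))) : Tendsto u F (𝓝 v) := by
  have h1 : Tendsto (fun x => ∑' ξ, wt ξ * ‖(u x - v).coef ξ‖ ^ 2) F
      (𝓝 (∑' ξ : ℤ × ℤ, wt ξ * ‖v.coef ξ - v.coef ξ‖ ^ 2)) := by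
    simp only [coef_sub]
    refine tendsto_tsum_of_dominated_convergence
      (bound := fun ξ => 2 * (wt ξ * A ξ ^ 2 + wt ξ * ‖v.coef ξ‖ ^ 2))
      ((hA.add v.summable_wt).mul_left 2)
      (fun ξ => (((h ξ).sub tendsto_const_nhds).norm.pow 2).const_mul _) ?_
    filter_upwards [hle] with x hx ξ
    have hw := wt_pos ξ
    rw [Real.norm_eq_abs, abs_of_nonneg (by positivity), ← mul_add, mul_left_comm]
    refine mul_le_mul_of_nonneg_left ?_ hw.le
    have h2 := norm_sub_le ((u x).coef ξ) (v.coef ξ)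
    have h3 := hx ξ
    have h4 := norm_nonneg ((u x).coef ξ - v.coef ξ)
    nlinarith [sq_nonneg (A ξ - ‖v.coef ξ‖)]
  simp only [sub_self, norm_zero, ne_eq, OfNat.ofNat_ne_zero, not_false_eq_true, zero_pow,
    mul_zero, tsum_zero] at h1
  rw [tendsto_iff_norm_sub_tendsto_zero]
  have h5 : Tendsto (fun x => ‖u x - v‖ ^ 2) F (𝓝 0) := by
    simp only [norm_sq_eq]
    simpa using h1.const_mul ((2 * Real.pi) ^ 2)
  have h6 := (Real.continuous_sqrt.tendsto 0).comp h5
  simpa [Function.comp_def] using h6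

end H2

/-- The sequences of the Fourier coefficients of the functions in `H²_od`. -/
structure IsOddH2 (a : ℤ × ℤ → ℂ) : Prop where
  isOddReal : IsOddReal a
  summable : Summable fun ξ => wt ξ * ‖a ξ‖ ^ 2

theorem IsOddH2.summable_norm {a : ℤ × ℤ → ℂ} (h : IsOddH2 a) : Summable fun ξ => ‖a ξ‖ :=
  (summable_of_wt_sq (fun _ => norm_nonneg _) h.summable).1

theorem isOddH2_coef (u : H2od) : IsOddH2 (u : H2).coef :=
  ⟨⟨fun ξ => fcoeff_neg _ ξ, (odd_iff_fcoeff _ (u : H2).summable_norm).1 u.2⟩,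
    (u : H2).summable_wt⟩

theorem exists_coef_eq {a : ℤ × ℤ → ℂ} (h : IsOddH2 a) : ∃ u : H2od, (u : H2).coef = a := by
  have hc : ∀ ξ, fcoeff (synthL2 a h.summable_norm) ξ = a ξ :=
    fcoeff_synthL2 h.summable_norm h.isOddReal.herm
  have h2 : IsH2 (synthL2 a h.summable_norm) := by
    refine h.summable.of_nonneg_of_le (fun ξ => by positivity) fun ξ => ?_
    rw [hc]
    exact mul_le_mul_of_nonneg_right (by simp [wt]) (sq_nonneg _)
  let u : H2 := ⟨synthL2 a h.summable_norm, h2⟩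
  have hu : u.coef = a := funext hc
  refine ⟨⟨u, (odd_iff_fcoeff _ u.summable_norm).2 fun ξ => ?_⟩, hu⟩
  change u.coef _ = -u.coef ξ
  rw [hu]
  exact h.isOddReal.odd ξ

open Classical in
/-- The function in `H²_od` with Fourier coefficients `a`, and `0` if there is none. -/
def ofCoef (a : ℤ × ℤ → ℂ) : H2od := if h : IsOddH2 a then (exists_coef_eq h).choose else 0

theorem coef_ofCoef {a : ℤ × ℤ → ℂ} (h : IsOddH2 a) : (ofCoef a : H2).coef = a := by
  rw [ofCoef, dif_pos h]
  exact (exists_coef_eq h).choose_spec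

theorem ofCoef_coef (u : H2od) : ofCoef (u : H2).coef = u :=
  Subtype.ext (H2.coef_injective (coef_ofCoef (isOddH2_coef u)))

/-- The functions in `H²_od` whose Fourier coefficients have a given square-summable majorant form a
compact set. -/
theorem isCompact_setOf_coef_le {G : ℤ × ℤ → ℝ} (hG : Summable fun ξ => wt ξ * G ξ ^ 2) :
    IsCompact {u : H2od | ∀ ξ, ‖(u : H2).coef ξ‖ ≤ G ξ} := by
  set Q : Set (ℤ × ℤ → ℂ) := Set.univ.pi (fun ξ => Metric.closedBall 0 (G ξ)) ∩
    {a | IsOddReal a} with hQ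
  have hodd : IsClosed {a : ℤ × ℤ → ℂ | IsOddReal a} := by
    have h1 : {a : ℤ × ℤ → ℂ | IsOddReal a} =
        (⋂ ξ, {a : ℤ × ℤ → ℂ | a (-ξ) = star (a ξ)}) ∩
          ⋂ ξ : ℤ × ℤ, {a : ℤ × ℤ → ℂ | a (-ξ.1, ξ.2) = -a ξ} := by
      ext a
      simp only [Set.mem_inter_iff, Set.mem_iInter, Set.mem_ofPred_eq]
      exact ⟨fun h => ⟨h.herm, h.odd⟩, fun h => ⟨h.1, h.2⟩⟩
    rw [h1]
    refine (isClosed_iInter fun ξ => ?_).inter (isClosed_iInter fun ξ => ?_)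
    · exact isClosed_eq (continuous_apply _) (continuous_star.comp (continuous_apply _))
    · exact isClosed_eq (f := fun a : ℤ × ℤ → ℂ => a (-ξ.1, ξ.2)) (continuous_apply _)
        (continuous_apply ξ).neg
  have hQc : IsCompact Q :=
    (isCompact_univ_pi fun ξ => isCompact_closedBall 0 (G ξ)).inter_right hodd
  have hle : ∀ a ∈ Q, ∀ ξ, ‖a ξ‖ ≤ G ξ := fun a ha ξ => by simpa using ha.1 ξ (Set.mem_univ ξ)
  have hst : ∀ a ∈ Q, IsOddH2 a := fun a ha => ⟨ha.2, hG.of_nonneg_of_le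
    (fun ξ => mul_nonneg (wt_pos ξ).le (sq_nonneg _)) fun ξ => mul_le_mul_of_nonneg_left
      (pow_le_pow_left₀ (norm_nonneg _) (hle a ha ξ) 2) (wt_pos ξ).le⟩
  -- `Q` carries the topology of coefficientwise convergence, which on it is convergence in `H²`.
  have hcont : ContinuousOn ofCoef Q := by
    intro a ha
    refine tendsto_subtype_rng.2 (H2.tendsto_of_coef hG ?_ fun ξ => ?_)
    · filter_upwards [self_mem_nhdsWithin] with b hb ξ
      rw [coef_ofCoef (hst b hb)]
      exact hle b hb ξ
    · rw [coef_ofCoef (hst a ha)]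
      refine ((continuous_apply ξ).tendsto a |>.mono_left nhdsWithin_le_nhds).congr' ?_
      filter_upwards [self_mem_nhdsWithin] with b hb
      rw [coef_ofCoef (hst b hb)]
  convert hQc.image_of_continuousOn hcont using 1
  ext u
  refine ⟨fun h => ⟨(u : H2).coef, ⟨fun ξ _ => by simpa using h ξ, (isOddH2_coef u).isOddReal⟩,
    ofCoef_coef u⟩, ?_⟩
  rintro ⟨a, ha, rfl⟩ ξ
  rw [coef_ofCoef (hst a ha)]
  exact hle a ha ξ

/-! ### Global attractors from compact absorbing sets -/

/-- A set that attracts all bounded sets and is invariant under the semiflow is connected when it is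
compact: it lies in a ball, which is connected, and the images of the ball shrink to it. -/
theorem AttractsBounded.isPreconnected {X : Type*} [NormedAddCommGroup X] [NormedSpace ℝ X]
    {S : ℝ → X → X} (hS : IsSemiflow S) {A : Set X} (hA : IsCompact A)
    (hinv : ∀ t, 0 ≤ t → S t '' A = A) (hatt : AttractsBounded S A) : IsPreconnected A := by
  rw [isPreconnected_iff_subset_of_disjoint_closed]
  intro u v hu hv huv hd
  by_contra! hcon
  obtain ⟨h1, h2⟩ := hcon
  obtain ⟨x, hxA, hxu⟩ := Set.not_subset.1 h1
  obtain ⟨y, hyA, hyv⟩ := Set.not_subset.1 h2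
  have hxv : x ∈ v := (huv hxA).resolve_left hxu
  have hyu : y ∈ u := (huv hyA).resolve_right hyv
  have hdis : Disjoint (A ∩ u) (A ∩ v) := by
    rw [Set.disjoint_iff_inter_eq_empty, ← hd]; ext z; simp; tauto
  obtain ⟨r, hr, hdr⟩ := hdis.exists_thickenings (hA.inter_right hu) (hA.inter_right hv).isClosed
  obtain ⟨R, hR⟩ := hA.isBounded.subset_ball 0
  obtain ⟨T, hT⟩ := hatt _ (Metric.isBounded_ball (x := (0 : X)) (r := R)) r hr
  have ht : (0 : ℝ) ≤ max T 0 := le_max_right _ _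
  have hpre : IsPreconnected (S (max T 0) '' Metric.ball 0 R) :=
    (convex_ball (0 : X) R).isPreconnected.image _ (hS.continuous _ ht).continuousOn
  have hsub : A ⊆ S (max T 0) '' Metric.ball 0 R := by
    conv_lhs => rw [← hinv _ ht]
    exact Set.image_mono hR
  have hcov : S (max T 0) '' Metric.ball 0 R ⊆
      Metric.thickening r (A ∩ u) ∪ Metric.thickening r (A ∩ v) := by
    rw [← Metric.thickening_union, ← Set.inter_union_distrib_left, Set.inter_eq_left.2 huv]
    exact hT _ (le_max_left _ _)
  obtain ⟨z, _, hz⟩ := hpre _ _ Metric.isOpen_thickening Metric.isOpen_thickening hcov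
    ⟨y, hsub hyA, Metric.self_subset_thickening hr _ ⟨hyA, hyu⟩⟩
    ⟨x, hsub hxA, Metric.self_subset_thickening hr _ ⟨hxA, hxv⟩⟩
  exact Set.disjoint_left.1 hdr hz.1 hz.2

theorem AttractsBounded.isAttractor {X : Type*} [PseudoMetricSpace X] {S : ℝ → X → X} {A : Set X}
    (hinv : ∀ t, 0 ≤ t → S t '' A = A) (hatt : AttractsBounded S A) : IsAttractor S A := by
  refine ⟨hinv, Set.univ, isOpen_univ, Set.subset_univ _, fun u _ => ?_⟩
  rw [ENNReal.tendsto_nhds_zero]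
  intro e he
  obtain ⟨r, hr0, hre⟩ : ∃ r : ℝ, 0 < r ∧ ENNReal.ofReal r ≤ e := by
    rcases eq_or_ne e ∞ with rfl | h
    · exact ⟨1, one_pos, le_top⟩
    · exact ⟨e.toReal, ENNReal.toReal_pos he.ne' h, ENNReal.ofReal_toReal_le⟩
  obtain ⟨T, hT⟩ := hatt {u} Bornology.isBounded_singleton r hr0
  filter_upwards [eventually_ge_atTop T] with t ht
  have := hT t ht ⟨u, rfl, rfl⟩
  exact (Metric.mem_thickening_iff_infEDist_lt.1 this).le.trans hre

/-- A semiflow with a compact set `K` that absorbs all bounded sets has a global attractor: the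
intersection of the sets `S t K` over the times `t` after which `K` is mapped into itself. -/
theorem IsSemiflow.exists_globalAttractor {X : Type*} [NormedAddCommGroup X] [NormedSpace ℝ X]
    {S : ℝ → X → X} (hS : IsSemiflow S) {K : Set X} (hK : IsCompact K)
    (habs : ∀ B : Set X, Bornology.IsBounded B → ∃ T : ℝ, ∀ t, T ≤ t → S t '' B ⊆ K) :
    ∃ A : Set X, IsCompact A ∧ IsConnected A ∧ AttractsBounded S A ∧
      IsGreatest {A' : Set X | Bornology.IsBounded A' ∧ IsAttractor S A'} A := by
  obtain ⟨T₁, hT₁⟩ := habs K hK.isBounded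
  obtain ⟨T₀, hT₀, hself⟩ : ∃ T : ℝ, 0 ≤ T ∧ ∀ t, T ≤ t → S t '' K ⊆ K :=
    ⟨max T₁ 0, le_max_right _ _, fun t ht => hT₁ t ((le_max_left _ _).trans ht)⟩
  have hne : K.Nonempty := by
    obtain ⟨T, hT⟩ := habs {0} Bornology.isBounded_singleton
    exact ⟨S T 0, hT T le_rfl ⟨0, rfl, rfl⟩⟩
  let ι := Set.Ici T₀
  have : Nonempty ι := ⟨⟨T₀, Set.mem_Ici.2 le_rfl⟩⟩
  let V : ι → Set X := fun s => S s '' K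
  have hι : ∀ s : ι, (0 : ℝ) ≤ s := fun s => hT₀.trans s.2
  have hVc : ∀ s, IsCompact (V s) := fun s => hK.image (hS.continuous s (hι s))
  have hmono : ∀ s s' : ι, (s : ℝ) + T₀ ≤ s' → V s' ⊆ V s := by
    rintro s s' h _ ⟨k, hk, rfl⟩
    refine ⟨S (s' - s) k, hself _ (by linarith) ⟨k, hk, rfl⟩, ?_⟩
    rw [← hS.add _ _ (hι s) (by linarith), add_sub_cancel]
  have hdir : ∀ s s' : ι, ∃ z : ι, (s : ℝ) + T₀ ≤ z ∧ (s' : ℝ) + T₀ ≤ z := fun s s' =>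
    ⟨⟨s + s' + T₀, Set.mem_Ici.2 (by linarith [hι s, hι s'])⟩,
      by linarith [hι s'], by linarith [hι s]⟩
  have hVd : Directed (· ⊇ ·) V := fun s s' => by
    obtain ⟨z, h1, h2⟩ := hdir s s'
    exact ⟨z, hmono _ _ h1, hmono _ _ h2⟩
  set A : Set X := ⋂ s, V s with hAdef
  have hAne : A.Nonempty := IsCompact.nonempty_iInter_of_directed_nonempty_isCompact_isClosed V hVd
    (fun s => hne.image _) hVc (fun s => (hVc s).isClosed)
  have hAc : IsCompact A := (hVc ⟨T₀, Set.mem_Ici.2 le_rfl⟩).of_isClosed_subset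
    (isClosed_iInter fun s => (hVc s).isClosed) (Set.iInter_subset _ _)
  have hinv : ∀ t, 0 ≤ t → S t '' A = A := by
    intro t ht
    apply Set.Subset.antisymm
    · rintro _ ⟨x, hx, rfl⟩
      refine Set.mem_iInter.2 fun s => ?_
      obtain ⟨k, hk, rfl⟩ := Set.mem_iInter.1 hx
        ⟨s + T₀, Set.mem_Ici.2 (by linarith [hι s])⟩
      refine ⟨S (t + T₀) k, hself _ (by linarith) ⟨k, hk, rfl⟩, ?_⟩
      rw [← hS.add _ _ (hι s) (by linarith), ← hS.add _ _ ht (by linarith [hι s])]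
      congr 1
      ring
    · intro y hy
      -- A preimage of `y` under `S t` exists in every `V s`, hence by compactness in `A`.
      let C : ι → Set X := fun s => V s ∩ S t ⁻¹' {y}
      have hcl : IsClosed (S t ⁻¹' {y}) := isClosed_singleton.preimage (hS.continuous t ht)
      have hC : (⋂ s, C s).Nonempty := by
        refine IsCompact.nonempty_iInter_of_directed_nonempty_isCompact_isClosed C ?_ ?_
          (fun s => (hVc s).inter_right hcl) (fun s => (hVc s).isClosed.inter hcl)
        · intro s s'
          obtain ⟨z, h1, h2⟩ := hVd s s'
          exact ⟨z, Set.inter_subset_inter_left _ h1, Set.inter_subset_inter_left _ h2⟩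
        · intro s
          obtain ⟨k, hk, hky⟩ := Set.mem_iInter.1 hy
            ⟨t + s, Set.mem_Ici.2 (by linarith [Set.mem_Ici.1 s.2])⟩
          refine ⟨S s k, ⟨k, hk, rfl⟩, ?_⟩
          simpa [← hS.add _ _ ht (hι s)] using hky
      obtain ⟨x, hx⟩ := hC
      rw [Set.mem_iInter] at hx
      exact ⟨x, Set.mem_iInter.2 fun s => (hx s).1, (hx ⟨T₀, Set.mem_Ici.2 le_rfl⟩).2⟩
  have hatt : AttractsBounded S A := by
    intro B hB r hr
    obtain ⟨s, hs⟩ := exists_subset_nhds_of_isCompact hVd hVc (U := Metric.thickening r A)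
      (fun x hx => Metric.isOpen_thickening.mem_nhds (Metric.self_subset_thickening hr _ hx))
    obtain ⟨T, hT⟩ := habs B hB
    refine ⟨s + max T 0, fun t ht => ?_⟩
    have h0 : 0 ≤ max T 0 := le_max_right _ _
    rintro _ ⟨b, hb, rfl⟩
    refine hs ⟨S (t - s) b, hT _ (by linarith [le_max_left T 0]) ⟨b, hb, rfl⟩, ?_⟩
    rw [← hS.add _ _ (hι s) (by linarith), add_sub_cancel]
  refine ⟨A, hAc, ⟨hAne, hatt.isPreconnected hS hAc hinv⟩, hatt,
    ⟨hAc.isBounded, hatt.isAttractor hinv⟩, ?_⟩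
  rintro A' ⟨hb, hA'⟩ x hx
  rw [← hAc.isClosed.closure_eq, Metric.closure_eq_iInter_thickening]
  refine Set.mem_iInter₂.2 fun r hr => ?_
  obtain ⟨T, hT⟩ := hatt A' hb r hr
  refine hT (max T 0) (le_max_left _ _) ?_
  rwa [hA'.invariant _ (le_max_right _ _)]

/-! ### The semiflow -/

/-- A family of maps of `H²_od` whose orbits have Fourier coefficients that solve the equation. -/
structure IsModeFlow (l : ℤ × ℤ → ℝ) (S : ℝ → H2od → H2od) : Prop where
  zero : ∀ u : H2od, S 0 u = u
  modeSol : ∀ (u : H2od) (T : ℝ), 0 < T → ∃ a, ModeSol l T a ∧ a 0 = (u : H2).coef ∧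
    ∀ t ∈ Set.Icc 0 T, (S t u : H2).coef = a t

theorem exists_isModeFlow {l : ℤ × ℤ → ℝ} {c K : ℝ} (hl : IsParabolic l c K) :
    ∃ S, IsModeFlow l S := by
  have h (u : H2od) (T : ℝ) := exists_modeSol hl (isOddH2_coef u).isOddReal (u : H2).summable_wt T
  choose a ha ha0 using h
  have hgood : ∀ (u : H2od) (T : ℝ), ∀ t ∈ Set.Icc 0 T, IsOddH2 (a u T t) := fun u T t ht =>
    ⟨(ha u T).isOddReal hl (ht.1.trans ht.2) (ha0 u T ▸ (isOddH2_coef u).isOddReal) t ht,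
      (ha u T).summable_wt hl (ha0 u T ▸ (u : H2).summable_wt) ht⟩
  have hmem : ∀ t : ℝ, 0 ≤ t → t ∈ Set.Icc 0 (t + 1) := fun t ht => ⟨ht, by linarith⟩
  -- The state at time `t` is read off from the solution on `[0, t + 1]`; by uniqueness any other
  -- interval would give the same.
  refine ⟨fun t u => ofCoef (a u (t + 1) t), fun u => ?_, fun u T hT =>
    ⟨a u T, ha u T, ha0 u T, fun t ht => ?_⟩⟩
  · rw [ha0, ofCoef_coef]
  · rw [coef_ofCoef (hgood u _ t (hmem t ht.1))]
    exact ((ha u (t + 1)).mono (by linarith)).unique hl ht.1 ((ha u T).mono ht.2)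
      ((ha0 u _).trans (ha0 u _).symm) t (Set.right_mem_Icc.2 ht.1)

namespace IsModeFlow

variable {l : ℤ × ℤ → ℝ} {c K : ℝ} {S : ℝ → H2od → H2od}

theorem add (hl : IsParabolic l c K) (hS : IsModeFlow l S) {s t : ℝ} (hs : 0 ≤ s) (ht : 0 ≤ t)
    (u : H2od) : S (s + t) u = S s (S t u) := by
  obtain ⟨a, ha, -, haS⟩ := hS.modeSol u (s + 1 + t) (by positivity)
  obtain ⟨b, hb, hb0, hbS⟩ := hS.modeSol (S t u) (s + 1) (by positivity)
  have h := ((ha.shift ht).mono (by linarith)).unique hl (by positivity) hb (by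
    simp only [zero_add]
    rw [hb0, haS t ⟨ht, by linarith⟩]) s ⟨hs, by linarith⟩
  refine Subtype.ext (H2.coef_injective ?_)
  rw [haS (s + t) ⟨by positivity, by linarith⟩, hbS s ⟨hs, by linarith⟩]
  exact h

theorem continuousOn (hl : IsParabolic l c K) (hS : IsModeFlow l S) (u : H2od) :
    ContinuousOn (fun t => (S t u : H2)) (Set.Ici 0) := by
  intro t ht
  have ht : 0 ≤ t := ht
  obtain ⟨a, ha, ha0, haS⟩ := hS.modeSol u (t + 1) (by positivity)
  obtain ⟨A, -, hA, hle⟩ := ha.exists_env hl (ha0 ▸ (u : H2).summable_wt)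
  have hmem : Set.Icc 0 (t + 1) ∈ 𝓝[Set.Ici 0] t := by
    rw [← Set.Ici_inter_Iic]
    exact inter_mem self_mem_nhdsWithin (mem_nhdsWithin_of_mem_nhds (Iic_mem_nhds (by linarith)))
  refine H2.tendsto_of_coef hA ?_ fun ξ => ?_
  · filter_upwards [hmem] with s hs ξ
    rw [haS s hs]
    exact hle s hs ξ
  · rw [haS t ⟨ht, by linarith⟩]
    refine (((ha.cont ξ).tendsto t).mono_left nhdsWithin_le_nhds).congr' ?_
    filter_upwards [hmem] with s hs
    rw [haS s hs]

end IsModeFlow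

/-- The equation of `IsSolution`, in terms of convolutions. -/
theorem nl_coef (u : H2) (ξ : ℤ × ℤ) :
    Complex.I * (ξ.1 : ℂ) / 2 * fcoeff (fun z => u.toL2 z ^ 2) ξ = nl u.coef ξ := by
  rw [fcoeff_sq u.toL2 u.summable_norm, nl]
  rfl

section

variable {β δ ε c K : ℝ} {S : ℝ → H2od → H2od}

theorem IsModeFlow.isSolution (hl : IsParabolic (linSymbol β δ ε) c K)
    (hS : IsModeFlow (linSymbol β δ ε) S) (u : H2od) :
    IsSolution β δ ε u (fun t => (S t u : H2)) := by
  refine ⟨by simp only [hS.zero], hS.continuousOn hl u, fun T hT => ?_, fun ξ t ht => ?_⟩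
  · obtain ⟨a, ha, ha0, haS⟩ := hS.modeSol u T hT
    refine lt_of_eq_of_lt ?_ (ha.lintegral_lt_top hl hT (ha0 ▸ (u : H2).summable_wt))
    refine setLIntegral_congr_fun measurableSet_Ioc fun t ht => ?_
    have h := haS t ⟨ht.1.le, ht.2⟩
    simp only [← h, H2.coef]
  · obtain ⟨a, ha, ha0, haS⟩ := hS.modeSol u (t + 1) (by positivity)
    have h := ha.deriv ξ t ⟨ht, by linarith⟩
    rw [nl_coef]
    rw [← haS t ⟨ht.le, by linarith⟩] at h
    refine h.congr_of_eventuallyEq ?_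
    filter_upwards [Icc_mem_nhds ht (lt_add_one t)] with s hs
    rw [← haS s hs]
    rfl

/-- Every solution with values in `H²`, stopped at the ends of `[0, T]`, is given by a family of
modes: it is bounded in `L²` on `[0, T]`, and this already provides a summable majorant. -/
theorem IsSolution.modeSol (hl : IsParabolic (linSymbol β δ ε) c K) {u : H2} {v : ℝ → H2}
    (hv : IsSolution β δ ε u v) {T : ℝ} (hT : 0 < T) :
    ModeSol (linSymbol β δ ε) T fun t => (v (clamp T t)).coef := by
  have hcont : Continuous fun t => v (clamp T t) :=
    hv.continuousOn.comp_continuous (continuous_clamp T) fun t => (clamp_mem hT.le t).1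
  have hc (ξ : ℤ × ℤ) : Continuous fun t => (v (clamp T t)).coef ξ :=
    (H2.continuous_coef ξ).comp hcont
  have hd : ∀ ξ, ∀ t ∈ Set.Ioo 0 T, HasDerivAt (fun s => (v (clamp T s)).coef ξ)
      (-(nl (v (clamp T t)).coef ξ + linSymbol β δ ε ξ * (v (clamp T t)).coef ξ)) t := by
    intro ξ t ht
    have h := hv.equation ξ t ht.1
    rw [nl_coef] at h
    rw [clamp_of_mem (Set.Ioo_subset_Icc_self ht)]
    refine h.congr_of_eventuallyEq ?_
    filter_upwards [Icc_mem_nhds ht.1 ht.2] with s hs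
    rw [clamp_of_mem hs]
    rfl
  obtain ⟨M, hM⟩ := (isCompact_Icc (a := (0 : ℝ)) (b := T)).exists_bound_of_continuousOn
    (f := fun t => v (clamp T t)) hcont.continuousOn
  have henv := fun t (ht : t ∈ Set.Icc 0 T) ξ =>
    norm_le_energyEnv hl (hc ξ) (hd ξ) (M := M ^ 2) (fun t _ => H2.summable_sq _)
      (fun t ht => (H2.energy_coef_le _).trans (pow_le_pow_left₀ (norm_nonneg _) (hM t ht) 2)) ht
  refine ⟨hc, ⟨_, summable_energyEnv c K T (M ^ 2) (H2.summable_norm (v (clamp T 0))),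
    fun t ξ => ?_⟩, hd⟩
  have h := henv (clamp T t) (clamp_mem hT.le t) ξ
  rwa [clamp_of_mem (clamp_mem hT.le t)] at h

theorem IsModeFlow.isSolutionOperator (hl : IsParabolic (linSymbol β δ ε) c K)
    (hS : IsModeFlow (linSymbol β δ ε) S) : IsSolutionOperator β δ ε S := by
  refine fun u => ⟨hS.isSolution hl u, fun v hv t ht => H2.coef_injective ?_⟩
  obtain ⟨a, ha, ha0, haS⟩ := hS.modeSol u (t + 1) (by positivity)
  have hmem : t ∈ Set.Icc 0 (t + 1) := ⟨ht, by linarith⟩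
  have h := (hv.modeSol hl (T := t + 1) (by positivity)).unique hl (by positivity) ha (by
    simp only [clamp_of_mem (Set.left_mem_Icc.2 (by positivity : (0 : ℝ) ≤ t + 1)), hv.initial, ha0])
    t hmem
  rw [haS t hmem, ← h, clamp_of_mem hmem]

end

namespace IsModeFlow

variable {l : ℤ × ℤ → ℝ} {c K : ℝ} {S : ℝ → H2od → H2od}

theorem exists_energy_le (hl : IsParabolic l c K) (hS : IsModeFlow l S) :
    ∃ D, 0 ≤ D ∧ ∀ (u : H2od) (t : ℝ), 0 ≤ t →
      energy (S t u : H2).coef ≤ 3 * Real.exp (-t) * ‖u‖ ^ 2 + D := by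
  obtain ⟨D, hD0, hD⟩ := NonlocalKS.exists_energy_le hl
  refine ⟨D, hD0, fun u t ht => ?_⟩
  obtain ⟨a, ha, ha0, haS⟩ := hS.modeSol u (t + 1) (by positivity)
  have hmem : t ∈ Set.Icc 0 (t + 1) := ⟨ht, by linarith⟩
  have h := hD _ a ha (ha0 ▸ (isOddH2_coef u).isOddReal) (ha0 ▸ (u : H2).summable_wt) t hmem
  rw [← haS t hmem, ha0] at h
  refine h.trans ?_
  gcongr
  exact H2.energy_coef_le _

/-- On bounded sets of initial values the modes have majorants with a common sum, so that the
solutions depend on the initial value in a Lipschitz way. -/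
theorem exists_norm_sub_le (hl : IsParabolic l c K) (hS : IsModeFlow l S) (ρ : ℝ) {t : ℝ}
    (ht : 0 ≤ t) : ∃ L, ∀ u v : H2od, ‖u‖ ≤ ρ → ‖v‖ ≤ ρ → ‖S t u - S t v‖ ^ 2 ≤ L * ‖u - v‖ ^ 2 := by
  obtain ⟨D, hD0, hD⟩ := hS.exists_energy_le hl
  have hc := hl.c_pos
  set T := t + 1 with hT
  set M := 3 * ρ ^ 2 + D with hM
  set C₀ := ∑' ξ : ℤ × ℤ, (wt ξ)⁻¹ with hC₀
  set R := Real.exp (K * T) * (√(C₀ * ρ ^ 2) + M / c * decaySum) with hR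
  have hC₀0 : 0 ≤ C₀ := tsum_nonneg fun ξ => (inv_pos.2 (wt_pos ξ)).le
  have hR0 : 0 ≤ R := by
    have : 0 ≤ decaySum := tsum_nonneg decay_nonneg
    positivity
  obtain ⟨L, hL0, hL⟩ := exists_lipschitz hl hR0 T
  have key : ∀ u : H2od, ‖u‖ ≤ ρ → ∃ a A, ModeSol l T a ∧ a 0 = (u : H2).coef ∧
      (∀ s ∈ Set.Icc 0 T, (S s u : H2).coef = a s) ∧ Summable A ∧ ∑' ξ, A ξ ≤ R ∧
      ∀ s ∈ Set.Icc 0 T, ∀ ξ, ‖a s ξ‖ ≤ A ξ := by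
    intro u hu
    obtain ⟨a, ha, ha0, haS⟩ := hS.modeSol u T (by positivity)
    refine ⟨a, energyEnv c K T M (a 0), ha, ha0, haS,
      summable_energyEnv c K T M (ha.summable_norm 0), ?_, fun s hs ξ =>
        norm_le_energyEnv hl (ha.cont ξ) (ha.deriv ξ) (fun r hr => ?_) (fun r hr => ?_) hs⟩
    · rw [tsum_energyEnv c K T M (ha.summable_norm 0), hR, ha0]
      have h1 : ∑' ξ, ‖(u : H2).coef ξ‖ ≤ √(C₀ * ρ ^ 2) := by
        refine Real.le_sqrt_of_sq_le ?_
        refine (summable_of_wt_sq (fun _ => norm_nonneg _) (u : H2).summable_wt).2.trans ?_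
        refine mul_le_mul_of_nonneg_left ((u : H2).tsum_wt_le.trans ?_) hC₀0
        exact pow_le_pow_left₀ (norm_nonneg _) hu 2
      gcongr
    · rw [← haS r hr]
      exact H2.summable_sq _
    · rw [← haS r hr]
      have h1 := hD u r hr.1
      have h2 : Real.exp (-r) ≤ 1 := Real.exp_le_one_iff.2 (by linarith [hr.1])
      have h3 : ‖u‖ ^ 2 ≤ ρ ^ 2 := pow_le_pow_left₀ (norm_nonneg _) hu 2
      have h4 : Real.exp (-r) * ‖u‖ ^ 2 ≤ 1 * ρ ^ 2 := by gcongr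
      linarith
  refine ⟨L, fun u v hu hv => ?_⟩
  obtain ⟨a, A, ha, ha0, haS, hA, hAR, haA⟩ := key u hu
  obtain ⟨b, B, hb, hb0, hbS, hB, hBR, hbB⟩ := key v hv
  have hmem : t ∈ Set.Icc 0 T := ⟨ht, by linarith⟩
  have hn : ∀ u v : H2od, ‖u - v‖ ^ 2 =
      (2 * Real.pi) ^ 2 * ∑' ξ, wt ξ * ‖(u : H2).coef ξ - (v : H2).coef ξ‖ ^ 2 := fun u v => by
    simp only [← H2.coef_sub]
    exact H2.norm_sq_eq ((u : H2) - v)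
  have h := hL a b A B ha hb hA hB hAR hBR haA hbB (by
    simp only [ha0, hb0, ← H2.coef_sub]
    exact H2.summable_wt _) t hmem
  rw [hn, hn, haS t hmem, hbS t hmem, ← ha0, ← hb0, mul_left_comm]
  exact mul_le_mul_of_nonneg_left h (by positivity)

theorem isSemiflow (hl : IsParabolic l c K) (hS : IsModeFlow l S) : IsSemiflow S := by
  refine ⟨hS.zero, fun s t hs ht u => hS.add hl hs ht u, fun t ht => ?_⟩
  rw [continuous_iff_continuousAt]
  intro u
  obtain ⟨L, hL⟩ := hS.exists_norm_sub_le hl (‖u‖ + 1) ht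
  rw [ContinuousAt, tendsto_iff_norm_sub_tendsto_zero]
  have h1 : Tendsto (fun v => √(L * ‖v - u‖ ^ 2)) (𝓝 u) (𝓝 0) := by
    have : Continuous fun v => √(L * ‖v - u‖ ^ 2) := by fun_prop
    simpa using this.tendsto u
  refine squeeze_zero' (Eventually.of_forall fun _ => norm_nonneg _) ?_ h1
  filter_upwards [Metric.ball_mem_nhds u one_pos] with v hv
  refine Real.le_sqrt_of_sq_le (hL v u ?_ (by linarith))
  have h2 := norm_le_norm_add_norm_sub u v
  rw [Metric.mem_ball, dist_comm, dist_eq_norm] at hv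
  linarith

/-- After the energy has become bounded by a constant, two more units of time bring the modes below
a fixed majorant in `H²`. -/
theorem exists_isCompact_absorbing (hl : IsParabolic l c K) (hS : IsModeFlow l S) :
    ∃ Q : Set H2od, IsCompact Q ∧
      ∀ B, Bornology.IsBounded B → ∃ T, ∀ t, T ≤ t → S t '' B ⊆ Q := by
  obtain ⟨D, hD0, hD⟩ := hS.exists_energy_le hl
  obtain ⟨G, hG, hGle⟩ := exists_smoothing hl (M := D + 1) (by positivity)
  refine ⟨_, isCompact_setOf_coef_le hG, fun B hB => ?_⟩
  obtain ⟨ρ, hρ⟩ := hB.exists_norm_le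
  have hlim : Tendsto (fun t => 3 * Real.exp (-t) * ρ ^ 2) atTop (𝓝 0) := by
    simpa using (Real.tendsto_exp_neg_atTop_nhds_zero.const_mul 3).mul_const (ρ ^ 2)
  obtain ⟨T, hT⟩ := eventually_atTop.1 (hlim.eventually (gt_mem_nhds one_pos))
  refine ⟨max T 0 + 2, fun t ht => ?_⟩
  rintro _ ⟨u, hu, rfl⟩ ξ
  have h1 := le_max_left T 0
  have h2 := le_max_right T 0
  -- Split off the last two units of time, during which the energy is at most `D + 1`.
  have hsplit : ∀ s, 0 ≤ s → S (s + (t - 2)) u = S s (S (t - 2) u) := fun s hs =>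
    hS.add hl hs (by linarith) u
  obtain ⟨a, ha, -, haS⟩ := hS.modeSol (S (t - 2) u) 2 two_pos
  have h := hGle a ha (fun s hs => haS s hs ▸ H2.summable_sq _) (fun s hs => ?_) ξ
  · rw [← haS 2 ⟨by norm_num, le_rfl⟩, ← hsplit 2 (by norm_num), add_sub_cancel] at h
    exact h
  · rw [← haS s hs, ← hsplit s hs.1]
    have h3 := hD u (s + (t - 2)) (by linarith [hs.1])
    have h4 := hT (s + (t - 2)) (by linarith [hs.1])
    have h5 : ‖u‖ ^ 2 ≤ ρ ^ 2 := pow_le_pow_left₀ (norm_nonneg _) (hρ u hu) 2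
    have h6 := mul_le_mul_of_nonneg_left h5 (by positivity : 0 ≤ 3 * Real.exp (-(s + (t - 2))))
    linarith

end IsModeFlow

end NonlocalKS

end

theorem mainTheorem5 (β δ ε : ℝ) (hβ : 0 < β) (hδ : 0 ≤ δ) (hε : 0 < ε) :
    ∃ S : ℝ → NonlocalKS.H2od → NonlocalKS.H2od,
      NonlocalKS.IsSolutionOperator β δ ε S ∧
      NonlocalKS.IsSemiflow S ∧
      ∃ A : Set NonlocalKS.H2od,
        IsCompact A ∧
        IsConnected A ∧
        NonlocalKS.AttractsBounded S A ∧
        IsGreatest {A' : Set NonlocalKS.H2od |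
          Bornology.IsBounded A' ∧ NonlocalKS.IsAttractor S A'} A := by
  obtain ⟨c, K, hl⟩ := NonlocalKS.exists_isParabolic_linSymbol β hδ hε
  obtain ⟨S, hS⟩ := NonlocalKS.exists_isModeFlow hl
  obtain ⟨Q, hQ, habs⟩ := hS.exists_isCompact_absorbing hl
  exact ⟨S, hS.isSolutionOperator hl, hS.isSemiflow hl,
    (hS.isSemiflow hl).exists_globalAttractor hQ habs⟩
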